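/- Let $(M,g)$ be a compact smooth Riemannian manifold (without boundary) of dimension $n\ge 5$, with Riemannian volume $dv_g$, and let $a\in L^r(M)$, $b\in L^s(M)$ be real functions with $r>\frac n2$, $s>\frac n4$. Let $H_2^2(M)$ be the completion of $C^\infty(M)$ for the standard norm $\|u\|_{2,2}=\|u\|_2+\|\nabla u\|_2+\|\nabla^2u\|_2$, and put $$\|u\|_{H_2^2(M)}=\Big(\int_M\big((\Delta_gu)^2+|\nabla_gu|^2+u^2\big)\,dv_g\Big)^{1/2}.$$ Let $P_gu=\Delta_g^2u+\operatorname{div}_g(a\nabla_gu)+bu$, understood in the weak sense on $H_2^2(M)$, that is $$\int_M vP_g(u)\,dv_g=\int_M\big(\Delta_gu\,\Delta_gv-a\langle\nabla_gu,\nabla_gv\rangle+buv\big)\,dv_g ,$$ and call $P_g$ coercive if there is $\Lambda>0$ such that $\int_M uP_g(u)\,dv_g\ge\Lambda\|u\|_{H_2^2(M)}^2$ for every $u\in H_2^2(M)$. Then for every $u\in H_2^2(M)$ the functions $u^2$, $|\nabla_gu|^2$, $|\nabla_g^2u|^2$, $(\Delta_gu)^2$, $a|\nabla_gu|^2$ and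 $bu^2$ are integrable, and the following are equivalent: (i) $\int_M\big(|\Delta_gu|^2-a|\nabla_gu|^2+bu^2\big)\,dv_g\ge0$ for every $u\in H_2^2(M)$, and $$\|u\|=\Big(\int_M\big(|\Delta_gu|^2-a(x)|\nabla_gu|^2+b(x)u^2\big)\,dv_g\Big)^{1/2}$$ is a norm on $H_2^2(M)$ which is equivalent to the standard norm $\|\cdot\|_{2,2}$; (ii) $P_g$ is coercive. -/

import Mathlib

open MeasureTheory Filter
open scoped Manifold ContDiff Topology ENNReal

noncomputable section

namespace SobolevH22

/-! ### Local Riemannian geometry in charts -/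

/-- The model space `ℝⁿ`. -/
abbrev Model (n : ℕ) : Type := EuclideanSpace ℝ (Fin n)

/-- The partial derivative `∂ᵢ f (y)` of a function on `ℝⁿ`. -/
def partialDeriv {n : ℕ} (i : Fin n) (f : Model n → ℝ) (y : Model n) : ℝ :=
  fderiv ℝ f y (EuclideanSpace.single i 1)

section Geometry

variable {n : ℕ} {M : Type*} [TopologicalSpace M] [ChartedSpace (Model n) M]
  [IsManifold (𝓡 n) ∞ M]

/-- The smooth Riemannian metrics on `M`. -/
abbrev SmoothMetric (n : ℕ) (M : Type*) [TopologicalSpace M] [ChartedSpace (Model n) M]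
    [IsManifold (𝓡 n) ∞ M] : Type _ :=
  Bundle.ContMDiffRiemannianMetric (𝓡 n) ∞ (Model n) (fun x : M => TangentSpace (𝓡 n) x)

/-- The coordinate vector `∂ᵢ` of the chart at `p`, at the point with coordinates `y`. -/
def coordVec (p : M) (y : Model n) (i : Fin n) :
    TangentSpace (𝓡 n) ((chartAt (Model n) p).symm y) :=
  mfderiv (𝓡 n) (𝓡 n) (chartAt (Model n) p).symm y
    (EuclideanSpace.single i (1 : ℝ) : Model n)

/-- The matrix `g_{ij}` of the metric in the chart at `p`, at the point with coordinates `y`. -/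
def gram (g : SmoothMetric n M) (p : M) (y : Model n) : Matrix (Fin n) (Fin n) ℝ :=
  Matrix.of fun i j =>
    g.inner ((chartAt (Model n) p).symm y) (coordVec p y i) (coordVec p y j)

/-- The Christoffel symbol
`Γᵏ_{ij} = ½ ∑ₗ g^{kl} (∂ᵢ g_{jl} + ∂ⱼ g_{il} - ∂ₗ g_{ij})` in the chart at `p`. -/
def christoffel (g : SmoothMetric n M) (p : M) (y : Model n) (k i j : Fin n) : ℝ :=
  (1 / 2) * ∑ l, (gram g p y)⁻¹ k l *
    (partialDeriv i (fun z => gram g p z j l) y + partialDeriv j (fun z => gram g p z i l) y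
      - partialDeriv l (fun z => gram g p z i j) y)

/-- The expression `φ ∘ e⁻¹` of a function in the chart `e` at `p`. -/
def inChart (φ : M → ℝ) (p : M) : Model n → ℝ := fun y => φ ((chartAt (Model n) p).symm y)

/-- The components `∂ᵢ φ` of `∇φ` (as a covector) in the chart at `p`. -/
def localGrad (φ : M → ℝ) (p : M) (y : Model n) : Fin n → ℝ :=
  fun i => partialDeriv i (inChart φ p) y

/-- The components `(∇²φ)_{ij} = ∂ᵢ∂ⱼφ - ∑ₖ Γᵏ_{ij} ∂ₖφ` of the covariant Hessian
in the chart at `p`. -/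
def localHess (g : SmoothMetric n M) (φ : M → ℝ) (p : M) (y : Model n) :
    Matrix (Fin n) (Fin n) ℝ :=
  Matrix.of fun i j => partialDeriv i (partialDeriv j (inChart φ p)) y
    - ∑ k, christoffel g p y k i j * partialDeriv k (inChart φ p) y

/-! ### The Riemannian volume measure -/

/-- The measure `√(det g_{ij}) dy` of the chart at `p`, transported to `M`: the Riemannian
volume restricted to the domain of that chart. -/
def chartVolume [MeasurableSpace M] (g : SmoothMetric n M) (p : M) : Measure M :=
  Measure.map (chartAt (Model n) p).symm
    ((volume.restrict (chartAt (Model n) p).target).withDensity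
      (fun y => ENNReal.ofReal (Real.sqrt (gram g p y).det)))

/-- The Riemannian volume measure `dv_g`: the least measure that dominates its restrictions
to all chart domains. -/
def vol [MeasurableSpace M] (g : SmoothMetric n M) : Measure M := ⨆ p : M, chartVolume g p

/-! ### Second order jets -/

/-- A triple `(s, ξ, η)`: a number, a covector and a covariant 2-tensor at a point `x`, the last
two given by their components in the chart `chartAt (Model n) x`. -/
abbrev Jet (n : ℕ) : Type := ℝ × (Fin n → ℝ) × Matrix (Fin n) (Fin n) ℝ

/-- The matrix `g_{ij}(x)` in the chart `chartAt (Model n) x`. -/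
def gramAt (g : SmoothMetric n M) (x : M) : Matrix (Fin n) (Fin n) ℝ :=
  gram g x (chartAt (Model n) x x)

/-- The scalar product `∑ g^{ij} ξᵢ ζⱼ` of covectors at `x`. -/
def covInner (g : SmoothMetric n M) (x : M) (ξ ζ : Fin n → ℝ) : ℝ :=
  ∑ i, ∑ j, (gramAt g x)⁻¹ i j * ξ i * ζ j

/-- The squared norm `∑ g^{ik} g^{jl} η_{ij} η_{kl}` of a covariant 2-tensor at `x`. -/
def tensorSq (g : SmoothMetric n M) (x : M) (η : Matrix (Fin n) (Fin n) ℝ) : ℝ :=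
  ∑ i, ∑ j, ∑ k, ∑ l, (gramAt g x)⁻¹ i k * (gramAt g x)⁻¹ j l * η i j * η k l

/-- The trace `∑ g^{ij} η_{ij}` of a covariant 2-tensor at `x`. -/
def tensorTrace (g : SmoothMetric n M) (x : M) (η : Matrix (Fin n) (Fin n) ℝ) : ℝ :=
  ∑ i, ∑ j, (gramAt g x)⁻¹ i j * η i j

/-- `|s|² + |ξ|²_g + |η|²_g`. -/
def jetSq (g : SmoothMetric n M) (x : M) (J : Jet n) : ℝ :=
  J.1 ^ 2 + covInner g x J.2.1 J.2.1 + tensorSq g x J.2.2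

/-- The jet `(φ, ∇φ, ∇²φ)` of a function. -/
def jet (g : SmoothMetric n M) (φ : M → ℝ) : M → Jet n := fun x =>
  (φ x, localGrad φ x (chartAt (Model n) x x), localHess g φ x (chartAt (Model n) x x))

end Geometry

/-! ### Upper integrals -/

/-- The upper integral of a function that need not be measurable: the infimum of the integrals
of its measurable majorants (for measurable functions this is the usual integral). -/
def upperLIntegral {X : Type*} [MeasurableSpace X] (μ : Measure X) (f : X → ℝ≥0∞) : ℝ≥0∞ :=
  ⨅ F : {F : X → ℝ≥0∞ // Measurable F ∧ ∀ x, f x ≤ F x}, ∫⁻ x, F.1 x ∂μ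

theorem upperLIntegral_zero {X : Type*} [MeasurableSpace X] (μ : Measure X) :
    upperLIntegral μ (fun _ => 0) = 0 := by
  refine le_antisymm ?_ zero_le
  refine (iInf_le _ ⟨fun _ => 0, measurable_const, fun _ => le_rfl⟩).trans ?_
  simp

/-- The upper integral is sublinear. -/
theorem upperLIntegral_le {X : Type*} [MeasurableSpace X] (μ : Measure X) {f f₁ f₂ : X → ℝ≥0∞}
    {c : ℝ≥0∞} (hc : c ≠ ⊤) (h : ∀ x, f x ≤ c * f₁ x + c * f₂ x) :
    upperLIntegral μ f ≤ c * upperLIntegral μ f₁ + c * upperLIntegral μ f₂ := by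
  have i1 : Nonempty {F : X → ℝ≥0∞ // Measurable F ∧ ∀ x, f₁ x ≤ F x} :=
    ⟨⟨fun _ => ⊤, measurable_const, fun _ => le_top⟩⟩
  have i2 : Nonempty {F : X → ℝ≥0∞ // Measurable F ∧ ∀ x, f₂ x ≤ F x} :=
    ⟨⟨fun _ => ⊤, measurable_const, fun _ => le_top⟩⟩
  rw [upperLIntegral, upperLIntegral, upperLIntegral, ENNReal.mul_iInf (by simp [hc]),
    ENNReal.mul_iInf (by simp [hc])]
  refine ENNReal.le_iInf_add_iInf ?_
  rintro ⟨F, hF, hF'⟩ ⟨G, hG, hG'⟩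
  refine (iInf_le _ ⟨fun x => c * F x + c * G x, by fun_prop, fun x => (h x).trans ?_⟩).trans ?_
  · simp only
    rw [lintegral_add_left (hF.const_mul c), lintegral_const_mul _ hF, lintegral_const_mul _ hG]
  · exact add_le_add (mul_le_mul_right (hF' x) c) (mul_le_mul_right (hG' x) c)

/-! ### Helper facts: linearity of jets, positivity of the norms -/

section Helpers

variable {n : ℕ} {M : Type*} [TopologicalSpace M] [ChartedSpace (Model n) M]
  [IsManifold (𝓡 n) ∞ M]

theorem gram_posSemidef (g : SmoothMetric n M) (p : M) (y : Model n) :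
    (gram g p y).PosSemidef := by
  refine Matrix.PosSemidef.of_dotProduct_mulVec_nonneg ?_ ?_
  · ext i j
    simp only [Matrix.conjTranspose_apply, gram, Matrix.of_apply, star_trivial]
    exact g.symm _ _ _
  · intro v
    have key : star v ⬝ᵥ Matrix.mulVec (gram g p y) v =
        g.inner ((chartAt (Model n) p).symm y) (∑ i, v i • coordVec p y i)
          (∑ i, v i • coordVec p y i) := by
      simp only [dotProduct, Matrix.mulVec, gram, Matrix.of_apply, map_sum, map_smul,
        _root_.sum_apply, _root_.smul_apply, Pi.star_apply,
        star_trivial, smul_eq_mul, Finset.mul_sum]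
      rw [Finset.sum_comm]
      refine Finset.sum_congr rfl fun i _ => Finset.sum_congr rfl fun j _ => ?_
      ring
    rw [key]
    by_cases hv : (∑ i, v i • coordVec p y i) = 0
    · rw [hv]; simp
    · exact (g.pos _ _ hv).le

theorem covInner_self_nonneg (g : SmoothMetric n M) (x : M) (ξ : Fin n → ℝ) :
    0 ≤ covInner g x ξ ξ := by
  have h := (gram_posSemidef g x (chartAt (Model n) x x)).inv.dotProduct_mulVec_nonneg ξ
  refine h.trans_eq ?_
  simp only [dotProduct, Matrix.mulVec, covInner, gramAt, Pi.star_apply, star_trivial,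
    Finset.mul_sum]
  refine Finset.sum_congr rfl fun i _ => Finset.sum_congr rfl fun j _ => ?_
  ring

theorem tensorSq_nonneg (g : SmoothMetric n M) (x : M) (η : Matrix (Fin n) (Fin n) ℝ) :
    0 ≤ tensorSq g x η := by
  have hG := (gram_posSemidef g x (chartAt (Model n) x x)).inv
  have h := (hG.kronecker hG).dotProduct_mulVec_nonneg (fun q => η q.1 q.2)
  refine h.trans_eq ?_
  simp only [dotProduct, Matrix.mulVec, tensorSq, gramAt, Pi.star_apply, star_trivial,
    Finset.mul_sum, Fintype.sum_prod_type, Matrix.kroneckerMap_apply]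
  refine Finset.sum_congr rfl fun i _ => Finset.sum_congr rfl fun j _ =>
    Finset.sum_congr rfl fun k _ => Finset.sum_congr rfl fun l _ => ?_
  ring

theorem jetSq_nonneg (g : SmoothMetric n M) (x : M) (J : Jet n) : 0 ≤ jetSq g x J :=
  add_nonneg (add_nonneg (sq_nonneg _) (covInner_self_nonneg g x _)) (tensorSq_nonneg g x _)

theorem jetSq_smul (g : SmoothMetric n M) (x : M) (c : ℝ) (J : Jet n) :
    jetSq g x (c • J) = c ^ 2 * jetSq g x J := by
  simp only [jetSq, covInner, tensorSq, Prod.smul_fst, Prod.smul_snd, Pi.smul_apply,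
    Matrix.smul_apply, smul_eq_mul, mul_add, Finset.mul_sum, mul_pow]
  congr 1
  · congr 1
    exact Finset.sum_congr rfl fun i _ => Finset.sum_congr rfl fun j _ => by ring
  · exact Finset.sum_congr rfl fun i _ => Finset.sum_congr rfl fun j _ =>
      Finset.sum_congr rfl fun k _ => Finset.sum_congr rfl fun l _ => by ring

theorem jetSq_parallelogram (g : SmoothMetric n M) (x : M) (J K : Jet n) :
    jetSq g x (J + K) + jetSq g x (J - K) = 2 * jetSq g x J + 2 * jetSq g x K := by
  have h1 : covInner g x (J.2.1 + K.2.1) (J.2.1 + K.2.1)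
      + covInner g x (J.2.1 - K.2.1) (J.2.1 - K.2.1)
      = 2 * covInner g x J.2.1 J.2.1 + 2 * covInner g x K.2.1 K.2.1 := by
    simp only [covInner, Finset.mul_sum, ← Finset.sum_add_distrib, Pi.add_apply, Pi.sub_apply]
    exact Finset.sum_congr rfl fun i _ => Finset.sum_congr rfl fun j _ => by ring
  have h2 : tensorSq g x (J.2.2 + K.2.2) + tensorSq g x (J.2.2 - K.2.2)
      = 2 * tensorSq g x J.2.2 + 2 * tensorSq g x K.2.2 := by
    simp only [tensorSq, Finset.mul_sum, ← Finset.sum_add_distrib, Matrix.add_apply,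
      Matrix.sub_apply]
    exact Finset.sum_congr rfl fun i _ => Finset.sum_congr rfl fun j _ =>
      Finset.sum_congr rfl fun k _ => Finset.sum_congr rfl fun l _ => by ring
  simp only [jetSq, Prod.fst_add, Prod.snd_add, Prod.fst_sub, Prod.snd_sub]
  linear_combination h1 + h2

theorem jetSq_add_le (g : SmoothMetric n M) (x : M) (J K : Jet n) :
    jetSq g x (J + K) ≤ 2 * jetSq g x J + 2 * jetSq g x K := by
  have h1 := jetSq_parallelogram g x J K
  have h2 := jetSq_nonneg g x (J - K)
  linarith

theorem contDiffOn_inChart {φ : M → ℝ} (hφ : ContMDiff (𝓡 n) 𝓘(ℝ) ∞ φ) (p : M) :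
    ContDiffOn ℝ ∞ (inChart φ p) (chartAt (Model n) p).target := by
  rw [← contMDiffOn_iff_contDiffOn]
  exact hφ.comp_contMDiffOn (contMDiffOn_chart_symm (x := p))

theorem differentiableAt_inChart {φ : M → ℝ} (hφ : ContMDiff (𝓡 n) 𝓘(ℝ) ∞ φ) (p : M)
    {y : Model n} (hy : y ∈ (chartAt (Model n) p).target) :
    DifferentiableAt ℝ (inChart φ p) y :=
  ((contDiffOn_inChart hφ p).contDiffAt
    ((chartAt (Model n) p).open_target.mem_nhds hy)).differentiableAt (by simp)

theorem differentiableAt_partialDeriv {φ : M → ℝ} (hφ : ContMDiff (𝓡 n) 𝓘(ℝ) ∞ φ) (p : M)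
    {y : Model n} (hy : y ∈ (chartAt (Model n) p).target) (i : Fin n) :
    DifferentiableAt ℝ (partialDeriv i (inChart φ p)) y := by
  have h := (contDiffOn_inChart hφ p).contDiffAt
    ((chartAt (Model n) p).open_target.mem_nhds hy)
  have h' : ContDiffAt ℝ 1 (fderiv ℝ (inChart φ p)) y := h.fderiv_right (by norm_cast)
  exact (h'.differentiableAt (by simp)).clm_apply (differentiableAt_const _)

theorem jet_add (g : SmoothMetric n M) {φ ψ : M → ℝ} (hφ : ContMDiff (𝓡 n) 𝓘(ℝ) ∞ φ)
    (hψ : ContMDiff (𝓡 n) 𝓘(ℝ) ∞ ψ) : jet g (φ + ψ) = jet g φ + jet g ψ := by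
  funext x
  have hy : chartAt (Model n) x x ∈ (chartAt (Model n) x).target := mem_chart_target _ x
  have h1 : ∀ i, ∀ y ∈ (chartAt (Model n) x).target, partialDeriv i (inChart (n := n) (φ + ψ) x) y
      = partialDeriv i (inChart φ x) y + partialDeriv i (inChart ψ x) y := by
    intro i y hy
    have : inChart (n := n) (φ + ψ) x = inChart φ x + inChart ψ x := rfl
    rw [partialDeriv, this, fderiv_add (differentiableAt_inChart hφ x hy)
      (differentiableAt_inChart hψ x hy)]
    rfl
  have h2 : ∀ i j, partialDeriv i (partialDeriv j (inChart (n := n) (φ + ψ) x)) (chartAt (Model n) x x)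
      = partialDeriv i (partialDeriv j (inChart φ x)) (chartAt (Model n) x x)
        + partialDeriv i (partialDeriv j (inChart ψ x)) (chartAt (Model n) x x) := by
    intro i j
    have : partialDeriv j (inChart (n := n) (φ + ψ) x) =ᶠ[𝓝 (chartAt (Model n) x x)]
        partialDeriv j (inChart φ x) + partialDeriv j (inChart ψ x) :=
      Filter.eventuallyEq_of_mem ((chartAt (Model n) x).open_target.mem_nhds hy) (h1 j)
    rw [partialDeriv, this.fderiv_eq, fderiv_add (differentiableAt_partialDeriv hφ x hy j)
      (differentiableAt_partialDeriv hψ x hy j)]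
    rfl
  refine Prod.ext rfl (Prod.ext ?_ ?_)
  · funext i
    exact h1 i _ hy
  · ext i j
    simp only [jet, localHess, Pi.add_apply, Prod.snd_add, Matrix.add_apply, Matrix.of_apply, h2,
      h1 _ _ hy, mul_add, Finset.sum_add_distrib]
    ring

theorem jet_smul (g : SmoothMetric n M) (c : ℝ) {φ : M → ℝ}
    (hφ : ContMDiff (𝓡 n) 𝓘(ℝ) ∞ φ) : jet g (c • φ) = c • jet g φ := by
  funext x
  have hy : chartAt (Model n) x x ∈ (chartAt (Model n) x).target := mem_chart_target _ x
  have h1 : ∀ i, ∀ y ∈ (chartAt (Model n) x).target, partialDeriv i (inChart (n := n) (c • φ) x) y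
      = c * partialDeriv i (inChart φ x) y := by
    intro i y hy
    have : inChart (n := n) (c • φ) x = c • inChart φ x := rfl
    rw [partialDeriv, this, fderiv_const_smul (differentiableAt_inChart hφ x hy)]
    rfl
  have h2 : ∀ i j, partialDeriv i (partialDeriv j (inChart (n := n) (c • φ) x)) (chartAt (Model n) x x)
      = c * partialDeriv i (partialDeriv j (inChart φ x)) (chartAt (Model n) x x) := by
    intro i j
    have : partialDeriv j (inChart (n := n) (c • φ) x) =ᶠ[𝓝 (chartAt (Model n) x x)]
        c • partialDeriv j (inChart φ x) :=
      Filter.eventuallyEq_of_mem ((chartAt (Model n) x).open_target.mem_nhds hy) (h1 j)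
    rw [partialDeriv, this.fderiv_eq, fderiv_const_smul (differentiableAt_partialDeriv hφ x hy j)]
    rfl
  refine Prod.ext rfl (Prod.ext ?_ ?_)
  · funext i
    exact h1 i _ hy
  · ext i j
    simp only [jet, localHess, Pi.smul_apply, Prod.smul_snd, Matrix.smul_apply, Matrix.of_apply,
      h2, h1 _ _ hy, smul_eq_mul, mul_sub, Finset.mul_sum]
    congr 1
    exact Finset.sum_congr rfl fun k _ => by ring

theorem jet_zero (g : SmoothMetric n M) : jet g (0 : M → ℝ) = 0 := by
  have h : ContMDiff (𝓡 n) 𝓘(ℝ) ∞ (0 : M → ℝ) := contMDiff_const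
  have := jet_smul g 0 h
  rwa [zero_smul, zero_smul] at this

end Helpers

/-! ### The Sobolev space `H₂²(M)` -/

section Sobolev

variable {n : ℕ} {M : Type*} [TopologicalSpace M] [ChartedSpace (Model n) M]
  [IsManifold (𝓡 n) ∞ M] [MeasurableSpace M]

/-- The square of the distance of `(φ, ∇φ, ∇²φ)` and `(u, α, η)` in `L²`, that is
`∫ (|φ - u|² + |∇φ - α|² + |∇²φ - η|²) dv_g`. -/
def jetDistSq (g : SmoothMetric n M) (φ : M → ℝ) (J : M → Jet n) : ℝ≥0∞ :=
  upperLIntegral (vol g) (fun x => ENNReal.ofReal (jetSq g x (jet g φ x - J x)))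

/-- The triples `(u, ∇u, ∇²u)` that are `L²`-limits of `(φₖ, ∇φₖ, ∇²φₖ)` with
`φₖ ∈ C^∞(M)`. (As an upper integral is used for the `L²`-distance, such a limit is
automatically measurable.) -/
def preH22 (g : SmoothMetric n M) : Submodule ℝ (M → Jet n) where
  carrier := {J | ∃ φ : ℕ → M → ℝ, (∀ k, ContMDiff (𝓡 n) 𝓘(ℝ) ∞ (φ k)) ∧
    Tendsto (fun k => jetDistSq g (φ k) J) atTop (𝓝 0)}
  zero_mem' := by
    refine ⟨fun _ => 0, fun _ => contMDiff_const, ?_⟩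
    have : jetDistSq g (0 : M → ℝ) 0 = 0 := by
      rw [jetDistSq, jet_zero]
      convert! upperLIntegral_zero (vol g) using 2
      funext x
      have := jetSq_smul g x 0 0
      simp at this
      simp [this]
    simp only [this]
    exact tendsto_const_nhds
  add_mem' := by
    rintro J K ⟨φ, hφ, hJ⟩ ⟨ψ, hψ, hK⟩
    refine ⟨fun k => φ k + ψ k, fun k => (hφ k).add (hψ k), ?_⟩
    have h0 : Tendsto (fun k => 2 * jetDistSq g (φ k) J + 2 * jetDistSq g (ψ k) K) atTop
        (𝓝 (2 * 0 + 2 * 0)) :=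
      (ENNReal.Tendsto.const_mul hJ (by simp)).add (ENNReal.Tendsto.const_mul hK (by simp))
    rw [mul_zero, add_zero] at h0
    refine tendsto_of_tendsto_of_tendsto_of_le_of_le tendsto_const_nhds h0
      (fun _ => zero_le) fun k => ?_
    refine upperLIntegral_le _ (by simp) fun x => ?_
    have h2 : (2 : ℝ≥0∞) = ENNReal.ofReal 2 := by simp
    rw [jet_add g (hφ k) (hψ k), h2, ← ENNReal.ofReal_mul (by norm_num),
      ← ENNReal.ofReal_mul (by norm_num), ← ENNReal.ofReal_add
        (mul_nonneg (by norm_num) (jetSq_nonneg g x _))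
        (mul_nonneg (by norm_num) (jetSq_nonneg g x _))]
    refine ENNReal.ofReal_le_ofReal ?_
    rw [Pi.add_apply, Pi.add_apply, add_sub_add_comm]
    exact jetSq_add_le g x _ _
  smul_mem' := by
    rintro c J ⟨φ, hφ, hJ⟩
    refine ⟨fun k => c • φ k, fun k => (contMDiff_const (c := c)).mul (hφ k), ?_⟩
    have h0 : Tendsto (fun k => ENNReal.ofReal (c ^ 2) * jetDistSq g (φ k) J
        + ENNReal.ofReal (c ^ 2) * jetDistSq g (φ k) J) atTop
        (𝓝 (ENNReal.ofReal (c ^ 2) * 0 + ENNReal.ofReal (c ^ 2) * 0)) :=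
      (ENNReal.Tendsto.const_mul hJ (by simp)).add (ENNReal.Tendsto.const_mul hJ (by simp))
    rw [mul_zero, add_zero] at h0
    refine tendsto_of_tendsto_of_tendsto_of_le_of_le tendsto_const_nhds h0
      (fun _ => zero_le) fun k => ?_
    refine upperLIntegral_le _ (by simp) fun x => le_add_right ?_
    rw [jet_smul g c (hφ k), Pi.smul_apply, Pi.smul_apply, ← smul_sub, jetSq_smul,
      ENNReal.ofReal_mul (sq_nonneg c)]

/-- The triples that vanish almost everywhere. -/
def nullH22 (g : SmoothMetric n M) : Submodule ℝ (preH22 g) where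
  carrier := {J | ∀ᵐ x ∂(vol g), J.1 x = 0}
  zero_mem' := by
    change ∀ᵐ x ∂(vol g), (0 : M → Jet n) x = 0
    exact Eventually.of_forall fun _ => rfl
  add_mem' := by
    intro J K hJ hK
    change ∀ᵐ x ∂(vol g), J.1 x + K.1 x = 0
    filter_upwards [hJ, hK] with x h1 h2
    rw [h1, h2, add_zero]
  smul_mem' := by
    intro c J hJ
    change ∀ᵐ x ∂(vol g), c • J.1 x = 0
    filter_upwards [hJ] with x h1
    rw [h1, smul_zero]

/-- The Sobolev space `H₂²(M)`: the completion of `C^∞(M)` for the norm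
`∑_{k ≤ 2} ‖∇ᵏφ‖₂`, realized as the closure of `{(φ, ∇φ, ∇²φ)}` in `L²`, with triples that agree
almost everywhere identified. -/
abbrev H22 (g : SmoothMetric n M) : Type _ := preH22 g ⧸ nullH22 g

namespace H22

variable {g : SmoothMetric n M}

/-- A representative `(u, ∇u, ∇²u)` of a Sobolev function. -/
def rep (u : H22 g) : M → Jet n := (Quotient.out u : preH22 g).1

/-- The function `u`. -/
def fn (u : H22 g) (x : M) : ℝ := (u.rep x).1

/-- The scalar product `⟨∇u, ∇v⟩_g`. -/
def gradInner (u v : H22 g) (x : M) : ℝ := covInner g x (u.rep x).2.1 (v.rep x).2.1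

/-- `|∇u|²_g`. -/
def gradSq (u : H22 g) (x : M) : ℝ := gradInner u u x

/-- `|∇²u|²_g`. -/
def hessSq (u : H22 g) (x : M) : ℝ := tensorSq g x (u.rep x).2.2

/-- The Laplacian `Δ_g u`, the trace of `∇²u`. -/
def lap (u : H22 g) (x : M) : ℝ := tensorTrace g x (u.rep x).2.2

/-- The standard norm `‖u‖_{2,2} = ‖u‖₂ + ‖∇u‖₂ + ‖∇²u‖₂`. -/
def stdNorm (u : H22 g) : ℝ :=
  Real.sqrt (∫ x, u.fn x ^ 2 ∂(vol g)) + Real.sqrt (∫ x, u.gradSq x ∂(vol g))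
    + Real.sqrt (∫ x, u.hessSq x ∂(vol g))

/-- The norm `‖u‖_{H₂²(M)} = (∫ ((Δ_g u)² + |∇u|² + u²) dv_g)^{1/2}`. -/
def lapNorm (u : H22 g) : ℝ :=
  Real.sqrt (∫ x, (u.lap x ^ 2 + u.gradSq x + u.fn x ^ 2) ∂(vol g))

/-- The quadratic form `∫ (|Δ_g u|² - a |∇u|² + b u²) dv_g`. -/
def quadForm (a b : M → ℝ) (u : H22 g) : ℝ :=
  ∫ x, (u.lap x ^ 2 - a x * u.gradSq x + b x * u.fn x ^ 2) ∂(vol g)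

/-- The weak form of `P_g u = Δ_g² u + div_g (a ∇u) + b u`: the pairing
`∫ v P_g u dv_g = ∫ (Δ_g u Δ_g v - a ⟨∇u, ∇v⟩ + b u v) dv_g`. -/
def pairing (a b : M → ℝ) (u v : H22 g) : ℝ :=
  ∫ x, (u.lap x * v.lap x - a x * gradInner u v x + b x * (u.fn x * v.fn x)) ∂(vol g)

end H22

/-- `P_g` is coercive: `∫ u P_g u dv_g ≥ Λ ‖u‖²_{H₂²(M)}` for some `Λ > 0` and all `u`. -/
def IsCoercive (g : SmoothMetric n M) (a b : M → ℝ) : Prop :=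
  ∃ Λ : ℝ, 0 < Λ ∧ ∀ u : H22 g, Λ * u.lapNorm ^ 2 ≤ H22.pairing a b u u

end Sobolev

/-! ### Norms -/

/-- `N` is a norm on the real vector space `V`. -/
structure IsNorm {V : Type*} [AddCommGroup V] [Module ℝ V] (N : V → ℝ) : Prop where
  nonneg : ∀ u, 0 ≤ N u
  eq_zero : ∀ u, N u = 0 → u = 0
  smul : ∀ (c : ℝ) u, N (c • u) = |c| * N u
  triangle : ∀ u v, N (u + v) ≤ N u + N v

/-- `N` is a norm, and it is equivalent to `N₀`. -/
def IsEquivalentNorm {V : Type*} [AddCommGroup V] [Module ℝ V] (N N₀ : V → ℝ) : Prop :=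
  IsNorm N ∧ ∃ c C : ℝ, 0 < c ∧ 0 < C ∧ ∀ u, c * N₀ u ≤ N u ∧ N u ≤ C * N₀ u

end SobolevH22

end

open MeasureTheory Filter
open scoped Manifold ContDiff Topology ENNReal

noncomputable section

namespace SobolevH22

/-! Write `E(u) = ∫ (u² + |∇u|² + |∇²u|²)` (`H22.energy`) and let `Q` be the quadratic form. The
square of the standard norm lies between `E` and `3E`, so everything can be measured by `E`. Two
inequalities carry the proof.

(A) Elliptic estimate: `‖u‖²_{H₂²(M)}` and `E(u)` are comparable. Only the bound of `∫ |∇²u|²` by `∫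
((Δu)² + |∇u|²)` is hard; the other direction is `(tr η)² ≤ n |η|²`. In a chart, with `A = (g^{ij})`
and summation understood, the expression `A^{ij} A^{kl} (∂ᵢₖf ∂ⱼₗf - ∂ᵢⱼf ∂ₖₗf)` is a divergence up
to products of one first and one second derivative. Positivity of `A ⊗ A` bounds its first half
below by `|D²f|²`, the second half is the square of the second order part of the Laplacian, and
Young's inequality absorbs the error after a cutoff (`exists_integral_euclHessSq_le`,
`exists_lintegral_hessSqAt_le`).

(B) Lower order terms: `∫ |a| |∇u|²` and `∫ |b| u²` are at most `C E(u)`. Since the volume is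
finite, `a ∈ L^{n/2}` and `b ∈ L^{n/4}`. Hölder's inequality then asks for `∇u ∈ L^{2n/(n-2)}` and
`u ∈ L^{2n/(n-4)}`, which are the Sobolev embeddings (`exists_eLpNorm_sobolev_le`,
`exists_lintegral_lower_order_le`).

From (i), `Q(u) ≥ c² ‖u‖²_{2,2} ≥ c² E(u) ≥ (c²/n) ‖u‖²_{H₂²(M)}`, which is coercivity. Conversely,
coercivity and (A) give `Q ≥ (Λ/D) E`, while (B) gives `Q ≤ (n + 2C) E`; the square root of a
positive definite quadratic form is a norm, so (i) follows.

Both inequalities are proved for smooth functions and pass to the Sobolev space by Fatou's lemma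
along an almost everywhere convergent sequence of jets. For smooth functions they are proved in
charts and patched by compactness. This needs two facts of differential geometry: `|∇φ|²`, `|∇²φ|²`
and `Δφ`, defined at `x` in the chart of `x`, may be computed in any fixed chart
(`hessian_pullback`, `localHess_transition`), and the volume is `√(det g) dy` in each chart
(`vol_eq_chartVolume`). -/

theorem differentiableAt_sum_smul {E F ι : Type*} [NormedAddCommGroup E] [NormedSpace ℝ E]
    [NormedAddCommGroup F] [NormedSpace ℝ F] [Fintype ι] {c : E → ι → ι → ℝ} {y : E}
    (h : ∀ i j, DifferentiableAt ℝ (fun z => c z i j) y) (B : ι → ι → F) :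
    DifferentiableAt ℝ (fun z => ∑ i, ∑ j, c z i j • B i j) y :=
  DifferentiableAt.fun_sum fun i _ => DifferentiableAt.fun_sum fun j _ => (h i j).smul_const _

/-! ### Changes of coordinates -/

section Transition
variable {n : ℕ} {M : Type*} [TopologicalSpace M] [ChartedSpace (Model n) M]

/-- The change of coordinates from the chart at `p` to the chart at `q`. -/
def transition (p q : M) : Model n → Model n :=
  chartAt (Model n) q ∘ (chartAt (Model n) p).symm

theorem transition_eventually {p q : M} {y : Model n} (hy : y ∈ (chartAt (Model n) p).target)
    (hq : (chartAt (Model n) p).symm y ∈ (chartAt (Model n) q).source) :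
    ∀ᶠ z in 𝓝 y, z ∈ (chartAt (Model n) p).target ∧
      (chartAt (Model n) p).symm z ∈ (chartAt (Model n) q).source :=
  ((chartAt (Model n) p).open_target.eventually_mem hy).and
    (((chartAt (Model n) p).continuousAt_symm hy).preimage_mem_nhds
      ((chartAt (Model n) q).open_source.mem_nhds hq))

theorem transition_mem {p q : M} {y : Model n}
    (hq : (chartAt (Model n) p).symm y ∈ (chartAt (Model n) q).source) :
    transition p q y ∈ (chartAt (Model n) q).target :=
  (chartAt (Model n) q).map_source hq

theorem symm_transition {p q : M} {y : Model n}
    (hq : (chartAt (Model n) p).symm y ∈ (chartAt (Model n) q).source) :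
    (chartAt (Model n) q).symm (transition p q y) = (chartAt (Model n) p).symm y :=
  (chartAt (Model n) q).left_inv hq

theorem transition_transition {p q : M} {y : Model n} (hy : y ∈ (chartAt (Model n) p).target)
    (hq : (chartAt (Model n) p).symm y ∈ (chartAt (Model n) q).source) :
    transition q p (transition p q y) = y := by
  simp only [transition, Function.comp]
  rw [(chartAt (Model n) q).left_inv hq, (chartAt (Model n) p).right_inv hy]

end Transition

/-! ### The metric in a chart: smoothness, positivity, change of coordinates -/

section Metric
variable {n : ℕ} {M : Type*} [TopologicalSpace M] [ChartedSpace (Model n) M]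
  [IsManifold (𝓡 n) ∞ M]

/-- The coordinate field is the tangent map of the inverse chart applied to the constant section `y
↦ (y, eᵢ)`. -/
theorem contMDiffOn_coordVec (p : M) (i : Fin n) :
    ContMDiffOn (𝓡 n) (𝓡 n).tangent ∞
      (fun y : Model n => (⟨(chartAt (Model n) p).symm y, coordVec p y i⟩ :
        TangentBundle (𝓡 n) M)) (chartAt (Model n) p).target := by
  have h := (contMDiffOn_chart_symm (I := 𝓡 n) (n := ∞) (x := p)).contMDiffOn_tangentMapWithin
    (m := ∞) (by simp) (chartAt (Model n) p).open_target.uniqueMDiffOn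
  have h2 : ContMDiffOn (𝓡 n) (𝓡 n).tangent ∞ (fun y : Model n =>
      (⟨y, (EuclideanSpace.single i (1 : ℝ) : Model n)⟩ : TangentBundle (𝓡 n) (Model n)))
      (chartAt (Model n) p).target := by
    apply ContMDiff.contMDiffOn
    refine contMDiff_vectorSpace_iff_contDiff.2 ?_
    exact contDiff_const
  refine (h.comp h2 fun y hy => hy).congr fun y hy => ?_
  simp only [Function.comp, tangentMapWithin, coordVec]
  rw [mfderivWithin_of_isOpen (chartAt (Model n) p).open_target hy]

theorem contDiffOn_gram (g : SmoothMetric n M) (p : M) (i j : Fin n) :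
    ContDiffOn ℝ ∞ (fun y => gram g p y i j) (chartAt (Model n) p).target := by
  rw [← contMDiffOn_iff_contDiffOn]
  have h := ContMDiffOn.clm_bundle_apply₂ (b := (chartAt (Model n) p).symm)
    (ψ := fun y => g.inner ((chartAt (Model n) p).symm y))
    (E₃ := Bundle.Trivial M ℝ) (F₃ := ℝ)
    (g.contMDiff.comp_contMDiffOn (contMDiffOn_chart_symm (x := p)))
    (contMDiffOn_coordVec p i) (contMDiffOn_coordVec p j)
  intro y hy
  have := h y hy
  rw [Bundle.contMDiffWithinAt_totalSpace] at this
  exact this.2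


/-- The differential of the inverse of the chart at `p`. -/
def chartSymmDeriv (p : M) (y : Model n) :
    Model n →L[ℝ] TangentSpace (𝓡 n) ((chartAt (Model n) p).symm y) :=
  mfderiv (𝓡 n) (𝓡 n) (chartAt (Model n) p).symm y

/-- The metric in the chart at `p`, as a bilinear form. -/
def metricForm (g : SmoothMetric n M) (p : M) (y : Model n) : Model n →L[ℝ] Model n →L[ℝ] ℝ :=
  ∑ i, ∑ j, gram g p y i j •
    (EuclideanSpace.proj i : Model n →L[ℝ] ℝ).smulRight (EuclideanSpace.proj j : Model n →L[ℝ] ℝ)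

theorem metricForm_eq_sum (g : SmoothMetric n M) (p : M) (y v w : Model n) :
    metricForm g p y v w = ∑ i, ∑ j, gram g p y i j * v i * w j := by
  simp [metricForm, mul_assoc]

theorem eq_sum_single (v : Model n) :
    v = ∑ i, v i • (EuclideanSpace.single i (1 : ℝ) : Model n) := by
  have := (EuclideanSpace.basisFun (Fin n) ℝ).sum_repr v
  simpa using this.symm

/-- Links the two faces of the metric in a chart: the finite sum of entries, which can be
differentiated, and the pull-back of `g` under the inverse chart, from which symmetry, positivity
and the transformation law are read off. -/
theorem metricForm_apply (g : SmoothMetric n M) (p : M) (y v w : Model n) :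
    metricForm g p y v w =
      g.inner ((chartAt (Model n) p).symm y) (chartSymmDeriv p y v) (chartSymmDeriv p y w) := by
  rw [metricForm_eq_sum]
  conv_rhs => rw [eq_sum_single v, eq_sum_single w]
  simp only [map_sum, map_smul, _root_.sum_apply, _root_.smul_apply, smul_eq_mul, Finset.mul_sum]
  rw [Finset.sum_comm]
  refine Finset.sum_congr rfl fun i _ => Finset.sum_congr rfl fun j _ => ?_
  change g.inner _ (chartSymmDeriv p y _) (chartSymmDeriv p y _) * _ * _ = _
  ring

theorem metricForm_single (g : SmoothMetric n M) (p : M) (y : Model n) (i j : Fin n) :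
    metricForm g p y (EuclideanSpace.single i 1) (EuclideanSpace.single j 1) = gram g p y i j := by
  rw [metricForm_apply]; rfl

theorem metricForm_symm (g : SmoothMetric n M) (p : M) (y v w : Model n) :
    metricForm g p y v w = metricForm g p y w v := by
  rw [metricForm_apply, metricForm_apply, g.symm]

theorem metricForm_pos (g : SmoothMetric n M) (p : M) {y : Model n}
    (hy : y ∈ (chartAt (Model n) p).target) {v : Model n} (hv : v ≠ 0) :
    0 < metricForm g p y v v := by
  rw [metricForm_apply]
  refine g.pos _ _ fun h => hv ?_
  have hinj := ((mdifferentiable_chart (I := 𝓡 n) p).symm).mfderiv_injective (x := y) hy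
  exact hinj (h.trans (map_zero (chartSymmDeriv p y)).symm)

theorem gram_posDef (g : SmoothMetric n M) (p : M) {y : Model n}
    (hy : y ∈ (chartAt (Model n) p).target) : (gram g p y).PosDef := by
  refine Matrix.PosDef.of_dotProduct_mulVec_pos (gram_posSemidef g p y).1 fun v hv => ?_
  have h := metricForm_pos g p hy (v := WithLp.toLp 2 v) (by simpa using hv)
  refine h.trans_eq ?_
  simp only [metricForm_eq_sum, dotProduct, Matrix.mulVec, Pi.star_apply, star_trivial,
    Finset.mul_sum]
  refine Finset.sum_congr rfl fun i _ => Finset.sum_congr rfl fun j _ => ?_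
  ring

theorem differentiableAt_gram (g : SmoothMetric n M) (p : M) {y : Model n}
    (hy : y ∈ (chartAt (Model n) p).target) (i j : Fin n) :
    DifferentiableAt ℝ (fun y => gram g p y i j) y :=
  ((contDiffOn_gram g p i j).contDiffAt
    ((chartAt (Model n) p).open_target.mem_nhds hy)).differentiableAt (by simp)

theorem differentiableAt_metricForm (g : SmoothMetric n M) (p : M) {y : Model n}
    (hy : y ∈ (chartAt (Model n) p).target) : DifferentiableAt ℝ (metricForm g p) y := by
  have hf : metricForm g p = fun y => ∑ i, ∑ j, gram g p y i j •
      (EuclideanSpace.proj i : Model n →L[ℝ] ℝ).smulRight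
        (EuclideanSpace.proj j : Model n →L[ℝ] ℝ) := by
    funext y
    rw [metricForm]
  rw [hf]
  exact differentiableAt_sum_smul (differentiableAt_gram g p hy) fun i j =>
    (EuclideanSpace.proj i : Model n →L[ℝ] ℝ).smulRight (EuclideanSpace.proj j : Model n →L[ℝ] ℝ)

theorem contDiffAt_transition {p q : M} {y : Model n} (hy : y ∈ (chartAt (Model n) p).target)
    (hq : (chartAt (Model n) p).symm y ∈ (chartAt (Model n) q).source) :
    ContDiffAt ℝ ∞ (transition p q) y := by
  rw [← contMDiffAt_iff_contDiffAt]
  have h1 : ContMDiffAt (𝓡 n) (𝓡 n) ∞ (chartAt (Model n) q) ((chartAt (Model n) p).symm y) :=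
    (contMDiffOn_chart (I := 𝓡 n) (x := q)).contMDiffAt
      ((chartAt (Model n) q).open_source.mem_nhds hq)
  have h2 : ContMDiffAt (𝓡 n) (𝓡 n) ∞ (chartAt (Model n) p).symm y :=
    (contMDiffOn_chart_symm (I := 𝓡 n) (x := p)).contMDiffAt
      ((chartAt (Model n) p).open_target.mem_nhds hy)
  exact h1.comp y h2

/-- Chain rule for `ψ_p = ψ_q ∘ transition p q` near `y`. The two sides live in tangent spaces at
points that are equal but not definitionally so, hence the ascription to the model space. -/
theorem chartSymmDeriv_transition {p q : M} {y : Model n} (hy : y ∈ (chartAt (Model n) p).target)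
    (hq : (chartAt (Model n) p).symm y ∈ (chartAt (Model n) q).source) (v : Model n) :
    (chartSymmDeriv p y v : Model n) =
      (chartSymmDeriv q (transition p q y) (fderiv ℝ (transition p q) y v) : Model n) := by
  have h1 : (chartAt (Model n) p).symm =ᶠ[𝓝 y]
      (chartAt (Model n) q).symm ∘ transition p q := by
    filter_upwards [transition_eventually hy hq] with z hz
    exact (symm_transition hz.2).symm
  have h2 : MDifferentiableAt (𝓡 n) (𝓡 n) (chartAt (Model n) q).symm (transition p q y) :=
    (mdifferentiable_chart (I := 𝓡 n) q).symm.mdifferentiableAt (transition_mem hq)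
  have h3 : MDifferentiableAt (𝓡 n) (𝓡 n) (transition p q : Model n → Model n) y :=
    ((contDiffAt_transition hy hq).differentiableAt (by simp)).mdifferentiableAt
  have h4 := (h2.hasMFDerivAt.comp y h3.hasMFDerivAt).congr_of_eventuallyEq h1
  have h5 := h4.mfderiv
  rw [mfderiv_eq_fderiv] at h5
  exact congrArg (fun A : Model n →L[ℝ] Model n => A v) h5

theorem metricForm_transition (g : SmoothMetric n M) {p q : M} {y : Model n}
    (hy : y ∈ (chartAt (Model n) p).target)
    (hq : (chartAt (Model n) p).symm y ∈ (chartAt (Model n) q).source) (v w : Model n) :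
    metricForm g p y v w = metricForm g q (transition p q y)
      (fderiv ℝ (transition p q) y v) (fderiv ℝ (transition p q) y w) := by
  rw [metricForm_apply, metricForm_apply]
  -- With the base points generalised, their equality can be eliminated by `rfl`, which avoids a
  -- transport between tangent spaces.
  have key : ∀ (x x' : M) (_ : x = x') (a b a' b' : Model n) (_ : a = a') (_ : b = b'),
      g.inner x (a : TangentSpace (𝓡 n) x) (b : TangentSpace (𝓡 n) x) =
      g.inner x' (a' : TangentSpace (𝓡 n) x') (b' : TangentSpace (𝓡 n) x') := by
    rintro x _ rfl a b _ _ rfl rfl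
    rfl
  exact key _ _ (symm_transition hq).symm _ _ _ _ (chartSymmDeriv_transition hy hq v)
    (chartSymmDeriv_transition hy hq w)

end Metric

/-! ### Covariance of the Hessian, for arbitrary fields of bilinear forms -/

section Abstract

variable {E : Type*} [NormedAddCommGroup E] [NormedSpace ℝ E]

/-- The Christoffel symbols of the first kind `½ (∂ᵤ G(v, w) + ∂ᵥ G(u, w) - ∂_w G(u, v))` of a
field of bilinear forms. -/
def christoffelForm (G : E → E →L[ℝ] E →L[ℝ] ℝ) (y u v w : E) : ℝ :=
  (1 / 2) * (fderiv ℝ G y u v w + fderiv ℝ G y v u w - fderiv ℝ G y w u v)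

variable {F : Type*} [NormedAddCommGroup F] [NormedSpace ℝ F] {G : E → E →L[ℝ] E →L[ℝ] ℝ}
  {H : F → F →L[ℝ] F →L[ℝ] ℝ} {τ : E → F} {y : E}

theorem christoffelForm_sum_left {ι : Type*} [Fintype ι] (c : ι → ℝ) (u : ι → E) (v w : E) :
    christoffelForm G y (∑ i, c i • u i) v w = ∑ i, c i * christoffelForm G y (u i) v w := by
  simp only [christoffelForm, map_sum, map_smul, _root_.sum_apply, _root_.smul_apply,
    smul_eq_mul, ← Finset.sum_add_distrib, ← Finset.sum_sub_distrib, Finset.mul_sum]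
  exact Finset.sum_congr rfl fun l _ => by ring

theorem christoffelForm_sum_mid {ι : Type*} [Fintype ι] (c : ι → ℝ) (v : ι → E) (u w : E) :
    christoffelForm G y u (∑ i, c i • v i) w = ∑ i, c i * christoffelForm G y u (v i) w := by
  simp only [christoffelForm, map_sum, map_smul, _root_.sum_apply, _root_.smul_apply,
    smul_eq_mul, ← Finset.sum_add_distrib, ← Finset.sum_sub_distrib, Finset.mul_sum]
  exact Finset.sum_congr rfl fun l _ => by ring

/-- Product rule for `G z v w = H (τ z) (Dτ v) (Dτ w)`: one term from `H`, and one from each of the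
two factors `Dτ`. -/
theorem fderiv_pullback_form (hG : DifferentiableAt ℝ G y) (hH : DifferentiableAt ℝ H (τ y))
    (hτ : ContDiffAt ℝ 2 τ y)
    (hGH : ∀ᶠ z in 𝓝 y, ∀ v w, G z v w = H (τ z) (fderiv ℝ τ z v) (fderiv ℝ τ z w)) (u v w : E) :
    fderiv ℝ G y u v w =
      fderiv ℝ H (τ y) (fderiv ℝ τ y u) (fderiv ℝ τ y v) (fderiv ℝ τ y w)
      + H (τ y) (fderiv ℝ (fderiv ℝ τ) y u v) (fderiv ℝ τ y w)
      + H (τ y) (fderiv ℝ τ y v) (fderiv ℝ (fderiv ℝ τ) y u w) := by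
  have hτ1 : HasFDerivAt τ (fderiv ℝ τ y) y := (hτ.differentiableAt (by norm_num)).hasFDerivAt
  have hτ2 : HasFDerivAt (fderiv ℝ τ) (fderiv ℝ (fderiv ℝ τ) y) y :=
    ((hτ.fderiv_right (m := 1) (by norm_num)).differentiableAt (by norm_num)).hasFDerivAt
  have h1 := (hG.hasFDerivAt.clm_apply (hasFDerivAt_const v y)).clm_apply (hasFDerivAt_const w y)
  have h0 : HasFDerivAt (fun z => H (τ z)) ((fderiv ℝ H (τ y)).comp (fderiv ℝ τ y)) y :=
    HasFDerivAt.comp (g := H) (f := τ) (g' := fderiv ℝ H (τ y)) y hH.hasFDerivAt hτ1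
  have h2 := (h0.clm_apply
    (hτ2.clm_apply (hasFDerivAt_const v y))).clm_apply (hτ2.clm_apply (hasFDerivAt_const w y))
  have h3 := h2.congr_of_eventuallyEq
    (f₁ := fun z => G z v w) (by filter_upwards [hGH] with z hz; exact hz v w)
  have h4 := congrArg (fun A : E →L[ℝ] ℝ => A u) (h1.unique h3)
  simp at h4
  linarith

theorem fderiv_fderiv_comp {f : E → ℝ} {k : F → ℝ} (hk : ContDiffAt ℝ 2 k (τ y))
    (hτ : ContDiffAt ℝ 2 τ y) (hf : f =ᶠ[𝓝 y] k ∘ τ) (u v : E) :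
    fderiv ℝ (fderiv ℝ f) y u v =
      fderiv ℝ (fderiv ℝ k) (τ y) (fderiv ℝ τ y u) (fderiv ℝ τ y v)
        + fderiv ℝ k (τ y) (fderiv ℝ (fderiv ℝ τ) y u v) := by
  have hτ1 : HasFDerivAt τ (fderiv ℝ τ y) y := (hτ.differentiableAt (by norm_num)).hasFDerivAt
  have hτ2 : HasFDerivAt (fderiv ℝ τ) (fderiv ℝ (fderiv ℝ τ) y) y :=
    ((hτ.fderiv_right (m := 1) (by norm_num)).differentiableAt (by norm_num)).hasFDerivAt
  have hk2 : HasFDerivAt (fderiv ℝ k) (fderiv ℝ (fderiv ℝ k) (τ y)) (τ y) :=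
    ((hk.fderiv_right (m := 1) (by norm_num)).differentiableAt (by norm_num)).hasFDerivAt
  have hev : fderiv ℝ f =ᶠ[𝓝 y] fun z => (fderiv ℝ k (τ z)).comp (fderiv ℝ τ z) := by
    have e1 : ∀ᶠ z in 𝓝 y, DifferentiableAt ℝ τ z :=
      (hτ.eventually (by simp)).mono fun z hz => hz.differentiableAt (by norm_num)
    have e2 : ∀ᶠ z in 𝓝 y, DifferentiableAt ℝ k (τ z) :=
      hτ.continuousAt.eventually
        ((hk.eventually (by simp)).mono fun z hz => hz.differentiableAt (by norm_num))
    filter_upwards [e1, e2, hf.eventually_nhds] with z h1 h2 h3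
    rw [Filter.EventuallyEq.fderiv_eq h3, fderiv_comp z h2 h1]
  have h := ((hk2.comp y hτ1).clm_comp hτ2).congr_of_eventuallyEq hev
  rw [h.fderiv]
  simp [add_comm]

/-- The covariant Hessian `D²f(u, v) - Γ(u, v; ∇f)` is compatible with changes of coordinates. -/
theorem hessian_pullback (hG : DifferentiableAt ℝ G y) (hH : DifferentiableAt ℝ H (τ y))
    (hτ : ContDiffAt ℝ 2 τ y)
    (hGH : ∀ᶠ z in 𝓝 y, ∀ v w, G z v w = H (τ z) (fderiv ℝ τ z v) (fderiv ℝ τ z w))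
    (hsymm : ∀ v w, H (τ y) v w = H (τ y) w v)
    {f : E → ℝ} {k : F → ℝ} (hk : ContDiffAt ℝ 2 k (τ y)) (hf : f =ᶠ[𝓝 y] k ∘ τ)
    (N : E) (hN : ∀ w, H (τ y) (fderiv ℝ τ y N) w = fderiv ℝ k (τ y) w) (u v : E) :
    fderiv ℝ (fderiv ℝ f) y u v - christoffelForm G y u v N =
      fderiv ℝ (fderiv ℝ k) (τ y) (fderiv ℝ τ y u) (fderiv ℝ τ y v)
        - christoffelForm H (τ y) (fderiv ℝ τ y u) (fderiv ℝ τ y v) (fderiv ℝ τ y N) := by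
  have hs : ∀ a b, fderiv ℝ (fderiv ℝ τ) y a b = fderiv ℝ (fderiv ℝ τ) y b a := by
    have := hτ.isSymmSndFDerivAt (by simp)
    exact fun a b => this a b
  have hd := fderiv_pullback_form hG hH hτ hGH
  -- In the alternating sum of first derivatives of `G`, the terms with `D²τ` cancel in pairs except
  -- for two copies of `H(D²τ(u, v), Dτ N)`. As `Dτ N` represents `Dk`, half their sum is `Dk(D²τ(u,
  -- v))`, exactly the extra term in the chain rule for `D²f`.
  rw [fderiv_fderiv_comp hk hτ hf, christoffelForm, christoffelForm, hd, hd, hd,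
    ← hN, hsymm (fderiv ℝ τ y N), hs v u, hs N u, hs N v,
    hsymm (fderiv ℝ τ y u) (fderiv ℝ (fderiv ℝ τ) y v N)]
  linear_combination (-1 / 2) * hsymm (fderiv ℝ τ y v) (fderiv ℝ (fderiv ℝ τ) y u N)

end Abstract

/-! ### Transformation of gradients and Hessians between charts -/

section Jets

variable {n : ℕ} {M : Type*} [TopologicalSpace M] [ChartedSpace (Model n) M]

theorem fderiv_inChart_eq_sum (φ : M → ℝ) (p : M) (y v : Model n) :
    fderiv ℝ (inChart φ p) y v = ∑ i, v i * localGrad φ p y i := by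
  conv_lhs => rw [eq_sum_single v]
  simp [localGrad, partialDeriv]

/-- The Jacobian matrix of the change of coordinates. -/
def jacobian (p q : M) (y : Model n) : Matrix (Fin n) (Fin n) ℝ :=
  Matrix.of fun a i => fderiv ℝ (transition p q) y (EuclideanSpace.single i 1) a

theorem fderiv_transition_single (p q : M) (y : Model n) (i : Fin n) :
    fderiv ℝ (transition p q) y (EuclideanSpace.single i 1) =
      ∑ a, jacobian p q y a i • (EuclideanSpace.single a (1 : ℝ) : Model n) :=
  eq_sum_single _

theorem inChart_eventuallyEq (φ : M → ℝ) {p q : M} {y : Model n}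
    (hy : y ∈ (chartAt (Model n) p).target)
    (hq : (chartAt (Model n) p).symm y ∈ (chartAt (Model n) q).source) :
    inChart φ p =ᶠ[𝓝 y] inChart φ q ∘ transition p q := by
  filter_upwards [transition_eventually hy hq] with z hz
  simp only [inChart, Function.comp, symm_transition hz.2]

variable [IsManifold (𝓡 n) ∞ M]

/-- The gradient of a function in the chart at `p`, as a vector. -/
def gradVec (g : SmoothMetric n M) (φ : M → ℝ) (p : M) (y : Model n) : Model n :=
  WithLp.toLp 2 fun l => ∑ k, (gram g p y)⁻¹ k l * localGrad φ p y k

/-- The gradient represents `dφ` with respect to the metric. This characterisation involves no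
coordinates, unlike the formula with `g^{kl}`, and it is the hypothesis on `N` in
`hessian_pullback`. -/
theorem metricForm_gradVec (g : SmoothMetric n M) (φ : M → ℝ) (p : M) {y : Model n}
    (hy : y ∈ (chartAt (Model n) p).target) (w : Model n) :
    metricForm g p y (gradVec g φ p y) w = fderiv ℝ (inChart φ p) y w := by
  have hdet : IsUnit (gram g p y).det := (gram_posDef g p hy).det_pos.ne'.isUnit
  have h : ∀ j, ∑ i, (∑ k, (gram g p y)⁻¹ k i * localGrad φ p y k) * gram g p y i j
      = localGrad φ p y j := by
    intro j
    have := congrFun (Matrix.vecMul_vecMul (localGrad φ p y) (gram g p y)⁻¹ (gram g p y)) j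
    rw [Matrix.nonsing_inv_mul _ hdet, Matrix.vecMul_one] at this
    rw [← this]
    simp only [Matrix.vecMul, dotProduct]
    exact Finset.sum_congr rfl fun i _ => by
      congr 1; exact Finset.sum_congr rfl fun k _ => mul_comm _ _
  rw [metricForm_eq_sum, fderiv_inChart_eq_sum, Finset.sum_comm]
  refine Finset.sum_congr rfl fun j _ => ?_
  rw [← h j, Finset.mul_sum]
  exact Finset.sum_congr rfl fun i _ => by simp only [gradVec]; ring

theorem partialDeriv_gram (g : SmoothMetric n M) (p : M) {y : Model n}
    (hy : y ∈ (chartAt (Model n) p).target) (i j k : Fin n) :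
    partialDeriv i (fun z => gram g p z j k) y =
      fderiv ℝ (metricForm g p) y (EuclideanSpace.single i 1) (EuclideanSpace.single j 1)
        (EuclideanSpace.single k 1) := by
  have h := (((differentiableAt_metricForm g p hy).hasFDerivAt.clm_apply
    (hasFDerivAt_const (EuclideanSpace.single j (1 : ℝ) : Model n) y)).clm_apply
    (hasFDerivAt_const (EuclideanSpace.single k (1 : ℝ) : Model n) y))
  simp only [metricForm_single] at h
  rw [partialDeriv, h.fderiv]
  simp

/-- Moving the inverse metric from the Christoffel symbol onto `dφ` turns `∑ₖ Γᵏ_{ij} ∂ₖφ` into the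
symbol of the first kind evaluated at the gradient, the form in which `hessian_pullback` applies. -/
theorem localHess_apply (g : SmoothMetric n M) {φ : M → ℝ} (hφ : ContMDiff (𝓡 n) 𝓘(ℝ) ∞ φ)
    (p : M) {y : Model n} (hy : y ∈ (chartAt (Model n) p).target) (i j : Fin n) :
    localHess g φ p y i j =
      fderiv ℝ (fderiv ℝ (inChart φ p)) y (EuclideanSpace.single i 1) (EuclideanSpace.single j 1)
      - christoffelForm (metricForm g p) y (EuclideanSpace.single i 1) (EuclideanSpace.single j 1)
        (gradVec g φ p y) := by
  have h1 : partialDeriv i (partialDeriv j (inChart φ p)) y =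
      fderiv ℝ (fderiv ℝ (inChart φ p)) y (EuclideanSpace.single i 1)
        (EuclideanSpace.single j 1) := by
    have h := (contDiffOn_inChart hφ p).contDiffAt
      ((chartAt (Model n) p).open_target.mem_nhds hy)
    have h' : ContDiffAt ℝ 1 (fderiv ℝ (inChart φ p)) y := h.fderiv_right (by norm_cast)
    have h2 := (h'.differentiableAt (by simp)).hasFDerivAt.clm_apply
      (hasFDerivAt_const (EuclideanSpace.single j (1 : ℝ) : Model n) y)
    have h3 : partialDeriv j (inChart φ p) =
      fun y => fderiv ℝ (inChart φ p) y (EuclideanSpace.single j 1) := rfl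
    rw [partialDeriv, h3, h2.fderiv]
    simp
  have h2 : ∀ w : Model n, christoffelForm (metricForm g p) y (EuclideanSpace.single i 1)
      (EuclideanSpace.single j 1) w = ∑ l, w l *
        christoffelForm (metricForm g p) y (EuclideanSpace.single i 1)
          (EuclideanSpace.single j 1) (EuclideanSpace.single l 1) := by
    intro w
    conv_lhs => rw [eq_sum_single w]
    simp only [christoffelForm, map_sum, map_smul, _root_.sum_apply, _root_.smul_apply,
      smul_eq_mul, ← Finset.sum_add_distrib, ← Finset.sum_sub_distrib, Finset.mul_sum]
    exact Finset.sum_congr rfl fun l _ => by ring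
  rw [h2, localHess, Matrix.of_apply, h1]
  congr 1
  simp only [christoffel, partialDeriv_gram g p hy, gradVec, localGrad, Finset.sum_mul,
    Finset.mul_sum]
  rw [Finset.sum_comm]
  exact Finset.sum_congr rfl fun l _ => Finset.sum_congr rfl fun k _ => by
    rw [christoffelForm]; ring

theorem fderiv_inChart_transition {φ : M → ℝ} (hφ : ContMDiff (𝓡 n) 𝓘(ℝ) ∞ φ) {p q : M}
    {y : Model n} (hy : y ∈ (chartAt (Model n) p).target)
    (hq : (chartAt (Model n) p).symm y ∈ (chartAt (Model n) q).source) (v : Model n) :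
    fderiv ℝ (inChart φ p) y v =
      fderiv ℝ (inChart φ q) (transition p q y) (fderiv ℝ (transition p q) y v) := by
  rw [(inChart_eventuallyEq φ hy hq).fderiv_eq, fderiv_comp y
    (differentiableAt_inChart hφ q (transition_mem hq))
    ((contDiffAt_transition hy hq).differentiableAt (by simp))]
  rfl

theorem gram_transition (g : SmoothMetric n M) {p q : M} {y : Model n}
    (hy : y ∈ (chartAt (Model n) p).target)
    (hq : (chartAt (Model n) p).symm y ∈ (chartAt (Model n) q).source) :
    gram g p y = (jacobian p q y).transpose * gram g q (transition p q y) * jacobian p q y := by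
  ext i j
  rw [← metricForm_single, metricForm_transition g hy hq, metricForm_eq_sum, Matrix.mul_apply,
    Finset.sum_comm]
  refine Finset.sum_congr rfl fun b _ => ?_
  rw [Matrix.mul_apply, Finset.sum_mul]
  refine Finset.sum_congr rfl fun a _ => ?_
  simp only [Matrix.transpose_apply, jacobian, Matrix.of_apply]
  ring

theorem localGrad_transition {φ : M → ℝ} (hφ : ContMDiff (𝓡 n) 𝓘(ℝ) ∞ φ) {p q : M}
    {y : Model n} (hy : y ∈ (chartAt (Model n) p).target)
    (hq : (chartAt (Model n) p).symm y ∈ (chartAt (Model n) q).source) :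
    localGrad φ p y =
      (jacobian p q y).transpose.mulVec (localGrad φ q (transition p q y)) := by
  funext i
  rw [localGrad, partialDeriv, fderiv_inChart_transition hφ hy hq, fderiv_inChart_eq_sum]
  rfl

theorem localHess_transition (g : SmoothMetric n M) {φ : M → ℝ}
    (hφ : ContMDiff (𝓡 n) 𝓘(ℝ) ∞ φ) {p q : M}
    {y : Model n} (hy : y ∈ (chartAt (Model n) p).target)
    (hq : (chartAt (Model n) p).symm y ∈ (chartAt (Model n) q).source) :
    localHess g φ p y =
      (jacobian p q y).transpose * localHess g φ q (transition p q y) * jacobian p q y := by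
  have hy' := transition_mem hq
  have hq' : (chartAt (Model n) q).symm (transition p q y) ∈ (chartAt (Model n) p).source := by
    rw [symm_transition hq]; exact (chartAt (Model n) p).map_target hy
  set T := fderiv ℝ (transition p q) y with hT
  -- The differential of the reverse transition map is a right inverse.
  have hsurj : ∀ w : Model n, ∃ v, T v = w := by
    intro w
    refine ⟨fderiv ℝ (transition q p) (transition p q y) w, ?_⟩
    have h1 : transition p q ∘ transition q p =ᶠ[𝓝 (transition p q y)] id := by
      filter_upwards [transition_eventually hy' hq'] with z hz
      exact transition_transition hz.1 hz.2
    have h2 := h1.fderiv_eq (𝕜 := ℝ)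
    have hd1 := (contDiffAt_transition hy hq).differentiableAt (by simp)
    have hd2 := (contDiffAt_transition hy' hq').differentiableAt (by simp)
    have hyy := transition_transition hy hq
    rw [fderiv_comp _ (by rw [hyy]; exact hd1) hd2, hyy, fderiv_id] at h2
    exact congrArg (fun A : Model n →L[ℝ] Model n => A w) h2
  have hN : ∀ w, metricForm g q (transition p q y) (T (gradVec g φ p y)) w =
      fderiv ℝ (inChart φ q) (transition p q y) w := by
    intro w
    obtain ⟨v, rfl⟩ := hsurj w
    rw [← metricForm_transition g hy hq, metricForm_gradVec g φ p hy,
      fderiv_inChart_transition hφ hy hq]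
  -- Both vectors represent the same covector, so their difference is orthogonal to itself and
  -- vanishes by positivity.
  have hTN : T (gradVec g φ p y) = gradVec g φ q (transition p q y) := by
    by_contra hne
    have h := metricForm_pos g q hy' (sub_ne_zero.2 hne)
    rw [map_sub (metricForm g q (transition p q y)), _root_.sub_apply, hN,
      metricForm_gradVec g φ q hy', sub_self] at h
    exact lt_irrefl _ h
  have key := fun u v => hessian_pullback (differentiableAt_metricForm g p hy)
    (differentiableAt_metricForm g q hy')
    ((contDiffAt_transition hy hq).of_le (by norm_cast))
    (by filter_upwards [transition_eventually hy hq] with z hz v w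
        exact metricForm_transition g hz.1 hz.2 v w)
    (metricForm_symm g q _)
    (((contDiffOn_inChart hφ q).contDiffAt
      ((chartAt (Model n) q).open_target.mem_nhds hy')).of_le (by norm_cast))
    (inChart_eventuallyEq φ hy hq) (gradVec g φ p y) hN u v
  ext i j
  rw [localHess_apply g hφ p hy, key, ← hT, hTN, fderiv_transition_single, fderiv_transition_single,
    Matrix.mul_apply]
  simp only [christoffelForm_sum_left, christoffelForm_sum_mid]
  simp only [Matrix.mul_apply, Finset.sum_mul, localHess_apply g hφ q hy',
    map_sum, map_smul, _root_.sum_apply, _root_.smul_apply, smul_eq_mul, Finset.mul_sum,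
    Matrix.transpose_apply]
  simp only [← Finset.sum_sub_distrib]
  exact Finset.sum_congr rfl fun b _ => Finset.sum_congr rfl fun a _ => by ring

/-! ### Invariance of the scalar contractions -/

/-- The contraction `∑ g^{ij} ξᵢ ξⱼ`. -/
def contractSq (G : Matrix (Fin n) (Fin n) ℝ) (ξ : Fin n → ℝ) : ℝ :=
  ∑ i, ∑ j, G⁻¹ i j * ξ i * ξ j

/-- The contraction `∑ g^{ik} g^{jl} η_{ij} η_{kl}`. -/
def contractTensorSq (G η : Matrix (Fin n) (Fin n) ℝ) : ℝ :=
  ∑ i, ∑ j, ∑ k, ∑ l, G⁻¹ i k * G⁻¹ j l * η i j * η k l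

/-- The contraction `∑ g^{ij} η_{ij}`. -/
def contractTrace (G η : Matrix (Fin n) (Fin n) ℝ) : ℝ := ∑ i, ∑ j, G⁻¹ i j * η i j

theorem contractSq_eq (G : Matrix (Fin n) (Fin n) ℝ) (ξ : Fin n → ℝ) :
    contractSq G ξ = ξ ⬝ᵥ G⁻¹.mulVec ξ := by
  simp only [contractSq, dotProduct, Matrix.mulVec, Finset.mul_sum]
  exact Finset.sum_congr rfl fun i _ => Finset.sum_congr rfl fun j _ => by ring

theorem contractTrace_eq (G η : Matrix (Fin n) (Fin n) ℝ) :
    contractTrace G η = (G⁻¹ * η.transpose).trace := by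
  simp only [contractTrace, Matrix.trace, Matrix.diag_apply, Matrix.mul_apply,
    Matrix.transpose_apply]

/-- Written as a trace of matrix products, invariance under `G ↦ JᵀGJ`, `η ↦ JᵀηJ` becomes
cancellation of `J J⁻¹` under cyclic permutation. The transpose on the first `G⁻¹` is there because
`G` is not assumed symmetric. -/
theorem contractTensorSq_eq (G η : Matrix (Fin n) (Fin n) ℝ) :
    contractTensorSq G η = (G⁻¹.transpose * η * G⁻¹ * η.transpose).trace := by
  simp only [contractTensorSq, Matrix.trace, Matrix.diag_apply, Matrix.mul_apply,
    Matrix.transpose_apply, Finset.sum_mul]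
  calc _ = ∑ i, ∑ k, ∑ j, ∑ l, G⁻¹ i k * G⁻¹ j l * η i j * η k l := by
        refine Finset.sum_congr rfl fun i _ => Finset.sum_comm
    _ = ∑ k, ∑ i, ∑ j, ∑ l, G⁻¹ i k * G⁻¹ j l * η i j * η k l := Finset.sum_comm
    _ = ∑ k, ∑ l, ∑ j, ∑ i, G⁻¹ i k * G⁻¹ j l * η i j * η k l := by
        refine Finset.sum_congr rfl fun k _ => ?_
        rw [Finset.sum_comm]
        rw [Finset.sum_congr rfl fun j _ => Finset.sum_comm]
        exact Finset.sum_comm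
    _ = _ := by
        refine Finset.sum_congr rfl fun k _ => Finset.sum_congr rfl fun l _ =>
          Finset.sum_congr rfl fun j _ => Finset.sum_congr rfl fun i _ => ?_
        ring

theorem inv_conj (G J : Matrix (Fin n) (Fin n) ℝ) : (J.transpose * G * J)⁻¹ = J⁻¹ * G⁻¹ * J⁻¹.transpose := by
  rw [Matrix.mul_inv_rev, Matrix.mul_inv_rev, Matrix.transpose_nonsing_inv, Matrix.mul_assoc]

section Invariance

variable {G J : Matrix (Fin n) (Fin n) ℝ} (hJ : IsUnit J.det)
include hJ

theorem contractSq_conj (ξ : Fin n → ℝ) :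
    contractSq (J.transpose * G * J) (J.transpose.mulVec ξ) = contractSq G ξ := by
  have h : J.transpose.mulVec ξ = Matrix.vecMul ξ J := Matrix.mulVec_transpose J ξ
  rw [contractSq_eq, contractSq_eq, inv_conj]
  nth_rw 1 [h]
  rw [← Matrix.dotProduct_mulVec, Matrix.mulVec_mulVec, Matrix.mulVec_mulVec]
  congr 2
  rw [Matrix.mul_assoc J⁻¹, ← Matrix.mul_assoc J,
    Matrix.mul_nonsing_inv _ hJ, Matrix.one_mul, Matrix.mul_assoc G⁻¹, ← Matrix.transpose_mul,
    Matrix.mul_nonsing_inv _ hJ]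
  simp

theorem contractTrace_conj (η : Matrix (Fin n) (Fin n) ℝ) :
    contractTrace (J.transpose * G * J) (J.transpose * η * J) = contractTrace G η := by
  rw [contractTrace_eq, contractTrace_eq, inv_conj]
  have : (J⁻¹ * G⁻¹ * J⁻¹.transpose * (J.transpose * η * J).transpose) =
      J⁻¹ * (G⁻¹ * (J⁻¹.transpose * J.transpose) * η.transpose * J) := by
    simp only [Matrix.transpose_mul, Matrix.transpose_transpose, Matrix.mul_assoc]
  rw [this, Matrix.trace_mul_comm, ← Matrix.transpose_mul, Matrix.mul_nonsing_inv _ hJ]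
  rw [Matrix.mul_assoc _ J, Matrix.mul_nonsing_inv _ hJ]
  simp

theorem contractTensorSq_conj (η : Matrix (Fin n) (Fin n) ℝ) :
    contractTensorSq (J.transpose * G * J) (J.transpose * η * J) = contractTensorSq G η := by
  rw [contractTensorSq_eq, contractTensorSq_eq, inv_conj]
  have h1 : J⁻¹.transpose * J.transpose = 1 := by
    rw [← Matrix.transpose_mul, Matrix.mul_nonsing_inv _ hJ, Matrix.transpose_one]
  have h2 : J * J⁻¹ = 1 := Matrix.mul_nonsing_inv _ hJ
  have : ((J⁻¹ * G⁻¹ * J⁻¹.transpose).transpose * (J.transpose * η * J) *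
      (J⁻¹ * G⁻¹ * J⁻¹.transpose) * (J.transpose * η * J).transpose) =
      J⁻¹ * (G⁻¹.transpose * (J⁻¹.transpose * J.transpose) * η * (J * J⁻¹) * G⁻¹ *
        (J⁻¹.transpose * J.transpose) * η.transpose * J) := by
    simp only [Matrix.transpose_mul, Matrix.transpose_transpose, Matrix.mul_assoc]
  rw [this, Matrix.trace_mul_comm, h1, h2, Matrix.mul_assoc _ J, h2]
  simp

end Invariance

/-- The determinant of the Jacobian is a factor of `det (gram g p y)`, which is positive. -/
theorem isUnit_det_jacobian (g : SmoothMetric n M) {p q : M} {y : Model n}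
    (hy : y ∈ (chartAt (Model n) p).target)
    (hq : (chartAt (Model n) p).symm y ∈ (chartAt (Model n) q).source) :
    IsUnit (jacobian p q y).det := by
  have h := (gram_posDef g p hy).det_pos
  rw [gram_transition g hy hq, Matrix.det_mul] at h
  exact (right_ne_zero_of_mul h.ne').isUnit

section Charts

variable (g : SmoothMetric n M) {φ : M → ℝ} (hφ : ContMDiff (𝓡 n) 𝓘(ℝ) ∞ φ) (p : M) {x : M}
  (hx : x ∈ (chartAt (Model n) p).source)
include hφ hx

/-- The left side uses the chart of `x`, which may jump as `x` moves; the right side uses one chart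
for a whole neighbourhood. Continuity and all local estimates depend on this replacement, here and
in the two analogues for the Hessian. -/
theorem covInner_jet :
    covInner g x (jet g φ x).2.1 (jet g φ x).2.1 =
      contractSq (gram g p (chartAt (Model n) p x)) (localGrad φ p (chartAt (Model n) p x)) := by
  have hy : chartAt (Model n) x x ∈ (chartAt (Model n) x).target := mem_chart_target _ x
  have hxx : (chartAt (Model n) x).symm (chartAt (Model n) x x) = x :=
    (chartAt (Model n) x).left_inv (mem_chart_source _ x)
  have hq : (chartAt (Model n) x).symm (chartAt (Model n) x x) ∈ (chartAt (Model n) p).source := by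
    rwa [hxx]
  have ht : transition x p (chartAt (Model n) x x) = chartAt (Model n) p x := by
    simp only [transition, Function.comp, hxx]
  have h := contractSq_conj (G := gram g p (chartAt (Model n) p x))
    (isUnit_det_jacobian g hy hq) (localGrad φ p (chartAt (Model n) p x))
  rw [← ht, ← gram_transition g hy hq, ← localGrad_transition hφ hy hq, ht] at h
  exact h

theorem tensorSq_jet :
    tensorSq g x (jet g φ x).2.2 =
      contractTensorSq (gram g p (chartAt (Model n) p x))
        (localHess g φ p (chartAt (Model n) p x)) := by
  have hy : chartAt (Model n) x x ∈ (chartAt (Model n) x).target := mem_chart_target _ x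
  have hxx : (chartAt (Model n) x).symm (chartAt (Model n) x x) = x :=
    (chartAt (Model n) x).left_inv (mem_chart_source _ x)
  have hq : (chartAt (Model n) x).symm (chartAt (Model n) x x) ∈ (chartAt (Model n) p).source := by
    rwa [hxx]
  have ht : transition x p (chartAt (Model n) x x) = chartAt (Model n) p x := by
    simp only [transition, Function.comp, hxx]
  have h := contractTensorSq_conj (G := gram g p (chartAt (Model n) p x))
    (isUnit_det_jacobian g hy hq) (localHess g φ p (chartAt (Model n) p x))
  rw [← ht, ← gram_transition g hy hq, ← localHess_transition g hφ hy hq, ht] at h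
  exact h

theorem tensorTrace_jet :
    tensorTrace g x (jet g φ x).2.2 =
      contractTrace (gram g p (chartAt (Model n) p x))
        (localHess g φ p (chartAt (Model n) p x)) := by
  have hy : chartAt (Model n) x x ∈ (chartAt (Model n) x).target := mem_chart_target _ x
  have hxx : (chartAt (Model n) x).symm (chartAt (Model n) x x) = x :=
    (chartAt (Model n) x).left_inv (mem_chart_source _ x)
  have hq : (chartAt (Model n) x).symm (chartAt (Model n) x x) ∈ (chartAt (Model n) p).source := by
    rwa [hxx]
  have ht : transition x p (chartAt (Model n) x x) = chartAt (Model n) p x := by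
    simp only [transition, Function.comp, hxx]
  have h := contractTrace_conj (G := gram g p (chartAt (Model n) p x))
    (isUnit_det_jacobian g hy hq) (localHess g φ p (chartAt (Model n) p x))
  rw [← ht, ← gram_transition g hy hq, ← localHess_transition g hφ hy hq, ht] at h
  exact h

end Charts

end Jets

/-! ### Measurability in charts -/

theorem measurableSet_inter_preimage_of_continuousOn {X Y : Type*} [TopologicalSpace X]
    [MeasurableSpace X] [OpensMeasurableSpace X] [TopologicalSpace Y] [MeasurableSpace Y]
    [BorelSpace Y] {f : X → Y} {t : Set X} (hf : ContinuousOn f t) (ht : MeasurableSet t)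
    {s : Set Y} (hs : MeasurableSet s) : MeasurableSet (t ∩ f ⁻¹' s) := by
  have h := (continuousOn_iff_continuous_domRestrict.1 hf).measurable hs
  have h2 := ht.subtype_image h
  convert! h2 using 1
  ext x
  simp [Set.domRestrict_apply, and_comm]

theorem continuousOn_det {X ι : Type*} [TopologicalSpace X] [Fintype ι] [DecidableEq ι]
    {A : X → Matrix ι ι ℝ} {s : Set X} (hA : ∀ i j, ContinuousOn (fun x => A x i j) s) :
    ContinuousOn (fun x => (A x).det) s := by
  simp only [Matrix.det_apply]
  exact continuousOn_finsetSum _ fun σ _ =>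
    (continuousOn_finsetProd _ fun i _ => hA _ _).const_smul _

section ChartMeasurability

variable {n : ℕ} {M : Type*} [TopologicalSpace M] [ChartedSpace (Model n) M]

theorem det_fderiv_transition (p q : M) (y : Model n) :
    (fderiv ℝ (transition p q) y).det = (jacobian p q y).det := by
  have h : jacobian p q y = LinearMap.toMatrix (EuclideanSpace.basisFun (Fin n) ℝ).toBasis
      (EuclideanSpace.basisFun (Fin n) ℝ).toBasis (fderiv ℝ (transition p q) y).toLinearMap := by
    ext a i
    simp [LinearMap.toMatrix_apply, jacobian]
  rw [h, LinearMap.det_toMatrix]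

theorem image_closedBall_mem_nhds (p : M) {r : ℝ} (hr : 0 < r) :
    (chartAt (Model n) p).symm '' (Metric.closedBall (chartAt (Model n) p p) r) ∈ 𝓝 p := by
  have h := (chartAt (Model n) p).symm.image_mem_nhds (x := chartAt (Model n) p p)
    (mem_chart_target _ p) (Metric.closedBall_mem_nhds _ hr)
  rwa [(chartAt (Model n) p).left_inv (mem_chart_source _ p)] at h

/-- The factor 4 leaves room for the nested balls below: estimates on radius `r` use data on radius
`2r`, where functions are extended by a cutoff that equals 1 up to `3r` and is supported in radius
`4r`. -/
theorem exists_closedBall_subset_target (p : M) :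
    ∃ r : ℝ, 0 < r ∧
      Metric.closedBall (chartAt (Model n) p p) (4 * r) ⊆ (chartAt (Model n) p).target := by
  obtain ⟨r, hr, h⟩ := Metric.nhds_basis_closedBall.mem_iff.1
    ((chartAt (Model n) p).open_target.mem_nhds (mem_chart_target _ p))
  exact ⟨r / 4, by positivity, by convert! h using 2; ring⟩

variable [MeasurableSpace M] [BorelSpace M]

theorem aemeasurable_chart_symm (p : M) :
    AEMeasurable (chartAt (Model n) p).symm (volume.restrict (chartAt (Model n) p).target) :=
  (chartAt (Model n) p).continuousOn_symm.aemeasurable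
    (chartAt (Model n) p).open_target.measurableSet

theorem measurableSet_target_inter (p : M) {s : Set M} (hs : MeasurableSet s) :
    MeasurableSet ((chartAt (Model n) p).target ∩ (chartAt (Model n) p).symm ⁻¹' s) :=
  measurableSet_inter_preimage_of_continuousOn (chartAt (Model n) p).continuousOn_symm
    (chartAt (Model n) p).open_target.measurableSet hs

/-- The push-forward of Lebesgue measure on a compact subset of a chart. -/
def pushLebesgue (p : M) (K : Set (Model n)) : Measure M :=
  Measure.map (chartAt (Model n) p).symm (volume.restrict K)

theorem aemeasurable_chart_symm_restrict {p : M} {K : Set (Model n)}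
    (hKt : K ⊆ (chartAt (Model n) p).target) :
    AEMeasurable (chartAt (Model n) p).symm (volume.restrict K) :=
  (aemeasurable_chart_symm p).mono_measure (Measure.restrict_mono hKt le_rfl)

end ChartMeasurability

/-! ### The Riemannian volume and its comparison with Lebesgue measure -/

section Volume

variable {n : ℕ} {M : Type*} [TopologicalSpace M] [ChartedSpace (Model n) M]
  [IsManifold (𝓡 n) ∞ M]

/-- The density of the Riemannian volume in the chart at `p`. -/
def volDensity (g : SmoothMetric n M) (p : M) (y : Model n) : ℝ := Real.sqrt (gram g p y).det

theorem continuousOn_volDensity (g : SmoothMetric n M) (p : M) :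
    ContinuousOn (volDensity g p) (chartAt (Model n) p).target :=
  Real.continuous_sqrt.comp_continuousOn
    (continuousOn_det fun i j => (contDiffOn_gram g p i j).continuousOn)

theorem volDensity_pos (g : SmoothMetric n M) (p : M) {y : Model n}
    (hy : y ∈ (chartAt (Model n) p).target) : 0 < volDensity g p y :=
  Real.sqrt_pos.2 (gram_posDef g p hy).det_pos

theorem volDensity_transition (g : SmoothMetric n M) {p q : M} {y : Model n}
    (hy : y ∈ (chartAt (Model n) p).target)
    (hq : (chartAt (Model n) p).symm y ∈ (chartAt (Model n) q).source) :
    |(fderiv ℝ (transition p q) y).det| * volDensity g q (transition p q y) =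
      volDensity g p y := by
  rw [det_fderiv_transition, volDensity, volDensity, gram_transition g hy hq, Matrix.det_mul,
    Matrix.det_mul, Matrix.det_transpose, ← Real.sqrt_sq_eq_abs, ← Real.sqrt_mul (sq_nonneg _)]
  congr 1
  ring

variable [MeasurableSpace M] [BorelSpace M]

theorem chartVolume_apply (g : SmoothMetric n M) (p : M) {s : Set M} (hs : MeasurableSet s) :
    chartVolume g p s =
      ∫⁻ y in (chartAt (Model n) p).target ∩ (chartAt (Model n) p).symm ⁻¹' s,
        ENNReal.ofReal (volDensity g p y) := by
  rw [chartVolume, Measure.map_apply_of_aemeasurable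
    ((aemeasurable_chart_symm p).mono_ac (withDensity_absolutelyContinuous _ _)) hs,
    withDensity_apply', Measure.restrict_restrict'
      (chartAt (Model n) p).open_target.measurableSet, Set.inter_comm]
  rfl

/-- Change of variables along the transition map; by `volDensity_transition` its Jacobian turns one
density into the other. -/
theorem chartVolume_inter_source_le (g : SmoothMetric n M) (p q : M) {s : Set M}
    (hs : MeasurableSet s) :
    chartVolume g q (s ∩ (chartAt (Model n) p).source) ≤ chartVolume g p s := by
  have hp := (chartAt (Model n) p).open_source.measurableSet
  have hq := (chartAt (Model n) q).open_source.measurableSet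
  set A := (chartAt (Model n) p).target ∩
    (chartAt (Model n) p).symm ⁻¹' (s ∩ (chartAt (Model n) q).source) with hA
  have hAm : MeasurableSet A := measurableSet_target_inter p (hs.inter hq)
  have himage : (chartAt (Model n) q).target ∩
      (chartAt (Model n) q).symm ⁻¹' (s ∩ (chartAt (Model n) p).source) = transition p q '' A := by
    ext z
    constructor
    · rintro ⟨hz, hzs, hzp⟩
      refine ⟨transition q p z, ⟨transition_mem hzp, ?_, ?_⟩, transition_transition hz hzp⟩
      · rw [symm_transition hzp]; exact hzs
      · rw [symm_transition hzp]; exact (chartAt (Model n) q).map_target hz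
    · rintro ⟨y, ⟨hy, hys, hyq⟩, rfl⟩
      refine ⟨transition_mem hyq, ?_, ?_⟩
      · rw [symm_transition hyq]; exact hys
      · rw [symm_transition hyq]; exact (chartAt (Model n) p).map_target hy
  have hinj : Set.InjOn (transition p q) A := by
    rintro y ⟨hy, -, hyq⟩ z ⟨hz, -, hzq⟩ h
    rw [← transition_transition hy hyq, h, transition_transition hz hzq]
  rw [chartVolume_apply g q (hs.inter hp), chartVolume_apply g p hs, himage,
    lintegral_image_eq_lintegral_abs_det_fderiv_mul volume hAm
      (fun y hy => (((contDiffAt_transition hy.1 hy.2.2).differentiableAt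
        (by simp)).hasFDerivAt).hasFDerivWithinAt) hinj]
  rw [setLIntegral_congr_fun (g := fun y => ENNReal.ofReal (volDensity g p y)) hAm]
  · exact lintegral_mono_set fun y hy => ⟨hy.1, hy.2.1⟩
  · intro y hy
    simp only
    rw [← ENNReal.ofReal_mul (abs_nonneg _), volDensity_transition g hy.1 hy.2.2]

/-- Shows that the supremum of measures in the definition of `vol` glues the chart volumes
correctly. -/
theorem vol_eq_chartVolume (g : SmoothMetric n M) (p : M) {s : Set M} (hs : MeasurableSet s)
    (hsp : s ⊆ (chartAt (Model n) p).source) : vol g s = chartVolume g p s := by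
  refine le_antisymm ?_ (Measure.le_iff'.1 (le_iSup (chartVolume g) p) s)
  have hp := (chartAt (Model n) p).open_source.measurableSet
  -- A supremum of measures is not computed set by set. It is bounded by exhibiting one measure
  -- above every `chartVolume g q`; the second summand is invisible to subsets of the chart domain.
  have h : vol g ≤ chartVolume g p + (vol g).restrict (chartAt (Model n) p).sourceᶜ := by
    refine iSup_le fun q => Measure.le_iff.2 fun t ht => ?_
    rw [← measure_inter_add_sdiff t hp, Measure.add_apply, Measure.restrict_apply ht]
    refine add_le_add (chartVolume_inter_source_le g p q ht) ?_
    rw [Set.sdiff_eq]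
    exact Measure.le_iff'.1 (le_iSup (chartVolume g) q) _
  refine (Measure.le_iff.1 h s hs).trans ?_
  rw [Measure.add_apply, Measure.restrict_apply hs]
  have : s ∩ (chartAt (Model n) p).sourceᶜ = ∅ := by
    rw [← Set.sdiff_eq]; exact Set.sdiff_eq_empty.2 hsp
  rw [this, measure_empty, add_zero]

variable {p : M} {K : Set (Model n)} (hK : IsCompact K) (hKt : K ⊆ (chartAt (Model n) p).target)
include hK hKt

/-- On a compact subset of a chart the density `√(det g)` is bounded away from zero. With the upper
bound behind `vol_restrict_le`, this allows integrals to be moved between the chart and the manifold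
at the cost of a constant. -/
theorem pushLebesgue_le (g : SmoothMetric n M) :
    ∃ C : ℝ≥0∞, C ≠ ⊤ ∧ pushLebesgue p K ≤ C • vol g := by
  obtain ⟨c, hc, hcK⟩ : ∃ c, 0 < c ∧ ∀ y ∈ K, c ≤ volDensity g p y := by
    rcases K.eq_empty_or_nonempty with rfl | hne
    · exact ⟨1, one_pos, by simp⟩
    · obtain ⟨y, hy, hmin⟩ := hK.exists_isMinOn hne ((continuousOn_volDensity g p).mono hKt)
      exact ⟨_, volDensity_pos g p (hKt hy), fun z hz => hmin hz⟩
  refine ⟨ENNReal.ofReal c⁻¹, ENNReal.ofReal_ne_top, Measure.le_iff.2 fun s hs => ?_⟩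
  have hKs : MeasurableSet (K ∩ (chartAt (Model n) p).symm ⁻¹' s) :=
    measurableSet_inter_preimage_of_continuousOn
      ((chartAt (Model n) p).continuousOn_symm.mono hKt) hK.measurableSet hs
  rw [pushLebesgue, Measure.map_apply_of_aemeasurable (aemeasurable_chart_symm_restrict hKt) hs,
    Measure.restrict_apply' hK.measurableSet, Set.inter_comm, Measure.smul_apply, smul_eq_mul]
  calc volume (K ∩ (chartAt (Model n) p).symm ⁻¹' s)
      = ∫⁻ y in K ∩ (chartAt (Model n) p).symm ⁻¹' s, 1 := by simp
    _ ≤ ∫⁻ y in K ∩ (chartAt (Model n) p).symm ⁻¹' s,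
          ENNReal.ofReal c⁻¹ * ENNReal.ofReal (volDensity g p y) := by
        refine setLIntegral_mono' hKs fun y hy => ?_
        rw [← ENNReal.ofReal_mul (inv_nonneg.2 hc.le), ← ENNReal.ofReal_one]
        refine ENNReal.ofReal_le_ofReal ?_
        rw [inv_mul_eq_div, one_le_div hc]
        exact hcK y hy.1
    _ ≤ ∫⁻ y in (chartAt (Model n) p).target ∩ (chartAt (Model n) p).symm ⁻¹' s,
          ENNReal.ofReal c⁻¹ * ENNReal.ofReal (volDensity g p y) :=
        lintegral_mono_set (Set.inter_subset_inter_left _ hKt)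
    _ = ENNReal.ofReal c⁻¹ * chartVolume g p s := by
        rw [lintegral_const_mul' _ _ ENNReal.ofReal_ne_top, chartVolume_apply g p hs]
    _ ≤ _ := mul_le_mul_right (Measure.le_iff'.1 (le_iSup (chartVolume g) p) s) _

theorem vol_restrict_le [T2Space M] (g : SmoothMetric n M) :
    ∃ C : ℝ≥0∞, C ≠ ⊤ ∧
      (vol g).restrict ((chartAt (Model n) p).symm '' K) ≤ C • pushLebesgue p K := by
  obtain ⟨c, hcK⟩ := (hK.image_of_continuousOn ((continuousOn_volDensity g p).mono hKt)).bddAbove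
  have hKi : MeasurableSet ((chartAt (Model n) p).symm '' K) :=
    (hK.image_of_continuousOn ((chartAt (Model n) p).continuousOn_symm.mono hKt)).measurableSet
  refine ⟨ENNReal.ofReal c, ENNReal.ofReal_ne_top, Measure.le_iff.2 fun s hs => ?_⟩
  have hKs : MeasurableSet (K ∩ (chartAt (Model n) p).symm ⁻¹' s) :=
    measurableSet_inter_preimage_of_continuousOn
      ((chartAt (Model n) p).continuousOn_symm.mono hKt) hK.measurableSet hs
  have hsub : (chartAt (Model n) p).symm '' K ⊆ (chartAt (Model n) p).source := by
    rintro _ ⟨y, hy, rfl⟩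
    exact (chartAt (Model n) p).map_target (hKt hy)
  rw [Measure.restrict_apply hs, vol_eq_chartVolume g p (hs.inter hKi)
    (Set.inter_subset_right.trans hsub), chartVolume_apply g p (hs.inter hKi), Measure.smul_apply,
    pushLebesgue, Measure.map_apply_of_aemeasurable (aemeasurable_chart_symm_restrict hKt) hs,
    Measure.restrict_apply' hK.measurableSet, Set.inter_comm _ K, smul_eq_mul]
  have hset : (chartAt (Model n) p).target ∩
      (chartAt (Model n) p).symm ⁻¹' (s ∩ (chartAt (Model n) p).symm '' K) =
      K ∩ (chartAt (Model n) p).symm ⁻¹' s := by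
    ext y
    constructor
    · rintro ⟨hy, hys, z, hz, hzy⟩
      exact ⟨(chartAt (Model n) p).symm.injOn (hKt hz) hy hzy ▸ hz, hys⟩
    · rintro ⟨hy, hys⟩
      exact ⟨hKt hy, hys, y, hy, rfl⟩
  rw [hset, ← setLIntegral_const]
  refine setLIntegral_mono' hKs fun y hy => ENNReal.ofReal_le_ofReal ?_
  exact hcK ⟨y, hy.1, rfl⟩

end Volume

section Finite

variable {n : ℕ} {M : Type*} [TopologicalSpace M] [T2Space M] [ChartedSpace (Model n) M]
  [IsManifold (𝓡 n) ∞ M] [MeasurableSpace M] [BorelSpace M]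

instance isFiniteMeasure_vol [CompactSpace M] (g : SmoothMetric n M) :
    IsFiniteMeasure (vol g) := by
  refine ⟨isCompact_univ.measure_lt_top_of_nhdsWithin fun p _ => ?_⟩
  obtain ⟨r, hr, h⟩ := exists_closedBall_subset_target (n := n) p
  have hc := isCompact_closedBall (chartAt (Model n) p p) (4 * r)
  refine ⟨_, mem_nhdsWithin_of_mem_nhds (image_closedBall_mem_nhds (n := n) p
    (by positivity : 0 < 4 * r)), ?_⟩
  obtain ⟨C, hC, hle⟩ := vol_restrict_le (n := n) hc h g
  have h1 := Measure.le_iff'.1 hle Set.univ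
  rw [Measure.restrict_apply_univ] at h1
  refine h1.trans_lt ?_
  rw [Measure.smul_apply, pushLebesgue,
    Measure.map_apply_of_aemeasurable (aemeasurable_chart_symm_restrict h) MeasurableSet.univ]
  simp only [Set.preimage_univ, Measure.restrict_apply_univ, smul_eq_mul]
  exact ENNReal.mul_lt_top hC.lt_top hc.measure_lt_top

end Finite

/-! ### Continuous and smooth matrix fields -/

section MatrixFields

variable {ι : Type*} [Fintype ι]

/-- The form has a positive minimum on the product of `K` with the unit sphere, which is compact;
homogeneity gives all other vectors. -/
theorem exists_le_quadratic_of_posDef {X : Type*} [TopologicalSpace X] {K : Set X}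
    (hK : IsCompact K) {A : X → Matrix ι ι ℝ} (hA : ∀ i j, ContinuousOn (fun x => A x i j) K)
    (hpos : ∀ x ∈ K, (A x).PosDef) :
    ∃ c : ℝ, 0 < c ∧ ∀ x ∈ K, ∀ v : ι → ℝ, c * ∑ i, v i ^ 2 ≤ ∑ i, ∑ j, A x i j * v i * v j := by
  classical
  set S : Set (EuclideanSpace ℝ ι) := Metric.sphere 0 1
  have hq : ∀ x ∈ K, ∀ v : ι → ℝ, v ≠ 0 → 0 < ∑ i, ∑ j, A x i j * v i * v j := by
    intro x hx v hv
    have h := (hpos x hx).dotProduct_mulVec_pos hv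
    refine h.trans_eq ?_
    simp only [dotProduct, Matrix.mulVec, Pi.star_apply, star_trivial, Finset.mul_sum]
    exact Finset.sum_congr rfl fun i _ => Finset.sum_congr rfl fun j _ => by ring
  have hcont : ContinuousOn (fun z : X × EuclideanSpace ℝ ι =>
      ∑ i, ∑ j, A z.1 i j * z.2 i * z.2 j) (K ×ˢ S) := by
    refine continuousOn_finsetSum _ fun i _ => continuousOn_finsetSum _ fun j _ => ?_
    have h1 : ContinuousOn (fun z : X × EuclideanSpace ℝ ι => A z.1 i j) (K ×ˢ S) :=
      (hA i j).comp continuousOn_fst fun z hz => hz.1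
    exact (h1.mul (by fun_prop)).mul (by fun_prop)
  have hcpt : IsCompact (K ×ˢ S) := hK.prod (isCompact_sphere _ _)
  have hmin : ∃ c : ℝ, 0 < c ∧ ∀ z ∈ K ×ˢ S, c ≤ ∑ i, ∑ j, A z.1 i j * z.2 i * z.2 j := by
    rcases (K ×ˢ S).eq_empty_or_nonempty with h | hne
    · exact ⟨1, one_pos, by simp [h]⟩
    · obtain ⟨z, hz, hmin⟩ := hcpt.exists_isMinOn hne hcont
      refine ⟨_, hq z.1 hz.1 z.2 ?_, fun w hw => hmin hw⟩
      intro h0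
      have h1 : z.2 = 0 := by ext i; exact congrFun h0 i
      have h2 : ‖z.2‖ = 1 := by simpa [S] using hz.2
      rw [h1, norm_zero] at h2
      exact zero_ne_one h2
  obtain ⟨c, hc, hmin⟩ := hmin
  refine ⟨c, hc, fun x hx v => ?_⟩
  by_cases hv : v = 0
  · simp [hv]
  set V : EuclideanSpace ℝ ι := WithLp.toLp 2 v
  have hV : 0 < ‖V‖ := norm_pos_iff.2 fun h => hv (by simpa [V] using h)
  have hVsq : ‖V‖ ^ 2 = ∑ i, v i ^ 2 := by
    rw [EuclideanSpace.norm_sq_eq]; simp [V]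
  have h := hmin (x, ‖V‖⁻¹ • V) ⟨hx, by simp [S, norm_smul, hV.ne']⟩
  have h2 : ∑ i, ∑ j, A x i j * (‖V‖⁻¹ • V) i * (‖V‖⁻¹ • V) j =
      (‖V‖ ^ 2)⁻¹ * ∑ i, ∑ j, A x i j * v i * v j := by
    simp only [Finset.mul_sum, PiLp.smul_apply, smul_eq_mul, V]
    exact Finset.sum_congr rfl fun i _ => Finset.sum_congr rfl fun j _ => by
      rw [← inv_pow]; ring
  simp only at h
  rw [h2, inv_mul_eq_div, le_div_iff₀ (by positivity), hVsq] at h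
  exact h

theorem exists_quadratic_le {X : Type*} [TopologicalSpace X] {K : Set X}
    (hK : IsCompact K) {A : X → Matrix ι ι ℝ} (hA : ∀ i j, ContinuousOn (fun x => A x i j) K) :
    ∃ C : ℝ, 0 < C ∧ ∀ x ∈ K, ∀ v : ι → ℝ, ∑ i, ∑ j, A x i j * v i * v j ≤ C * ∑ i, v i ^ 2 := by
  choose B hB using fun i j => hK.exists_bound_of_continuousOn (hA i j)
  refine ⟨∑ i, ∑ j, |B i j| + 1, by positivity, fun x hx v => ?_⟩
  have hv : ∀ i j, |v i * v j| ≤ ∑ k, v k ^ 2 := by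
    intro i j
    have h1 := Finset.single_le_sum (f := fun k => v k ^ 2) (fun k _ => sq_nonneg _)
      (Finset.mem_univ i)
    have h2 := Finset.single_le_sum (f := fun k => v k ^ 2) (fun k _ => sq_nonneg _)
      (Finset.mem_univ j)
    rw [abs_le]
    constructor <;> nlinarith [sq_nonneg (v i - v j), sq_nonneg (v i + v j)]
  have h0 : 0 ≤ ∑ k, v k ^ 2 := Finset.sum_nonneg fun k _ => sq_nonneg _
  calc ∑ i, ∑ j, A x i j * v i * v j ≤ ∑ i, ∑ j, |B i j| * ∑ k, v k ^ 2 := by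
        refine Finset.sum_le_sum fun i _ => Finset.sum_le_sum fun j _ => ?_
        rw [mul_assoc]
        refine (le_abs_self _).trans ?_
        rw [abs_mul]
        exact mul_le_mul ((hB i j x hx).trans (le_abs_self _)) (hv i j) (abs_nonneg _)
          (abs_nonneg _)
    _ = (∑ i, ∑ j, |B i j|) * ∑ k, v k ^ 2 := by simp only [Finset.sum_mul]
    _ ≤ _ := by nlinarith

variable [DecidableEq ι] {E : Type*} [NormedAddCommGroup E] [NormedSpace ℝ E]

theorem contDiffOn_det {A : E → Matrix ι ι ℝ} {s : Set E} {k : ℕ∞ω}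
    (hA : ∀ i j, ContDiffOn ℝ k (fun x => A x i j) s) :
    ContDiffOn ℝ k (fun x => (A x).det) s := by
  simp only [Matrix.det_apply]
  exact ContDiffOn.sum fun σ _ => (contDiffOn_prod fun i _ => hA _ _).const_smul _

/-- Cramer's rule: an entry of the inverse is a quotient of two determinants. -/
theorem contDiffOn_inv_apply {A : E → Matrix ι ι ℝ} {s : Set E} {k : ℕ∞ω}
    (hA : ∀ i j, ContDiffOn ℝ k (fun x => A x i j) s) (hdet : ∀ x ∈ s, (A x).det ≠ 0) (i j : ι) :
    ContDiffOn ℝ k (fun x => (A x)⁻¹ i j) s := by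
  have h : ∀ x ∈ s, (A x)⁻¹ i j =
      ((A x).det)⁻¹ * ((A x).updateRow j (Pi.single i 1)).det := by
    intro x hx
    rw [Matrix.inv_def, Matrix.smul_apply, Matrix.adjugate_apply, Ring.inverse_eq_inv', smul_eq_mul]
  refine ContDiffOn.congr ?_ h
  refine ((contDiffOn_det hA).inv hdet).mul (contDiffOn_det fun a b => ?_)
  by_cases ha : a = j
  · subst ha
    simp only [Matrix.updateRow_self]
    exact contDiffOn_const
  · simp only [Matrix.updateRow_ne ha]
    exact hA a b

end MatrixFields

/-! ### Cutoffs and the Sobolev inequality on Euclidean balls -/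

section Euclidean

variable {n : ℕ}

theorem contDiff_mul_of_tsupport_subset {E : Type*} [NormedAddCommGroup E] [NormedSpace ℝ E]
    {k : ℕ∞ω} {χ f : E → ℝ} {U : Set E} (hU : IsOpen U) (hχ : ContDiff ℝ k χ)
    (hsupp : tsupport χ ⊆ U) (hf : ContDiffOn ℝ k f U) : ContDiff ℝ k (fun x => χ x * f x) := by
  rw [contDiff_iff_contDiffAt]
  intro x
  by_cases hx : x ∈ U
  · exact hχ.contDiffAt.mul (hf.contDiffAt (hU.mem_nhds hx))
  · have h : (fun x => χ x * f x) =ᶠ[𝓝 x] fun _ => 0 := by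
      have h0 := (isClosed_tsupport χ).isOpen_compl.mem_nhds (fun h => hx (hsupp h))
      filter_upwards [h0] with y hy
      rw [image_eq_zero_of_notMem_tsupport hy, zero_mul]
    exact contDiffAt_const.congr_of_eventuallyEq h

/-- A function read in a chart is smooth only on the target, while the Euclidean estimates want
smooth functions on all of `ℝⁿ`. The cutoff is 1 on a larger ball than the one of the conclusion, so
that germs agree there and hence all derivatives. -/
theorem exists_contDiff_extension {c : Model n} {r : ℝ} (hr : 0 < r) {U : Set (Model n)}
    (hU : IsOpen U) (hsub : Metric.closedBall c (4 * r) ⊆ U) {k : ℕ∞} {f : Model n → ℝ}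
    (hf : ContDiffOn ℝ k f U) :
    ∃ F : Model n → ℝ, ContDiff ℝ k F ∧ ∀ y ∈ Metric.closedBall c (2 * r), F =ᶠ[𝓝 y] f := by
  let η : ContDiffBump c := ⟨3 * r, 4 * r, by positivity, by linarith⟩
  refine ⟨fun x => η x * f x, contDiff_mul_of_tsupport_subset hU η.contDiff
    (by rw [η.tsupport_eq]; exact hsub) hf, fun y hy => ?_⟩
  have hy' : Metric.ball c (3 * r) ∈ 𝓝 y := Metric.isOpen_ball.mem_nhds
    (Metric.closedBall_subset_ball (by linarith) hy)
  filter_upwards [hy'] with z hz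
  rw [η.one_of_mem_closedBall (Metric.ball_subset_closedBall hz), one_mul]

/-- The Gagliardo–Nirenberg–Sobolev inequality for the compactly supported function `χ h`.
Differentiating the cutoff produces the term with `h` itself on the right. -/
theorem exists_eLpNorm_closedBall_le (hn : 0 < n) {p p' : NNReal} (hp : 1 ≤ p)
    (hp' : (p' : ℝ)⁻¹ = (p : ℝ)⁻¹ - (n : ℝ)⁻¹) (c : Model n) {r : ℝ} (hr : 0 < r) :
    ∃ C : ℝ≥0∞, C ≠ ⊤ ∧ ∀ h : Model n → ℝ, ContDiff ℝ 1 h →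
      eLpNorm h p' (volume.restrict (Metric.closedBall c r)) ≤
        C * (eLpNorm h p (volume.restrict (Metric.closedBall c (2 * r))) +
          eLpNorm (fderiv ℝ h) p (volume.restrict (Metric.closedBall c (2 * r)))) := by
  let χ : ContDiffBump c := ⟨r, 2 * r, hr, by linarith⟩
  have hχ : ContDiff ℝ 1 χ := χ.contDiff
  obtain ⟨B, hB⟩ := (hχ.continuous_fderiv (by norm_num)).bounded_above_of_compact_support
    (χ.hasCompactSupport.fderiv ℝ)
  have hB0 : 0 ≤ B := (norm_nonneg _).trans (hB c)
  set K := SNormLESNormFDerivOfEqConst ℝ (volume : Measure (Model n)) p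
  refine ⟨K * (ENNReal.ofReal B + 1), by finiteness, fun h hh => ?_⟩
  set u : Model n → ℝ := fun x => χ x * h x with hu
  have hucs : HasCompactSupport u := χ.hasCompactSupport.mul_right
  have hu1 : ContDiff ℝ 1 u := hχ.mul hh
  have h1 : eLpNorm h p' (volume.restrict (Metric.closedBall c r)) ≤ eLpNorm u p' volume := by
    have : eLpNorm h p' (volume.restrict (Metric.closedBall c r)) =
        eLpNorm u p' (volume.restrict (Metric.closedBall c r)) := by
      refine eLpNorm_congr_ae ((ae_restrict_iff' Metric.isClosed_closedBall.measurableSet).2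
        (Eventually.of_forall fun x hx => ?_))
      rw [hu]; simp only
      rw [χ.one_of_mem_closedBall hx, one_mul]
    rw [this]
    exact eLpNorm_mono_measure _ Measure.restrict_le_self
  have h2 := eLpNorm_le_eLpNorm_fderiv_of_eq (volume : Measure (Model n)) hu1 hucs (p := p)
    (p' := p') hp (by simpa using hn) (by simpa using hp')
  have h3 : eLpNorm (fderiv ℝ u) p volume =
      eLpNorm (fderiv ℝ u) p (volume.restrict (Metric.closedBall c (2 * r))) := by
    symm
    apply eLpNorm_restrict_eq_of_support_subset (f := fderiv ℝ u)
    have hs : tsupport u ⊆ tsupport χ :=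
      closure_mono (Function.support_mul_subset_left (fun x => χ x) h)
    rw [χ.tsupport_eq] at hs
    exact (support_fderiv_subset ℝ).trans hs
  have h4 : eLpNorm (fderiv ℝ u) p (volume.restrict (Metric.closedBall c (2 * r))) ≤
      eLpNorm (fun x => ‖fderiv ℝ h x‖ + B * ‖h x‖) p
        (volume.restrict (Metric.closedBall c (2 * r))) := by
    refine eLpNorm_mono_real fun x => ?_
    have hd : fderiv ℝ u x = χ x • fderiv ℝ h x + h x • fderiv ℝ χ x :=
      fderiv_fun_mul (hχ.differentiable (by norm_num) x) (hh.differentiable (by norm_num) x)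
    rw [hd]
    refine (norm_add_le _ _).trans (add_le_add ?_ ?_)
    · rw [norm_smul, Real.norm_of_nonneg χ.nonneg]
      exact mul_le_of_le_one_left (norm_nonneg _) χ.le_one
    · rw [norm_smul, mul_comm]
      exact mul_le_mul_of_nonneg_right (hB x) (norm_nonneg _)
  have hm1 : Continuous (fderiv ℝ h) := hh.continuous_fderiv (by norm_num)
  have hm2 : Continuous h := hh.continuous
  have h5 : eLpNorm (fun x => ‖fderiv ℝ h x‖ + B * ‖h x‖) p
        (volume.restrict (Metric.closedBall c (2 * r))) ≤
      eLpNorm (fderiv ℝ h) p (volume.restrict (Metric.closedBall c (2 * r))) +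
      ENNReal.ofReal B * eLpNorm h p (volume.restrict (Metric.closedBall c (2 * r))) := by
    refine (eLpNorm_add_le (f := fun x => ‖fderiv ℝ h x‖) (g := fun x => B * ‖h x‖)
      hm1.norm.aestronglyMeasurable (hm2.norm.const_mul B |>.aestronglyMeasurable)
      (by exact_mod_cast hp)).trans ?_
    rw [eLpNorm_norm]
    refine add_le_add le_rfl ?_
    have := eLpNorm_const_smul B (fun x => ‖h x‖) p
      (volume.restrict (Metric.closedBall c (2 * r)))
    rw [eLpNorm_norm] at this
    refine (this.trans ?_).le
    rw [Real.enorm_of_nonneg hB0]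
  refine (h1.trans h2).trans ?_
  rw [h3, mul_assoc]
  refine mul_le_mul_right ((h4.trans h5).trans ?_) _
  rw [add_mul, one_mul, mul_add]
  set a := eLpNorm h p (volume.restrict (Metric.closedBall c (2 * r)))
  set b := eLpNorm (fderiv ℝ h) p (volume.restrict (Metric.closedBall c (2 * r)))
  calc b + ENNReal.ofReal B * a ≤ (a + b) + (ENNReal.ofReal B * a + ENNReal.ofReal B * b) :=
        add_le_add le_add_self le_self_add
    _ = _ := add_comm _ _

end Euclidean

/-! ### Partial derivatives and a divergence identity -/

section PartialDeriv

variable {n : ℕ} {f h : Model n → ℝ}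

theorem partialDeriv_mul {y : Model n} (hf : DifferentiableAt ℝ f y)
    (hh : DifferentiableAt ℝ h y) (i : Fin n) :
    partialDeriv i (fun z => f z * h z) y = f y * partialDeriv i h y + partialDeriv i f y * h y := by
  rw [partialDeriv, fderiv_fun_mul hf hh]
  simp [partialDeriv, mul_comm]

theorem contDiff_partialDeriv {k m : ℕ∞ω} (hf : ContDiff ℝ k f) (hmk : m + 1 ≤ k) (i : Fin n) :
    ContDiff ℝ m (partialDeriv i f) :=
  (hf.fderiv_right hmk).clm_apply contDiff_const

theorem partialDeriv_partialDeriv (hf : ContDiff ℝ 2 f) (i j : Fin n) (y : Model n) :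
    partialDeriv i (partialDeriv j f) y =
      fderiv ℝ (fderiv ℝ f) y (EuclideanSpace.single i 1) (EuclideanSpace.single j 1) := by
  have h1 : DifferentiableAt ℝ (fderiv ℝ f) y :=
    (hf.fderiv_right (m := 1) (by norm_num)).differentiable (by norm_num) y
  have h2 := h1.hasFDerivAt.clm_apply
    (hasFDerivAt_const (EuclideanSpace.single j (1 : ℝ) : Model n) y)
  have h3 : partialDeriv j f = fun y => fderiv ℝ f y (EuclideanSpace.single j 1) := rfl
  rw [partialDeriv, h3, h2.fderiv]
  simp

theorem partialDeriv_comm (hf : ContDiff ℝ 2 f) (i j : Fin n) :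
    partialDeriv i (partialDeriv j f) = partialDeriv j (partialDeriv i f) := by
  funext y
  rw [partialDeriv_partialDeriv hf, partialDeriv_partialDeriv hf]
  have := hf.contDiffAt.isSymmSndFDerivAt (x := y) (by simp)
  exact this _ _

theorem integral_partialDeriv_eq_zero (hf : ContDiff ℝ 1 f) (hcs : HasCompactSupport f)
    (i : Fin n) : ∫ y, partialDeriv i f y = 0 := by
  have h1 : Integrable (fun y => partialDeriv i f y) :=
    (contDiff_partialDeriv hf (m := 0) (by norm_num) i).continuous.integrable_of_hasCompactSupport
      (hcs.fderiv_apply ℝ _)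
  -- Integration by parts against the constant function 1.
  have h := integral_mul_fderiv_eq_neg_fderiv_mul_of_integrable (μ := (volume : Measure (Model n)))
    (f := fun _ => (1 : ℝ)) (g := f) (v := EuclideanSpace.single i 1)
    (by simp) (by simpa [partialDeriv] using h1)
    (by simpa using hf.continuous.integrable_of_hasCompactSupport hcs)
    (fun _ _ => differentiableAt_const _) (fun y _ => hf.differentiable (by norm_num) y)
  simpa [partialDeriv] using h

/-- The divergence form of `w (∂ᵢₖf ∂ⱼₗf - ∂ᵢⱼf ∂ₖₗf)`, up to terms of lower order. -/
theorem partialDeriv_sub_partialDeriv {w : Model n → ℝ} (hw : ContDiff ℝ 1 w)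
    (hf : ContDiff ℝ 3 f) (i j k l : Fin n) (y : Model n) :
    partialDeriv j (fun z => w z * (partialDeriv i (partialDeriv k f) z * partialDeriv l f z)) y -
      partialDeriv k (fun z => w z * (partialDeriv i (partialDeriv j f) z * partialDeriv l f z)) y =
    w y * (partialDeriv i (partialDeriv k f) y * partialDeriv j (partialDeriv l f) y -
        partialDeriv i (partialDeriv j f) y * partialDeriv k (partialDeriv l f) y) +
      (partialDeriv j w y * partialDeriv i (partialDeriv k f) y -
        partialDeriv k w y * partialDeriv i (partialDeriv j f) y) * partialDeriv l f y := by
  have hf1 : ∀ i, ContDiff ℝ 2 (partialDeriv i f) := fun i =>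
    contDiff_partialDeriv hf (by norm_num) i
  have hf2 : ∀ i j, ContDiff ℝ 1 (partialDeriv i (partialDeriv j f)) := fun i j =>
    contDiff_partialDeriv (hf1 j) (by norm_num) i
  have d0 : DifferentiableAt ℝ w y := hw.differentiable (by norm_num) y
  have d1 : ∀ i, DifferentiableAt ℝ (partialDeriv i f) y := fun i =>
    (hf1 i).differentiable (by norm_num) y
  have d2 : ∀ i j, DifferentiableAt ℝ (partialDeriv i (partialDeriv j f)) y := fun i j =>
    (hf2 i j).differentiable (by norm_num) y
  -- The two divergences contain the same third derivative of `f`, so it drops out of their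
  -- difference.
  have hcomm : partialDeriv j (partialDeriv i (partialDeriv k f)) =
      partialDeriv k (partialDeriv i (partialDeriv j f)) := by
    rw [partialDeriv_comm (hf1 k), partialDeriv_comm (hf.of_le (by norm_num)) j k,
      partialDeriv_comm (hf1 j)]
  rw [partialDeriv_mul d0 ((d2 i k).fun_mul (d1 l)), partialDeriv_mul d0 ((d2 i j).fun_mul (d1 l)),
    partialDeriv_mul (d2 i k) (d1 l), partialDeriv_mul (d2 i j) (d1 l), hcomm]
  ring

theorem integral_sum_eq_zero {X ι : Type*} [MeasurableSpace X] {μ : Measure X} [Fintype ι]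
    {s : ι → X → ℝ} (h : ∀ i, Integrable (s i) μ ∧ ∫ x, s i x ∂μ = 0) :
    Integrable (fun x => ∑ i, s i x) μ ∧ ∫ x, ∑ i, s i x ∂μ = 0 := by
  refine ⟨integrable_finsetSum _ fun i _ => (h i).1, ?_⟩
  rw [integral_finsetSum _ fun i _ => (h i).1]
  exact Finset.sum_eq_zero fun i _ => (h i).2

end PartialDeriv

/-! ### Interior `L²` estimate for second derivatives -/

section HessianEstimate

variable {n : ℕ}

/-- `∑ᵢ (∂ᵢf)²`. -/
def euclGradSq (f : Model n → ℝ) (y : Model n) : ℝ := ∑ i, partialDeriv i f y ^ 2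

/-- `∑ᵢⱼ (∂ᵢ∂ⱼf)²`. -/
def euclHessSq (f : Model n → ℝ) (y : Model n) : ℝ :=
  ∑ i, ∑ j, partialDeriv i (partialDeriv j f) y ^ 2

theorem abs_partialDeriv_le (f : Model n → ℝ) (y : Model n) (i : Fin n) :
    |partialDeriv i f y| ≤ Real.sqrt (euclGradSq f y) := by
  rw [← Real.sqrt_sq_eq_abs]
  exact Real.sqrt_le_sqrt (Finset.single_le_sum (f := fun i => partialDeriv i f y ^ 2)
    (fun _ _ => sq_nonneg _) (Finset.mem_univ i))

theorem abs_partialDeriv_partialDeriv_le (f : Model n → ℝ) (y : Model n) (i j : Fin n) :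
    |partialDeriv i (partialDeriv j f) y| ≤ Real.sqrt (euclHessSq f y) := by
  rw [← Real.sqrt_sq_eq_abs]
  refine Real.sqrt_le_sqrt ?_
  exact (Finset.single_le_sum (f := fun j => partialDeriv i (partialDeriv j f) y ^ 2)
    (fun _ _ => sq_nonneg _) (Finset.mem_univ j)).trans
    (Finset.single_le_sum (f := fun i => ∑ j, partialDeriv i (partialDeriv j f) y ^ 2)
    (fun _ _ => Finset.sum_nonneg fun _ _ => sq_nonneg _) (Finset.mem_univ i))

theorem euclGradSq_nonneg (f : Model n → ℝ) (y : Model n) : 0 ≤ euclGradSq f y :=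
  Finset.sum_nonneg fun _ _ => sq_nonneg _

theorem euclHessSq_nonneg (f : Model n → ℝ) (y : Model n) : 0 ≤ euclHessSq f y :=
  Finset.sum_nonneg fun _ _ => Finset.sum_nonneg fun _ _ => sq_nonneg _

theorem continuous_euclGradSq {f : Model n → ℝ} (hf : ContDiff ℝ 1 f) :
    Continuous (euclGradSq f) :=
  continuous_finsetSum _ fun i _ =>
    (contDiff_partialDeriv hf (m := 0) (by norm_num) i).continuous.pow 2

theorem continuous_euclHessSq {f : Model n → ℝ} (hf : ContDiff ℝ 2 f) :
    Continuous (euclHessSq f) :=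
  continuous_finsetSum _ fun i _ => continuous_finsetSum _ fun j _ =>
    (contDiff_partialDeriv (contDiff_partialDeriv hf (m := 1) (by norm_num) j) (m := 0)
      (by norm_num) i).continuous.pow 2

/-- The interior `L²` estimate for second derivatives by a non-degenerate second order operator
`∑ A^{ij} ∂ᵢ∂ⱼ` and the first derivatives. -/
theorem exists_integral_euclHessSq_le {A : Model n → Matrix (Fin n) (Fin n) ℝ} {U : Set (Model n)}
    (hU : IsOpen U) (hA : ∀ i j, ContDiffOn ℝ 1 (fun y => A y i j) U)
    (hpos : ∀ y ∈ U, (A y).PosDef) {c : Model n} {r : ℝ} (hr : 0 < r)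
    (hsub : Metric.closedBall c (2 * r) ⊆ U) :
    ∃ C : ℝ, 0 ≤ C ∧ ∀ f : Model n → ℝ, ContDiff ℝ 3 f →
      ∫ y in Metric.closedBall c r, euclHessSq f y ≤
        C * ∫ y in Metric.closedBall c (2 * r),
          ((∑ i, ∑ j, A y i j * partialDeriv i (partialDeriv j f) y) ^ 2 + euclGradSq f y) := by
  set K := Metric.closedBall c (2 * r) with hKdef
  have hK : IsCompact K := isCompact_closedBall _ _
  let χ : ContDiffBump c := ⟨r, 2 * r, hr, by linarith⟩
  have hχ : ContDiff ℝ 1 χ := χ.contDiff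
  have hχK : tsupport χ = K := χ.tsupport_eq
  have hχ0 : ∀ y, y ∉ K → χ y = 0 := fun y hy =>
    image_eq_zero_of_notMem_tsupport (by rwa [hχK])
  -- localized coefficients
  set a : Fin n → Fin n → Model n → ℝ := fun i j y => χ y * A y i j with ha
  have haC : ∀ i j, ContDiff ℝ 1 (a i j) := fun i j =>
    contDiff_mul_of_tsupport_subset hU hχ (hχK ▸ hsub) (hA i j)
  have haS : ∀ i j, HasCompactSupport (a i j) := fun i j => χ.hasCompactSupport.mul_right
  -- bounds
  obtain ⟨c₀, hc₀, hlow⟩ := exists_le_quadratic_of_posDef (ι := Fin n × Fin n) hK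
    (A := fun y => Matrix.kroneckerMap (· * ·) (A y) (A y))
    (fun p q => by
      simp only [Matrix.kroneckerMap_apply]
      exact ((hA _ _).continuousOn.mono hsub).mul ((hA _ _).continuousOn.mono hsub))
    (fun y hy => (hpos y (hsub hy)).kronecker (hpos y (hsub hy)))
  choose B₁ hB₁ using fun i j => hK.exists_bound_of_continuousOn ((hA i j).continuousOn.mono hsub)
  have hB₂' : ∀ i j k, ∃ B, ∀ y, ‖partialDeriv k (a i j) y‖ ≤ B := fun i j k =>
    (contDiff_partialDeriv (haC i j) (m := 0) (by norm_num) k).continuous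
      |>.bounded_above_of_compact_support ((haS i j).fderiv_apply ℝ _)
  choose B₂ hB₂ using hB₂'
  -- The bound on `a` keeps the factor `χ`. Each derivative of a product `a · a` then still carries
  -- one `χ`, without which the error could not be absorbed by `χ² |D²f|²`.
  obtain ⟨B, hB0, hBa, hBd⟩ : ∃ B : ℝ, 0 ≤ B ∧ (∀ i j y, |a i j y| ≤ B * χ y) ∧
      ∀ i j k y, |partialDeriv k (a i j) y| ≤ B := by
    refine ⟨∑ i, ∑ j, (|B₁ i j| + ∑ k, |B₂ i j k|), by positivity, ?_, ?_⟩
    · intro i j y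
      by_cases hy : y ∈ K
      · rw [ha]; simp only
        rw [abs_mul, abs_of_nonneg χ.nonneg, mul_comm]
        refine mul_le_mul_of_nonneg_right ?_ χ.nonneg
        have h1 : |A y i j| ≤ |B₁ i j| := (hB₁ i j y hy).trans (le_abs_self _)
        have h2 : |B₁ i j| + ∑ k, |B₂ i j k| ≤ ∑ j, (|B₁ i j| + ∑ k, |B₂ i j k|) :=
          Finset.single_le_sum (f := fun j => |B₁ i j| + ∑ k, |B₂ i j k|)
            (fun _ _ => by positivity) (Finset.mem_univ j)
        have h3 : ∑ j, (|B₁ i j| + ∑ k, |B₂ i j k|) ≤ ∑ i, ∑ j, (|B₁ i j| + ∑ k, |B₂ i j k|) :=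
          Finset.single_le_sum (f := fun i => ∑ j, (|B₁ i j| + ∑ k, |B₂ i j k|))
            (fun _ _ => by positivity) (Finset.mem_univ i)
        have h4 : 0 ≤ ∑ k, |B₂ i j k| := by positivity
        linarith
      · simp [ha, hχ0 y hy]
    · intro i j k y
      have h1 : |partialDeriv k (a i j) y| ≤ |B₂ i j k| := (hB₂ i j k y).trans (le_abs_self _)
      have h0 : |B₂ i j k| ≤ ∑ k, |B₂ i j k| :=
        Finset.single_le_sum (f := fun k => |B₂ i j k|) (fun _ _ => by positivity)
          (Finset.mem_univ k)
      have h2 : |B₁ i j| + ∑ k, |B₂ i j k| ≤ ∑ j, (|B₁ i j| + ∑ k, |B₂ i j k|) :=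
        Finset.single_le_sum (f := fun j => |B₁ i j| + ∑ k, |B₂ i j k|)
          (fun _ _ => by positivity) (Finset.mem_univ j)
      have h3 : ∑ j, (|B₁ i j| + ∑ k, |B₂ i j k|) ≤ ∑ i, ∑ j, (|B₁ i j| + ∑ k, |B₂ i j k|) :=
        Finset.single_le_sum (f := fun i => ∑ j, (|B₁ i j| + ∑ k, |B₂ i j k|))
          (fun _ _ => by positivity) (Finset.mem_univ i)
      have h4 : 0 ≤ |B₁ i j| := abs_nonneg _
      linarith
  -- There are `n⁴` index tuples, each contributing an error of size at most `4B²` times `χ |D²f|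
  -- |Df|`.
  set N : ℝ := (n : ℝ) ^ 4 * (4 * B ^ 2) with hN
  refine ⟨2 / c₀ * max 1 (N ^ 2 / (2 * c₀)), by positivity, fun f hf => ?_⟩
  have hf1 : ∀ i, ContDiff ℝ 2 (partialDeriv i f) := fun i =>
    contDiff_partialDeriv hf (by norm_num) i
  have hf2 : ∀ i j, ContDiff ℝ 1 (partialDeriv i (partialDeriv j f)) := fun i j =>
    contDiff_partialDeriv (hf1 j) (by norm_num) i
  -- the divergence term
  set w : Fin n → Fin n → Fin n → Fin n → Model n → ℝ := fun i j k l y => a i j y * a k l y with hw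
  have hwC : ∀ i j k l, ContDiff ℝ 1 (w i j k l) := fun i j k l => (haC i j).mul (haC k l)
  set F : Fin n → Fin n → Fin n → Fin n → Fin n → Model n → ℝ := fun i j k l m z =>
    w i j k l z * (partialDeriv i (partialDeriv m f) z * partialDeriv l f z) with hF
  have hFC : ∀ i j k l m, ContDiff ℝ 1 (F i j k l m) := fun i j k l m =>
    (hwC i j k l).mul ((hf2 i m).mul ((hf1 l).of_le (by norm_num)))
  have hFS : ∀ i j k l m, HasCompactSupport (F i j k l m) := fun i j k l m =>
    (haS i j).mul_right.mul_right
  -- `Z` is a sum of derivatives of compactly supported functions, so its integral vanishes.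
  set Z : Model n → ℝ := fun y => ∑ i, ∑ j, ∑ k, ∑ l,
    (partialDeriv j (F i j k l k) y - partialDeriv k (F i j k l j) y) with hZ
  have hFI : ∀ i j k l m o, Integrable (fun y => partialDeriv o (F i j k l m) y) :=
    fun i j k l m o => (contDiff_partialDeriv (hFC i j k l m) (m := 0) (by norm_num) o).continuous
      |>.integrable_of_hasCompactSupport ((hFS i j k l m).fderiv_apply ℝ _)
  obtain ⟨hZI, hZ0⟩ : Integrable Z ∧ ∫ y, Z y = 0 := by
    refine integral_sum_eq_zero fun i => integral_sum_eq_zero fun j => integral_sum_eq_zero fun k =>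
      integral_sum_eq_zero fun l => ⟨(hFI i j k l k j).sub (hFI i j k l j k), ?_⟩
    rw [integral_sub (hFI i j k l k j) (hFI i j k l j k),
      integral_partialDeriv_eq_zero (hFC _ _ _ _ _) (hFS _ _ _ _ _),
      integral_partialDeriv_eq_zero (hFC _ _ _ _ _) (hFS _ _ _ _ _), sub_zero]
  set L : Model n → ℝ := fun y => ∑ i, ∑ j, A y i j * partialDeriv i (partialDeriv j f) y with hL
  -- the pointwise inequality
  have hpt : ∀ y, c₀ / 2 * (χ y ^ 2 * euclHessSq f y) ≤
      Z y + K.indicator (fun y => L y ^ 2 + N ^ 2 / (2 * c₀) * euclGradSq f y) y := by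
    intro y
    -- `Z = T - χ² L² + R`, where `T ≥ c₀ χ² |D²f|²` and `R` collects the products of a first and a
    -- second derivative.
    have hZy : Z y = (∑ i, ∑ j, ∑ k, ∑ l, w i j k l y *
          (partialDeriv i (partialDeriv k f) y * partialDeriv j (partialDeriv l f) y)) -
        (∑ i, ∑ j, ∑ k, ∑ l, w i j k l y *
          (partialDeriv i (partialDeriv j f) y * partialDeriv k (partialDeriv l f) y)) +
        ∑ i, ∑ j, ∑ k, ∑ l, (partialDeriv j (w i j k l) y * partialDeriv i (partialDeriv k f) y -
          partialDeriv k (w i j k l) y * partialDeriv i (partialDeriv j f) y) *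
            partialDeriv l f y := by
      simp only [hZ, hF, ← Finset.sum_sub_distrib, ← Finset.sum_add_distrib]
      refine Finset.sum_congr rfl fun i _ => Finset.sum_congr rfl fun j _ =>
        Finset.sum_congr rfl fun k _ => Finset.sum_congr rfl fun l _ => ?_
      rw [partialDeriv_sub_partialDeriv (hwC i j k l) hf]
      ring
    have hL2 : (∑ i, ∑ j, ∑ k, ∑ l, w i j k l y *
        (partialDeriv i (partialDeriv j f) y * partialDeriv k (partialDeriv l f) y)) =
        χ y ^ 2 * L y ^ 2 := by
      have hs : χ y * L y = ∑ i, ∑ j, a i j y * partialDeriv i (partialDeriv j f) y := by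
        simp only [hL, ha, Finset.mul_sum, mul_assoc]
      rw [← mul_pow, hs, sq, Finset.sum_mul_sum]
      refine Finset.sum_congr rfl fun i _ => Finset.sum_comm.trans ?_
      refine Finset.sum_congr rfl fun k _ => ?_
      rw [Finset.sum_mul_sum]
      exact Finset.sum_congr rfl fun j _ => Finset.sum_congr rfl fun l _ => by
        simp only [hw]; ring
    have hT : χ y ^ 2 * (c₀ * euclHessSq f y) ≤ ∑ i, ∑ j, ∑ k, ∑ l, w i j k l y *
        (partialDeriv i (partialDeriv k f) y * partialDeriv j (partialDeriv l f) y) := by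
      by_cases hy : y ∈ K
      · have h := hlow y hy fun p => partialDeriv p.1 (partialDeriv p.2 f) y
        simp only [Fintype.sum_prod_type, Matrix.kroneckerMap_apply] at h
        refine (mul_le_mul_of_nonneg_left h (sq_nonneg _)).trans_eq ?_
        simp only [Finset.mul_sum, hw, ha]
        refine Finset.sum_congr rfl fun i _ => Finset.sum_comm.trans ?_
        exact Finset.sum_congr rfl fun j _ => Finset.sum_congr rfl fun k _ =>
          Finset.sum_congr rfl fun l _ => by ring
      · simp [hw, ha, hχ0 y hy]
    have hR : |∑ i, ∑ j, ∑ k, ∑ l,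
        (partialDeriv j (w i j k l) y * partialDeriv i (partialDeriv k f) y -
          partialDeriv k (w i j k l) y * partialDeriv i (partialDeriv j f) y) *
            partialDeriv l f y| ≤
        N * (χ y * (Real.sqrt (euclHessSq f y) * Real.sqrt (euclGradSq f y))) := by
      have hDw : ∀ i j k l m, |partialDeriv m (w i j k l) y| ≤ 2 * B ^ 2 * χ y := by
        intro i j k l m
        rw [hw]; simp only
        rw [partialDeriv_mul ((haC i j).differentiable (by norm_num) y)
          ((haC k l).differentiable (by norm_num) y)]
        refine (abs_add_le _ _).trans ?_
        rw [abs_mul (a i j y), abs_mul (partialDeriv m (a i j) y)]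
        have h1 := mul_le_mul (hBa i j y) (hBd k l m y) (abs_nonneg _)
          (mul_nonneg hB0 χ.nonneg)
        have h2 := mul_le_mul (hBd i j m y) (hBa k l y) (abs_nonneg _) hB0
        linarith
      have hterm : ∀ i j k l, |(partialDeriv j (w i j k l) y * partialDeriv i (partialDeriv k f) y -
          partialDeriv k (w i j k l) y * partialDeriv i (partialDeriv j f) y) *
            partialDeriv l f y| ≤
          4 * B ^ 2 * (χ y * (Real.sqrt (euclHessSq f y) * Real.sqrt (euclGradSq f y))) := by
        intro i j k l
        have hb : 0 ≤ 2 * B ^ 2 * χ y := mul_nonneg (by positivity) χ.nonneg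
        have h1 := mul_le_mul (hDw i j k l j) (abs_partialDeriv_partialDeriv_le f y i k)
          (abs_nonneg _) hb
        have h2 := mul_le_mul (hDw i j k l k) (abs_partialDeriv_partialDeriv_le f y i j)
          (abs_nonneg _) hb
        rw [← abs_mul] at h1 h2
        have h3 := (abs_sub _ _).trans (add_le_add h1 h2)
        rw [abs_mul]
        refine (mul_le_mul h3 (abs_partialDeriv_le f y l) (abs_nonneg _)
          (by positivity)).trans_eq ?_
        ring
      refine (Finset.abs_sum_le_sum_abs _ _).trans ?_
      refine (Finset.sum_le_sum fun i _ => (Finset.abs_sum_le_sum_abs _ _).trans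
        (Finset.sum_le_sum fun j _ => (Finset.abs_sum_le_sum_abs _ _).trans
        (Finset.sum_le_sum fun k _ => (Finset.abs_sum_le_sum_abs _ _).trans
        (Finset.sum_le_sum fun l _ => hterm i j k l)))).trans_eq ?_
      simp only [Finset.sum_const, Finset.card_univ, Fintype.card_fin, nsmul_eq_mul, hN]
      ring
    rw [hL2] at hZy
    by_cases hy : y ∈ K
    · rw [Set.indicator_of_mem hy]
      have hχ2 : χ y ^ 2 * L y ^ 2 ≤ L y ^ 2 :=
        mul_le_of_le_one_left (sq_nonneg _) (pow_le_one₀ χ.nonneg χ.le_one)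
      have hH := Real.sq_sqrt (euclHessSq_nonneg f y)
      have hP := Real.sq_sqrt (euclGradSq_nonneg f y)
      set sH := Real.sqrt (euclHessSq f y)
      set sP := Real.sqrt (euclGradSq f y)
      rw [← hH] at hT ⊢
      rw [← hP]
      -- Young's inequality, weighted so that the error takes up exactly half of the lower bound `c₀
      -- χ² |D²f|²`.
      have hyoung : N * (χ y * (sH * sP)) ≤
          c₀ / 2 * (χ y ^ 2 * sH ^ 2) + N ^ 2 / (2 * c₀) * sP ^ 2 := by
        have h : 0 ≤ (c₀ * (χ y * sH) - N * sP) ^ 2 / (2 * c₀) := by positivity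
        have h' : (c₀ * (χ y * sH) - N * sP) ^ 2 / (2 * c₀) =
          c₀ / 2 * (χ y ^ 2 * sH ^ 2) + N ^ 2 / (2 * c₀) * sP ^ 2 - N * (χ y * (sH * sP)) := by
          field_simp; ring
        linarith
      have := (abs_le.1 hR).1
      linarith
    · rw [Set.indicator_of_notMem hy]
      rw [hχ0 y hy] at hT hR hZy ⊢
      have := (abs_le.1 hR).1
      simp only [zero_mul, mul_zero, ne_eq, OfNat.ofNat_ne_zero, not_false_eq_true, zero_pow,
        neg_zero, sub_zero] at *
      linarith
  have hLc : ContinuousOn L K := continuousOn_finsetSum _ fun i _ =>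
    continuousOn_finsetSum _ fun j _ =>
      ((hA i j).continuousOn.mono hsub).mul (hf2 i j).continuous.continuousOn
  have hPc := continuous_euclGradSq (hf.of_le (by norm_num : (1 : ℕ∞ω) ≤ 3))
  have hHc := continuous_euclHessSq (hf.of_le (by norm_num : (2 : ℕ∞ω) ≤ 3))
  have hI1 : IntegrableOn (fun y => L y ^ 2 + N ^ 2 / (2 * c₀) * euclGradSq f y) K :=
    ((hLc.pow 2).add (continuousOn_const.mul hPc.continuousOn)).integrableOn_compact hK
  have hI2 : IntegrableOn (fun y => L y ^ 2 + euclGradSq f y) K :=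
    ((hLc.pow 2).add hPc.continuousOn).integrableOn_compact hK
  have hI3 : IntegrableOn (fun y => c₀ / 2 * euclHessSq f y) (Metric.closedBall c r) :=
    (continuous_const.mul hHc).continuousOn.integrableOn_compact (isCompact_closedBall _ _)
  have hBm : MeasurableSet (Metric.closedBall c r) := Metric.isClosed_closedBall.measurableSet
  have hKm : MeasurableSet K := hK.measurableSet
  have h1 : ∫ y in Metric.closedBall c r, c₀ / 2 * euclHessSq f y ≤
      ∫ y in K, (L y ^ 2 + N ^ 2 / (2 * c₀) * euclGradSq f y) := by
    rw [← integral_indicator hBm, ← integral_indicator hKm]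
    have := integral_mono (hI3.integrable_indicator hBm)
      (hZI.add (hI1.integrable_indicator hKm)) (fun y => ?_)
    · refine this.trans_eq ?_
      simp only [Pi.add_apply]
      rw [integral_add hZI (hI1.integrable_indicator hKm), hZ0, zero_add]
    · refine le_trans ?_ (hpt y)
      by_cases hy : y ∈ Metric.closedBall c r
      · rw [Set.indicator_of_mem hy, χ.one_of_mem_closedBall hy]
        simp
      · rw [Set.indicator_of_notMem hy]
        exact mul_nonneg (by positivity) (mul_nonneg (sq_nonneg _) (euclHessSq_nonneg f y))
  have h2 : ∫ y in K, (L y ^ 2 + N ^ 2 / (2 * c₀) * euclGradSq f y) ≤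
      max 1 (N ^ 2 / (2 * c₀)) * ∫ y in K, (L y ^ 2 + euclGradSq f y) := by
    rw [← integral_const_mul]
    refine integral_mono hI1 (hI2.const_mul _) fun y => ?_
    simp only
    rw [mul_add]
    refine add_le_add ?_ (mul_le_mul_of_nonneg_right (le_max_right _ _) (euclGradSq_nonneg f y))
    exact le_mul_of_one_le_left (sq_nonneg _) (le_max_left _ _)
  rw [integral_const_mul] at h1
  have h3 := h1.trans h2
  rw [mul_assoc, div_mul_eq_mul_div, le_div_iff₀ hc₀]
  linarith

end HessianEstimate

/-! ### Gradient, Hessian and Laplacian of smooth functions in a fixed chart -/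

theorem continuous_of_chart {n : ℕ} {M : Type*} [TopologicalSpace M]
    [ChartedSpace (Model n) M] {F : M → ℝ} (f : M → Model n → ℝ)
    (hf : ∀ p, ContinuousOn (f p) (chartAt (Model n) p).target)
    (hF : ∀ p, ∀ x ∈ (chartAt (Model n) p).source, F x = f p (chartAt (Model n) p x)) :
    Continuous F := by
  refine continuous_iff_continuousAt.2 fun p => ?_
  have hs := (chartAt (Model n) p).open_source.mem_nhds (mem_chart_source (Model n) p)
  have h : F =ᶠ[𝓝 p] fun x => f p (chartAt (Model n) p x) := by
    filter_upwards [hs] with x hx using hF p x hx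
  refine ContinuousAt.congr ?_ h.symm
  exact (((hf p).continuousAt ((chartAt (Model n) p).open_target.mem_nhds
    (mem_chart_target _ p))).comp ((chartAt (Model n) p).continuousAt (mem_chart_source _ p)))

section ChartComparison

variable {n : ℕ} {M : Type*} [TopologicalSpace M] [ChartedSpace (Model n) M]
  [IsManifold (𝓡 n) ∞ M]

theorem contDiffOn_partialDeriv {f : Model n → ℝ} {U : Set (Model n)} (hU : IsOpen U)
    {k m : ℕ∞ω} (hf : ContDiffOn ℝ k f U) (hmk : m + 1 ≤ k) (i : Fin n) :
    ContDiffOn ℝ m (partialDeriv i f) U :=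
  (hf.fderiv_of_isOpen hU hmk).clm_apply contDiffOn_const

theorem contDiffOn_gram_inv (g : SmoothMetric n M) (p : M) (i j : Fin n) :
    ContDiffOn ℝ ∞ (fun y => (gram g p y)⁻¹ i j) (chartAt (Model n) p).target :=
  contDiffOn_inv_apply (contDiffOn_gram g p) (fun _ hy => (gram_posDef g p hy).det_pos.ne') i j

theorem continuousOn_christoffel (g : SmoothMetric n M) (p : M) (k i j : Fin n) :
    ContinuousOn (fun y => christoffel g p y k i j) (chartAt (Model n) p).target := by
  have h : ∀ i j l, ContinuousOn (partialDeriv l (fun z => gram g p z i j))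
      (chartAt (Model n) p).target := fun i j l =>
    (contDiffOn_partialDeriv (m := 0) (chartAt (Model n) p).open_target (contDiffOn_gram g p i j)
      (by simp) l).continuousOn
  refine continuousOn_const.mul (continuousOn_finsetSum _ fun l _ => ?_)
  exact (contDiffOn_gram_inv g p k l).continuousOn.mul (((h _ _ _).add (h _ _ _)).sub (h _ _ _))

theorem continuousOn_localGrad {φ : M → ℝ} (hφ : ContMDiff (𝓡 n) 𝓘(ℝ) ∞ φ) (p : M) (i : Fin n) :
    ContinuousOn (fun y => localGrad φ p y i) (chartAt (Model n) p).target :=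
  (contDiffOn_partialDeriv (m := 0) (chartAt (Model n) p).open_target (contDiffOn_inChart hφ p)
      (by simp) i).continuousOn

theorem continuousOn_localHess (g : SmoothMetric n M) {φ : M → ℝ}
    (hφ : ContMDiff (𝓡 n) 𝓘(ℝ) ∞ φ) (p : M) (i j : Fin n) :
    ContinuousOn (fun y => localHess g φ p y i j) (chartAt (Model n) p).target := by
  refine ContinuousOn.sub ?_ (continuousOn_finsetSum _ fun k _ =>
    (continuousOn_christoffel g p k i j).mul (continuousOn_localGrad hφ p k))
  exact (contDiffOn_partialDeriv (m := 0) (chartAt (Model n) p).open_target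
    (contDiffOn_partialDeriv (m := 1) (chartAt (Model n) p).open_target (contDiffOn_inChart hφ p)
      (by norm_cast) j) (by simp) i).continuousOn

/-- `|∇φ|²`. -/
def gradSqAt (g : SmoothMetric n M) (φ : M → ℝ) (x : M) : ℝ :=
  covInner g x (jet g φ x).2.1 (jet g φ x).2.1

/-- `|∇²φ|²`. -/
def hessSqAt (g : SmoothMetric n M) (φ : M → ℝ) (x : M) : ℝ := tensorSq g x (jet g φ x).2.2

/-- `Δφ`. -/
def lapAt (g : SmoothMetric n M) (φ : M → ℝ) (x : M) : ℝ := tensorTrace g x (jet g φ x).2.2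

variable (g : SmoothMetric n M) {φ : M → ℝ} (hφ : ContMDiff (𝓡 n) 𝓘(ℝ) ∞ φ)

theorem gradSqAt_nonneg (φ : M → ℝ) (x : M) : 0 ≤ gradSqAt g φ x := covInner_self_nonneg g x _

theorem hessSqAt_nonneg (φ : M → ℝ) (x : M) : 0 ≤ hessSqAt g φ x := tensorSq_nonneg g x _

include hφ

theorem continuous_gradSqAt : Continuous (gradSqAt g φ) := by
  refine continuous_of_chart (fun p y => contractSq (gram g p y) (localGrad φ p y)) (fun p => ?_)
    fun p x hx => covInner_jet g hφ p hx
  exact continuousOn_finsetSum _ fun i _ => continuousOn_finsetSum _ fun j _ =>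
    ((contDiffOn_gram_inv g p i j).continuousOn.mul (continuousOn_localGrad hφ p i)).mul
      (continuousOn_localGrad hφ p j)

theorem continuous_hessSqAt : Continuous (hessSqAt g φ) := by
  refine continuous_of_chart (fun p y => contractTensorSq (gram g p y) (localHess g φ p y))
    (fun p => ?_) fun p x hx => tensorSq_jet g hφ p hx
  exact continuousOn_finsetSum _ fun i _ => continuousOn_finsetSum _ fun j _ =>
    continuousOn_finsetSum _ fun k _ => continuousOn_finsetSum _ fun l _ =>
    (((contDiffOn_gram_inv g p i k).continuousOn.mul
      (contDiffOn_gram_inv g p j l).continuousOn).mul (continuousOn_localHess g hφ p i j)).mul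
      (continuousOn_localHess g hφ p k l)

theorem continuous_lapAt : Continuous (lapAt g φ) := by
  refine continuous_of_chart (fun p y => contractTrace (gram g p y) (localHess g φ p y))
    (fun p => ?_) fun p x hx => tensorTrace_jet g hφ p hx
  exact continuousOn_finsetSum _ fun i _ => continuousOn_finsetSum _ fun j _ =>
    (contDiffOn_gram_inv g p i j).continuousOn.mul (continuousOn_localHess g hφ p i j)

variable {p : M} {y : Model n} (hy : y ∈ (chartAt (Model n) p).target)
include hy

theorem gradSqAt_symm : gradSqAt g φ ((chartAt (Model n) p).symm y) =
    contractSq (gram g p y) (localGrad φ p y) := by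
  have h := covInner_jet g hφ p ((chartAt (Model n) p).map_target hy)
  rwa [(chartAt (Model n) p).right_inv hy] at h

theorem hessSqAt_symm : hessSqAt g φ ((chartAt (Model n) p).symm y) =
    contractTensorSq (gram g p y) (localHess g φ p y) := by
  have h := tensorSq_jet g hφ p ((chartAt (Model n) p).map_target hy)
  rwa [(chartAt (Model n) p).right_inv hy] at h

theorem lapAt_symm : lapAt g φ ((chartAt (Model n) p).symm y) =
    contractTrace (gram g p y) (localHess g φ p y) := by
  have h := tensorTrace_jet g hφ p ((chartAt (Model n) p).map_target hy)
  rwa [(chartAt (Model n) p).right_inv hy] at h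

end ChartComparison

/-! ### Comparison of Riemannian and Euclidean expressions on compact sets -/

section ChartBounds

variable {n : ℕ} {M : Type*} [TopologicalSpace M] [ChartedSpace (Model n) M]
  [IsManifold (𝓡 n) ∞ M]

theorem exists_gradSq_bounds (g : SmoothMetric n M) {p : M} {K : Set (Model n)} (hK : IsCompact K)
    (hKt : K ⊆ (chartAt (Model n) p).target) :
    ∃ C : ℝ, 0 < C ∧ ∀ y ∈ K, ∀ ξ : Fin n → ℝ,
      ∑ i, ξ i ^ 2 ≤ C * contractSq (gram g p y) ξ ∧
        contractSq (gram g p y) ξ ≤ C * ∑ i, ξ i ^ 2 := by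
  have hc := fun i j => (contDiffOn_gram_inv g p i j).continuousOn.mono hKt
  obtain ⟨c, hc0, h1⟩ := exists_le_quadratic_of_posDef hK hc
    fun y hy => (gram_posDef g p (hKt hy)).inv
  obtain ⟨C, hC0, h2⟩ := exists_quadratic_le hK hc
  refine ⟨max c⁻¹ C, by positivity, fun y hy ξ => ⟨?_, ?_⟩⟩
  · have h := h1 y hy ξ
    change c * ∑ i, ξ i ^ 2 ≤ contractSq (gram g p y) ξ at h
    have h0 : 0 ≤ contractSq (gram g p y) ξ := le_trans (by positivity) h
    calc ∑ i, ξ i ^ 2 ≤ c⁻¹ * contractSq (gram g p y) ξ := by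
          rw [inv_mul_eq_div, le_div_iff₀ hc0]; linarith
      _ ≤ _ := mul_le_mul_of_nonneg_right (le_max_left _ _) h0
  · exact (h2 y hy ξ).trans (mul_le_mul_of_nonneg_right (le_max_right _ _) (by positivity))

theorem exists_hessSq_bounds (g : SmoothMetric n M) {p : M} {K : Set (Model n)} (hK : IsCompact K)
    (hKt : K ⊆ (chartAt (Model n) p).target) :
    ∃ C : ℝ, 0 < C ∧ ∀ y ∈ K, ∀ η : Matrix (Fin n) (Fin n) ℝ,
      ∑ i, ∑ j, η i j ^ 2 ≤ C * contractTensorSq (gram g p y) η ∧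
        contractTensorSq (gram g p y) η ≤ C * ∑ i, ∑ j, η i j ^ 2 := by
  have hc : ∀ q q' : Fin n × Fin n, ContinuousOn (fun y =>
      Matrix.kroneckerMap (· * ·) (gram g p y)⁻¹ (gram g p y)⁻¹ q q') K := fun q q' =>
    ((contDiffOn_gram_inv g p _ _).continuousOn.mono hKt).mul
      ((contDiffOn_gram_inv g p _ _).continuousOn.mono hKt)
  obtain ⟨c, hc0, h1⟩ := exists_le_quadratic_of_posDef hK hc
    fun y hy => (gram_posDef g p (hKt hy)).inv.kronecker (gram_posDef g p (hKt hy)).inv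
  obtain ⟨C, hC0, h2⟩ := exists_quadratic_le hK hc
  refine ⟨max c⁻¹ C, by positivity, fun y hy η => ⟨?_, ?_⟩⟩
  · have h := h1 y hy fun q => η q.1 q.2
    simp only [Fintype.sum_prod_type, Matrix.kroneckerMap_apply] at h
    change c * ∑ i, ∑ j, η i j ^ 2 ≤ contractTensorSq (gram g p y) η at h
    have h0 : 0 ≤ contractTensorSq (gram g p y) η := le_trans (by positivity) h
    calc ∑ i, ∑ j, η i j ^ 2 ≤ c⁻¹ * contractTensorSq (gram g p y) η := by
          rw [inv_mul_eq_div, le_div_iff₀ hc0]; linarith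
      _ ≤ _ := mul_le_mul_of_nonneg_right (le_max_left _ _) h0
  · have h := h2 y hy fun q => η q.1 q.2
    simp only [Fintype.sum_prod_type, Matrix.kroneckerMap_apply] at h
    exact h.trans (mul_le_mul_of_nonneg_right (le_max_right _ _) (by positivity))

theorem exists_christoffel_bound (g : SmoothMetric n M) {p : M} {K : Set (Model n)}
    (hK : IsCompact K) (hKt : K ⊆ (chartAt (Model n) p).target) :
    ∃ B : ℝ, 0 ≤ B ∧ ∀ y ∈ K, ∀ (i j : Fin n) (ξ : Fin n → ℝ),
      (∑ k, christoffel g p y k i j * ξ k) ^ 2 ≤ B * ∑ k, ξ k ^ 2 := by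
  choose B hB using fun k i j => hK.exists_bound_of_continuousOn
    ((continuousOn_christoffel g p k i j).mono hKt)
  refine ⟨∑ i, ∑ j, ∑ k, B k i j ^ 2, by positivity, fun y hy i j ξ => ?_⟩
  refine (Finset.sum_mul_sq_le_sq_mul_sq _ _ _).trans
    (mul_le_mul_of_nonneg_right ?_ (by positivity))
  calc ∑ k, christoffel g p y k i j ^ 2 ≤ ∑ k, B k i j ^ 2 := by
        refine Finset.sum_le_sum fun k _ => sq_le_sq.2 ?_
        exact (hB k i j y hy).trans (le_abs_self _)
    _ ≤ ∑ j, ∑ k, B k i j ^ 2 := Finset.single_le_sum (f := fun j => ∑ k, B k i j ^ 2)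
        (fun _ _ => by positivity) (Finset.mem_univ j)
    _ ≤ _ := Finset.single_le_sum (f := fun i => ∑ j, ∑ k, B k i j ^ 2)
        (fun _ _ => by positivity) (Finset.mem_univ i)

theorem exists_inv_gram_bound (g : SmoothMetric n M) {p : M} {K : Set (Model n)}
    (hK : IsCompact K) (hKt : K ⊆ (chartAt (Model n) p).target) :
    ∃ B : ℝ, 0 ≤ B ∧ ∀ y ∈ K, ∀ η : Matrix (Fin n) (Fin n) ℝ,
      contractTrace (gram g p y) η ^ 2 ≤ B * ∑ i, ∑ j, η i j ^ 2 := by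
  choose B hB using fun i j => hK.exists_bound_of_continuousOn
    ((contDiffOn_gram_inv g p i j).continuousOn.mono hKt)
  refine ⟨∑ i, ∑ j, B i j ^ 2, by positivity, fun y hy η => ?_⟩
  have h := Finset.sum_mul_sq_le_sq_mul_sq Finset.univ
    (fun q : Fin n × Fin n => (gram g p y)⁻¹ q.1 q.2) (fun q => η q.1 q.2)
  simp only [Fintype.sum_prod_type] at h
  refine h.trans (mul_le_mul_of_nonneg_right ?_ (by positivity))
  refine Finset.sum_le_sum fun i _ => Finset.sum_le_sum fun j _ => sq_le_sq.2 ?_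
  exact (hB i j y hy).trans (le_abs_self _)

/-- On a compact subset of a chart, `|∇φ|²`, `|∇²φ|²` and `(Δφ)²` are comparable with the
corresponding Euclidean expressions, up to lower order terms. -/
theorem exists_chart_bounds (g : SmoothMetric n M) {p : M} {K : Set (Model n)}
    (hK : IsCompact K) (hKt : K ⊆ (chartAt (Model n) p).target) :
    ∃ C : ℝ, 0 < C ∧ ∀ φ : M → ℝ, ContMDiff (𝓡 n) 𝓘(ℝ) ∞ φ → ∀ y ∈ K,
      euclGradSq (inChart φ p) y ≤ C * gradSqAt g φ ((chartAt (Model n) p).symm y) ∧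
      gradSqAt g φ ((chartAt (Model n) p).symm y) ≤ C * euclGradSq (inChart φ p) y ∧
      euclHessSq (inChart φ p) y ≤ C * (hessSqAt g φ ((chartAt (Model n) p).symm y) +
        gradSqAt g φ ((chartAt (Model n) p).symm y)) ∧
      hessSqAt g φ ((chartAt (Model n) p).symm y) ≤
        C * (euclHessSq (inChart φ p) y + euclGradSq (inChart φ p) y) ∧
      (∑ i, ∑ j, (gram g p y)⁻¹ i j * partialDeriv i (partialDeriv j (inChart φ p)) y) ^ 2 ≤
        C * (lapAt g φ ((chartAt (Model n) p).symm y) ^ 2 +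
          gradSqAt g φ ((chartAt (Model n) p).symm y)) := by
  obtain ⟨C₁, hC₁, h1⟩ := exists_gradSq_bounds g hK hKt
  obtain ⟨C₂, hC₂, h2⟩ := exists_hessSq_bounds g hK hKt
  obtain ⟨B₁, hB₁, h3⟩ := exists_christoffel_bound g hK hKt
  obtain ⟨B₂, hB₂, h4⟩ := exists_inv_gram_bound g hK hKt
  set D : ℝ := (n : ℝ) ^ 2 * B₁ with hD
  have hD0 : 0 ≤ D := by positivity
  -- A sum of four constants: `C₁` serves both gradient bounds, the two middle ones the Hessian
  -- bounds, and the last the Laplacian.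
  refine ⟨C₁ + (2 * C₂ + 2 * D * C₁) + (2 * C₂ + 2 * D * C₂) + (2 + 2 * B₂ * D * C₁),
    by positivity, fun φ hφ y hy => ?_⟩
  rw [gradSqAt_symm g hφ (hKt hy), hessSqAt_symm g hφ (hKt hy), lapAt_symm g hφ (hKt hy)]
  obtain ⟨g1, g2⟩ := h1 y hy (localGrad φ p y)
  obtain ⟨e1, e2⟩ := h2 y hy (localHess g φ p y)
  have hPdef : ∑ i, localGrad φ p y i ^ 2 = euclGradSq (inChart φ p) y := rfl
  rw [hPdef] at g1 g2
  set R : Matrix (Fin n) (Fin n) ℝ :=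
    Matrix.of fun i j => ∑ k, christoffel g p y k i j * localGrad φ p y k with hR
  set S : Matrix (Fin n) (Fin n) ℝ :=
    Matrix.of fun i j => partialDeriv i (partialDeriv j (inChart φ p)) y with hS
  -- The covariant Hessian is the Euclidean one minus the Christoffel term `R`, which is of first
  -- order: `|R|² ≤ D |∂φ|²`.
  have hSR : localHess g φ p y = S - R := rfl
  have hH : ∑ i, ∑ j, S i j ^ 2 = euclHessSq (inChart φ p) y := rfl
  have hRb : ∑ i, ∑ j, R i j ^ 2 ≤ D * euclGradSq (inChart φ p) y := by
    calc ∑ i, ∑ j, R i j ^ 2 ≤ ∑ i : Fin n, ∑ j : Fin n, B₁ * euclGradSq (inChart φ p) y :=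
          Finset.sum_le_sum fun i _ => Finset.sum_le_sum fun j _ => h3 y hy i j _
      _ = _ := by simp [hD]; ring
  have hT : ∑ i, ∑ j, (gram g p y)⁻¹ i j * partialDeriv i (partialDeriv j (inChart φ p)) y =
      contractTrace (gram g p y) (localHess g φ p y) + contractTrace (gram g p y) R := by
    simp only [contractTrace, hSR, Matrix.sub_apply, ← Finset.sum_add_distrib, hS, Matrix.of_apply]
    exact Finset.sum_congr rfl fun i _ => Finset.sum_congr rfl fun j _ => by ring
  have hTR := h4 y hy R
  have hsum1 : ∑ i, ∑ j, S i j ^ 2 ≤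
      2 * ∑ i, ∑ j, (localHess g φ p y) i j ^ 2 + 2 * ∑ i, ∑ j, R i j ^ 2 := by
    simp only [Finset.mul_sum, ← Finset.sum_add_distrib, hSR, Matrix.sub_apply]
    refine Finset.sum_le_sum fun i _ => Finset.sum_le_sum fun j _ => ?_
    nlinarith [sq_nonneg (S i j - 2 * R i j)]
  have hsum2 : ∑ i, ∑ j, (localHess g φ p y) i j ^ 2 ≤
      2 * ∑ i, ∑ j, S i j ^ 2 + 2 * ∑ i, ∑ j, R i j ^ 2 := by
    simp only [Finset.mul_sum, ← Finset.sum_add_distrib, hSR, Matrix.sub_apply]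
    refine Finset.sum_le_sum fun i _ => Finset.sum_le_sum fun j _ => ?_
    nlinarith [sq_nonneg (S i j + R i j)]
  rw [hH] at hsum1 hsum2
  rw [hT]
  have hP0 := euclGradSq_nonneg (inChart φ p) y
  have hH0 := euclHessSq_nonneg (inChart φ p) y
  have hG0 : 0 ≤ contractSq (gram g p y) (localGrad φ p y) := by
    rw [← gradSqAt_symm g hφ (hKt hy)]; exact gradSqAt_nonneg g _ _
  have hE0 : 0 ≤ contractTensorSq (gram g p y) (localHess g φ p y) := by
    rw [← hessSqAt_symm g hφ (hKt hy)]; exact hessSqAt_nonneg g _ _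
  generalize contractTrace (gram g p y) (localHess g φ p y) = t at *
  generalize contractTrace (gram g p y) R = t' at *
  generalize contractTensorSq (gram g p y) (localHess g φ p y) = E at *
  generalize contractSq (gram g p y) (localGrad φ p y) = G at *
  generalize (∑ i, ∑ j, localHess g φ p y i j ^ 2) = Q at *
  generalize euclHessSq (inChart φ p) y = H at *
  generalize euclGradSq (inChart φ p) y = P at *
  generalize (∑ i, ∑ j, R i j ^ 2) = r at *
  have hDP : D * P ≤ D * (C₁ * G) := mul_le_mul_of_nonneg_left g1 hD0
  have mono : ∀ {c x : ℝ}, 0 ≤ x → c ≤ C₁ + (2 * C₂ + 2 * D * C₁) + (2 * C₂ + 2 * D * C₂) +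
      (2 + 2 * B₂ * D * C₁) → c * x ≤ (C₁ + (2 * C₂ + 2 * D * C₁) + (2 * C₂ + 2 * D * C₂) +
      (2 + 2 * B₂ * D * C₁)) * x := fun hx hc => mul_le_mul_of_nonneg_right hc hx
  have q1 : 0 ≤ D * C₁ := by positivity
  have q2 : 0 ≤ D * C₂ := by positivity
  have q3 : 0 ≤ B₂ * D * C₁ := by positivity
  refine ⟨g1.trans (mono hG0 (by linarith)), g2.trans (mono hP0 (by linarith)), ?_, ?_, ?_⟩
  · refine le_trans ?_ (mono (c := 2 * C₂ + 2 * D * C₁) (add_nonneg hE0 hG0) (by linarith))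
    nlinarith [mul_nonneg q1 hE0, mul_nonneg hC₂.le hG0]
  · refine le_trans ?_ (mono (c := 2 * C₂ + 2 * D * C₂) (add_nonneg hH0 hP0) (by linarith))
    have : C₂ * Q ≤ C₂ * (2 * H + 2 * (D * P)) := mul_le_mul_of_nonneg_left (by linarith) hC₂.le
    nlinarith [mul_nonneg q2 hH0, mul_nonneg hC₂.le hP0]
  · refine le_trans ?_ (mono (c := 2 + 2 * B₂ * D * C₁) (add_nonneg (sq_nonneg t) hG0)
      (by linarith))
    have h5 : B₂ * r ≤ B₂ * (D * (C₁ * G)) := mul_le_mul_of_nonneg_left (by linarith) hB₂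
    nlinarith [mul_nonneg q3 (sq_nonneg t), sq_nonneg (t - t')]

end ChartBounds

/-! ### From local to global estimates -/

section LocalToGlobal

/-- For `p ≥ 1` the function `t ↦ t^{1/p}` is subadditive. This is what makes a local estimate
stable under finite unions. -/
theorem eLpNorm_restrict_union_le {X : Type*} [MeasurableSpace X] {μ : Measure X} {p : NNReal}
    (hp : 1 ≤ p) (f : X → ℝ) (s t : Set X) :
    eLpNorm f p (μ.restrict (s ∪ t)) ≤
      eLpNorm f p (μ.restrict s) + eLpNorm f p (μ.restrict t) := by
  have hp0 : (p : ℝ≥0∞) ≠ 0 := by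
    have : p ≠ 0 := (zero_lt_one.trans_le hp).ne'
    exact_mod_cast this
  have hp1 : (1 : ℝ) ≤ p := by exact_mod_cast hp
  simp only [eLpNorm_eq_lintegral_rpow_enorm_toReal hp0 ENNReal.coe_ne_top, ENNReal.coe_toReal]
  refine (ENNReal.rpow_le_rpow (lintegral_union_le _ s t) (by positivity)).trans ?_
  refine ENNReal.rpow_add_le_add_rpow _ _ (by positivity) ?_
  rw [one_div]
  exact inv_le_one_of_one_le₀ hp1

/-- An estimate that holds locally, uniformly over a family of functions, holds globally on a
compact space. -/
theorem exists_eLpNorm_le_of_local {X Φ : Type*} [TopologicalSpace X] [CompactSpace X]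
    [MeasurableSpace X] {μ : Measure X} {p : NNReal} (hp : 1 ≤ p) (F : Φ → X → ℝ) (R : Φ → ℝ≥0∞)
    (h : ∀ x, ∃ U ∈ 𝓝 x, ∃ C : ℝ≥0∞, C ≠ ⊤ ∧ ∀ φ, eLpNorm (F φ) p (μ.restrict U) ≤ C * R φ) :
    ∃ C : ℝ≥0∞, C ≠ ⊤ ∧ ∀ φ, eLpNorm (F φ) p μ ≤ C * R φ := by
  have key : ∃ C : ℝ≥0∞, C ≠ ⊤ ∧ ∀ φ, eLpNorm (F φ) p (μ.restrict Set.univ) ≤ C * R φ := by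
    refine isCompact_univ.induction_on (p := fun s => ∃ C : ℝ≥0∞, C ≠ ⊤ ∧
      ∀ φ, eLpNorm (F φ) p (μ.restrict s) ≤ C * R φ) ?_ ?_ ?_ ?_
    · exact ⟨0, ENNReal.zero_ne_top, fun φ => by simp⟩
    · rintro s t hst ⟨C, hC, hle⟩
      exact ⟨C, hC, fun φ => (eLpNorm_mono_measure _ (Measure.restrict_mono hst le_rfl)).trans
        (hle φ)⟩
    · rintro s t ⟨C, hC, hle⟩ ⟨C', hC', hle'⟩
      refine ⟨C + C', ENNReal.add_ne_top.2 ⟨hC, hC'⟩, fun φ => ?_⟩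
      rw [add_mul]
      exact (eLpNorm_restrict_union_le hp _ s t).trans (add_le_add (hle φ) (hle' φ))
    · intro x _
      obtain ⟨U, hU, hle⟩ := h x
      exact ⟨U, mem_nhdsWithin_of_mem_nhds hU, hle⟩
  simpa using key

theorem eLpNorm_le_of_measure_le {X : Type*} [MeasurableSpace X] {μ ν : Measure X} {C : ℝ≥0∞}
    (h : μ ≤ C • ν) (p : ℝ≥0∞) (f : X → ℝ) :
    eLpNorm f p μ ≤ C ^ (1 / p).toReal * eLpNorm f p ν :=
  (eLpNorm_mono_measure f h).trans (eLpNorm_smul_measure_le C f p ν)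

theorem norm_fderiv_le_sqrt {n : ℕ} (f : Model n → ℝ) (y : Model n) :
    ‖fderiv ℝ f y‖ ≤ Real.sqrt (euclGradSq f y) := by
  refine ContinuousLinearMap.opNorm_le_bound _ (Real.sqrt_nonneg _) fun v => ?_
  have h : fderiv ℝ f y v = ∑ i, partialDeriv i f y * v i := by
    conv_lhs => rw [eq_sum_single v]
    simp [partialDeriv, mul_comm]
  rw [h, EuclideanSpace.norm_eq, ← Real.sqrt_mul (euclGradSq_nonneg f y), Real.norm_eq_abs]
  refine Real.abs_le_sqrt ?_
  simp only [Real.norm_eq_abs, sq_abs]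
  exact Finset.sum_mul_sq_le_sq_mul_sq _ _ _

end LocalToGlobal

theorem eLpNorm_pushLebesgue {n : ℕ} {M : Type*} [TopologicalSpace M]
    [ChartedSpace (Model n) M] [MeasurableSpace M] [BorelSpace M] {p : M} {K : Set (Model n)}
    (hKt : K ⊆ (chartAt (Model n) p).target) {F : M → ℝ} (hF : Continuous F) (q : ℝ≥0∞) :
    eLpNorm F q (pushLebesgue p K) =
      eLpNorm (F ∘ (chartAt (Model n) p).symm) q (volume.restrict K) :=
  eLpNorm_map_measure hF.measurable.aestronglyMeasurable (aemeasurable_chart_symm_restrict hKt)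

/-! ### Local Sobolev inequalities on the manifold -/

section SmoothEstimates

variable {n : ℕ} {M : Type*} [TopologicalSpace M] [ChartedSpace (Model n) M]
  [IsManifold (𝓡 n) ∞ M]

/-- `(φ² + |∇φ|²)^{1/2}`. -/
def firstOrderSize (g : SmoothMetric n M) (φ : M → ℝ) (x : M) : ℝ :=
  Real.sqrt (φ x ^ 2 + gradSqAt g φ x)

/-- `(φ² + |∇φ|² + |∇²φ|²)^{1/2}`. -/
def secondOrderSize (g : SmoothMetric n M) (φ : M → ℝ) (x : M) : ℝ :=
  Real.sqrt (φ x ^ 2 + gradSqAt g φ x + hessSqAt g φ x)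

theorem continuous_firstOrderSize (g : SmoothMetric n M) {φ : M → ℝ}
    (hφ : ContMDiff (𝓡 n) 𝓘(ℝ) ∞ φ) : Continuous (firstOrderSize g φ) :=
  Real.continuous_sqrt.comp ((hφ.continuous.pow 2).add (continuous_gradSqAt g hφ))

theorem continuous_secondOrderSize (g : SmoothMetric n M) {φ : M → ℝ}
    (hφ : ContMDiff (𝓡 n) 𝓘(ℝ) ∞ φ) : Continuous (secondOrderSize g φ) :=
  Real.continuous_sqrt.comp (((hφ.continuous.pow 2).add (continuous_gradSqAt g hφ)).add
    (continuous_hessSqAt g hφ))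

variable [MeasurableSpace M] [BorelSpace M]

/-- Transfer of a local Sobolev inequality to the manifold. -/
theorem exists_eLpNorm_closedBall_le_vol (g : SmoothMetric n M) (hn : 0 < n) {q q' : NNReal}
    (hq : 1 ≤ q) (hq' : (q' : ℝ)⁻¹ = (q : ℝ)⁻¹ - (n : ℝ)⁻¹) (p : M) {r : ℝ} (hr : 0 < r)
    (hsub : Metric.closedBall (chartAt (Model n) p p) (2 * r) ⊆ (chartAt (Model n) p).target)
    {B : ℝ} (hB : 0 ≤ B) :
    ∃ C : ℝ≥0∞, C ≠ ⊤ ∧ ∀ (h : Model n → ℝ) (W : M → ℝ), ContDiff ℝ 1 h → Continuous W →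
      (∀ y ∈ Metric.closedBall (chartAt (Model n) p p) (2 * r),
        |h y| ≤ B * W ((chartAt (Model n) p).symm y) ∧
        ‖fderiv ℝ h y‖ ≤ B * W ((chartAt (Model n) p).symm y)) →
      eLpNorm h q' (volume.restrict (Metric.closedBall (chartAt (Model n) p p) r)) ≤
        C * eLpNorm W q (vol g) := by
  set K := Metric.closedBall (chartAt (Model n) p p) (2 * r) with hKdef
  have hK : IsCompact K := isCompact_closedBall _ _
  obtain ⟨C₁, hC₁, h1⟩ := exists_eLpNorm_closedBall_le hn hq hq' (chartAt (Model n) p p) hr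
  obtain ⟨C₂, hC₂, h2⟩ := pushLebesgue_le hK hsub g
  refine ⟨C₁ * (2 * (ENNReal.ofReal B * C₂ ^ (1 / (q : ℝ≥0∞)).toReal)), ?_, ?_⟩
  · exact ENNReal.mul_ne_top hC₁ (ENNReal.mul_ne_top (by simp) (ENNReal.mul_ne_top (by simp)
      (ENNReal.rpow_ne_top_of_nonneg (by positivity) hC₂)))
  intro h W hh hW hb
  -- Stated for any normed codomain, to be used both for `h` and for its derivative.
  have key : ∀ {G : Type _} [NormedAddCommGroup G] (f : Model n → G),
      (∀ y ∈ K, ‖f y‖ ≤ B * W ((chartAt (Model n) p).symm y)) →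
      eLpNorm f q (volume.restrict K) ≤
        ENNReal.ofReal B * C₂ ^ (1 / (q : ℝ≥0∞)).toReal * eLpNorm W q (vol g) := by
    intro G _ f hf
    have := eLpNorm_le_mul_eLpNorm_of_ae_le_mul (p := (q : ℝ≥0∞)) (μ := volume.restrict K)
      (f := f) (g := W ∘ (chartAt (Model n) p).symm) (c := B) ?_
    · refine this.trans ?_
      rw [mul_assoc, ← eLpNorm_pushLebesgue hsub hW]
      exact mul_le_mul_right (eLpNorm_le_of_measure_le h2 _ _) _
    · refine (ae_restrict_iff' hK.measurableSet).2 (Eventually.of_forall fun y hy => ?_)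
      exact (hf y hy).trans (mul_le_mul_of_nonneg_left (le_abs_self _) hB)
  refine (h1 h hh).trans ?_
  rw [mul_assoc]
  refine mul_le_mul_right ?_ _
  rw [two_mul (ENNReal.ofReal B * _), add_mul]
  exact add_le_add (key h fun y hy => (hb y hy).1) (key (fderiv ℝ h) fun y hy => (hb y hy).2)

variable [T2Space M]

/-- Local form of the Sobolev inequality for functions. -/
theorem exists_local_eLpNorm_le (g : SmoothMetric n M) (hn : 0 < n) {q q' : NNReal}
    (hq : 1 ≤ q) (hq' : (q' : ℝ)⁻¹ = (q : ℝ)⁻¹ - (n : ℝ)⁻¹) (p : M) :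
    ∃ U ∈ 𝓝 p, ∃ C : ℝ≥0∞, C ≠ ⊤ ∧ ∀ φ : {φ : M → ℝ // ContMDiff (𝓡 n) 𝓘(ℝ) ∞ φ},
      eLpNorm φ.1 q' ((vol g).restrict U) ≤ C * eLpNorm (firstOrderSize g φ.1) q (vol g) := by
  obtain ⟨r, hr, hsub4⟩ := exists_closedBall_subset_target (n := n) p
  have hsub2 : Metric.closedBall (chartAt (Model n) p p) (2 * r) ⊆
    (chartAt (Model n) p).target := (Metric.closedBall_subset_closedBall (by linarith)).trans hsub4
  have hsub1 : Metric.closedBall (chartAt (Model n) p p) r ⊆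
    (chartAt (Model n) p).target := (Metric.closedBall_subset_closedBall (by linarith)).trans hsub4
  obtain ⟨D, hD, hbd⟩ := exists_chart_bounds g (isCompact_closedBall _ _) hsub2
  -- In `B`, the 1 accounts for the values of the function and `√D` for its gradient.
  obtain ⟨C₁, hC₁, h1⟩ := exists_eLpNorm_closedBall_le_vol g hn hq hq' p hr hsub2
    (B := 1 + Real.sqrt D) (by positivity)
  obtain ⟨C₂, hC₂, h2⟩ := vol_restrict_le (isCompact_closedBall _ _) hsub1 g
  refine ⟨_, image_closedBall_mem_nhds (n := n) p hr, C₂ ^ (1 / (q' : ℝ≥0∞)).toReal * C₁,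
    ENNReal.mul_ne_top (ENNReal.rpow_ne_top_of_nonneg (by positivity) hC₂) hC₁, fun φ => ?_⟩
  obtain ⟨φ, hφ⟩ := φ
  obtain ⟨f, hf, hfφ⟩ := exists_contDiff_extension hr (chartAt (Model n) p).open_target hsub4
    (contDiffOn_inChart hφ p)
  refine (eLpNorm_le_of_measure_le h2 _ _).trans ?_
  rw [mul_assoc, eLpNorm_pushLebesgue hsub1 hφ.continuous]
  refine mul_le_mul_right ?_ _
  have hcongr : eLpNorm (φ ∘ (chartAt (Model n) p).symm) q'
      (volume.restrict (Metric.closedBall (chartAt (Model n) p p) r)) =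
      eLpNorm f q' (volume.restrict (Metric.closedBall (chartAt (Model n) p p) r)) := by
    refine eLpNorm_congr_ae ((ae_restrict_iff' Metric.isClosed_closedBall.measurableSet).2
      (Eventually.of_forall fun y hy => ?_))
    exact (hfφ y (Metric.closedBall_subset_closedBall (by linarith) hy)).eq_of_nhds.symm
  rw [hcongr]
  refine h1 f _ (hf.of_le (by norm_cast)) (continuous_firstOrderSize g hφ) fun y hy => ?_
  have hG := gradSqAt_nonneg g φ ((chartAt (Model n) p).symm y)
  have hs : 0 ≤ firstOrderSize g φ ((chartAt (Model n) p).symm y) := Real.sqrt_nonneg _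
  constructor
  · rw [(hfφ y hy).eq_of_nhds]
    have : |inChart φ p y| ≤ firstOrderSize g φ ((chartAt (Model n) p).symm y) :=
      Real.abs_le_sqrt (by simp only [inChart]; linarith)
    nlinarith [Real.sqrt_nonneg D]
  · rw [(hfφ y hy).fderiv_eq]
    refine (norm_fderiv_le_sqrt _ y).trans ((Real.sqrt_le_sqrt (hbd φ hφ y hy).1).trans ?_)
    rw [Real.sqrt_mul hD.le]
    have : Real.sqrt (gradSqAt g φ ((chartAt (Model n) p).symm y)) ≤
        firstOrderSize g φ ((chartAt (Model n) p).symm y) :=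
      Real.sqrt_le_sqrt (by linarith [sq_nonneg (φ ((chartAt (Model n) p).symm y))])
    nlinarith [Real.sqrt_nonneg D]

/-- Local form of the Sobolev inequality for gradients. -/
theorem exists_local_eLpNorm_grad_le (g : SmoothMetric n M) (hn : 0 < n) {q q' : NNReal}
    (hq : 1 ≤ q) (h1q' : 1 ≤ q') (hq' : (q' : ℝ)⁻¹ = (q : ℝ)⁻¹ - (n : ℝ)⁻¹) (p : M) :
    ∃ U ∈ 𝓝 p, ∃ C : ℝ≥0∞, C ≠ ⊤ ∧ ∀ φ : {φ : M → ℝ // ContMDiff (𝓡 n) 𝓘(ℝ) ∞ φ},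
      eLpNorm (fun x => Real.sqrt (gradSqAt g φ.1 x)) q' ((vol g).restrict U) ≤
        C * eLpNorm (secondOrderSize g φ.1) q (vol g) := by
  obtain ⟨r, hr, hsub4⟩ := exists_closedBall_subset_target (n := n) p
  have hsub2 : Metric.closedBall (chartAt (Model n) p p) (2 * r) ⊆
    (chartAt (Model n) p).target := (Metric.closedBall_subset_closedBall (by linarith)).trans hsub4
  have hsub1 : Metric.closedBall (chartAt (Model n) p p) r ⊆
    (chartAt (Model n) p).target := (Metric.closedBall_subset_closedBall (by linarith)).trans hsub4
  obtain ⟨D, hD, hbd⟩ := exists_chart_bounds g (isCompact_closedBall _ _) hsub2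
  obtain ⟨C₁, hC₁, h1⟩ := exists_eLpNorm_closedBall_le_vol g hn hq hq' p hr hsub2
    (B := Real.sqrt D) (by positivity)
  obtain ⟨C₂, hC₂, h2⟩ := vol_restrict_le (isCompact_closedBall _ _) hsub1 g
  refine ⟨_, image_closedBall_mem_nhds (n := n) p hr,
    C₂ ^ (1 / (q' : ℝ≥0∞)).toReal * (ENNReal.ofReal (Real.sqrt D) * (n * C₁)),
    ENNReal.mul_ne_top (ENNReal.rpow_ne_top_of_nonneg (by positivity) hC₂)
      (ENNReal.mul_ne_top (by simp) (ENNReal.mul_ne_top (by simp) hC₁)), fun φ => ?_⟩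
  obtain ⟨φ, hφ⟩ := φ
  obtain ⟨f, hf, hfφ⟩ := exists_contDiff_extension hr (chartAt (Model n) p).open_target hsub4
    (contDiffOn_inChart hφ p)
  have hgc : Continuous fun x => Real.sqrt (gradSqAt g φ x) :=
    Real.continuous_sqrt.comp (continuous_gradSqAt g hφ)
  have hpd : ∀ i, ∀ y ∈ Metric.closedBall (chartAt (Model n) p p) (2 * r),
      partialDeriv i f =ᶠ[𝓝 y] partialDeriv i (inChart φ p) := fun i y hy => by
    filter_upwards [(hfφ y hy).eventually_nhds] with z hz
    rw [partialDeriv, partialDeriv, Filter.EventuallyEq.fderiv_eq hz]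
  have hfi : ∀ i, ContDiff ℝ 1 (partialDeriv i f) := fun i =>
    contDiff_partialDeriv hf (by norm_cast) i
  -- The Sobolev inequality is applied to each partial derivative, since `|∇φ|` itself need not be
  -- differentiable where it vanishes. The sum of the `|∂ᵢf|` then dominates `|∇φ|` up to `√D`.
  have hterm : ∀ i, eLpNorm (partialDeriv i f) q'
      (volume.restrict (Metric.closedBall (chartAt (Model n) p p) r)) ≤
      C₁ * eLpNorm (secondOrderSize g φ) q (vol g) := by
    intro i
    refine h1 _ _ (hfi i) (continuous_secondOrderSize g hφ) fun y hy => ?_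
    obtain ⟨b1, b2, b3, b4, b5⟩ := hbd φ hφ y hy
    have hG := gradSqAt_nonneg g φ ((chartAt (Model n) p).symm y)
    have hH := hessSqAt_nonneg g φ ((chartAt (Model n) p).symm y)
    have hsz : ∀ t, t ≤ D * (hessSqAt g φ ((chartAt (Model n) p).symm y) +
        gradSqAt g φ ((chartAt (Model n) p).symm y)) →
        Real.sqrt t ≤ Real.sqrt D * secondOrderSize g φ ((chartAt (Model n) p).symm y) := by
      intro t ht
      rw [secondOrderSize, ← Real.sqrt_mul hD.le]
      refine Real.sqrt_le_sqrt (ht.trans (mul_le_mul_of_nonneg_left ?_ hD.le))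
      linarith [sq_nonneg (φ ((chartAt (Model n) p).symm y))]
    constructor
    · rw [(hpd i y hy).eq_of_nhds]
      exact (abs_partialDeriv_le _ y i).trans (hsz _ (b1.trans
        (mul_le_mul_of_nonneg_left (by linarith) hD.le)))
    · refine (norm_fderiv_le_sqrt _ y).trans (hsz _ (le_trans ?_ b3))
      -- The sums are exchanged so that the index of the inner derivative, here the fixed `i`,
      -- becomes the outer one.
      refine le_trans (le_of_eq ?_) (Finset.single_le_sum
        (f := fun j => ∑ k, partialDeriv k (partialDeriv j (inChart φ p)) y ^ 2)
        (fun _ _ => Finset.sum_nonneg fun _ _ => sq_nonneg _) (Finset.mem_univ i) |>.trans_eq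
        Finset.sum_comm)
      refine Finset.sum_congr rfl fun k _ => ?_
      rw [partialDeriv, partialDeriv, (hpd i y hy).fderiv_eq]
  refine (eLpNorm_le_of_measure_le h2 _ _).trans ?_
  rw [mul_assoc, eLpNorm_pushLebesgue hsub1 hgc]
  refine mul_le_mul_right ?_ _
  have hle : eLpNorm ((fun x => Real.sqrt (gradSqAt g φ x)) ∘ (chartAt (Model n) p).symm) q'
      (volume.restrict (Metric.closedBall (chartAt (Model n) p p) r)) ≤
      ENNReal.ofReal (Real.sqrt D) * eLpNorm (∑ i, fun y => ‖partialDeriv i f y‖) q'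
        (volume.restrict (Metric.closedBall (chartAt (Model n) p p) r)) := by
    refine eLpNorm_le_mul_eLpNorm_of_ae_le_mul
      ((ae_restrict_iff' Metric.isClosed_closedBall.measurableSet).2
        (Eventually.of_forall fun y hy => ?_)) _
    have hy2 := Metric.closedBall_subset_closedBall (by linarith : r ≤ 2 * r) hy
    obtain ⟨b1, b2, -⟩ := hbd φ hφ y hy2
    simp only [Function.comp, Finset.sum_apply, Real.norm_eq_abs]
    rw [abs_of_nonneg (Real.sqrt_nonneg _),
      abs_of_nonneg (Finset.sum_nonneg fun _ _ => abs_nonneg _)]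
    refine (Real.sqrt_le_sqrt b2).trans ?_
    rw [Real.sqrt_mul hD.le]
    refine mul_le_mul_of_nonneg_left ?_ (Real.sqrt_nonneg _)
    rw [Real.sqrt_le_left (Finset.sum_nonneg fun _ _ => abs_nonneg _)]
    have : euclGradSq (inChart φ p) y = ∑ i, |partialDeriv i f y| ^ 2 := by
      refine Finset.sum_congr rfl fun i _ => ?_
      rw [sq_abs, (hpd i y hy2).eq_of_nhds]
    rw [this]
    exact Finset.sum_sq_le_sq_sum_of_nonneg fun _ _ => abs_nonneg _
  refine hle.trans ?_
  rw [mul_assoc]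
  refine mul_le_mul_right ?_ _
  refine (eLpNorm_sum_le (fun i _ => (hfi i).continuous.norm.aestronglyMeasurable)
    (by exact_mod_cast h1q')).trans ?_
  simp only [eLpNorm_norm]
  refine (Finset.sum_le_sum fun i _ => hterm i).trans_eq ?_
  simp [mul_assoc]

end SmoothEstimates

/-! ### The `L²` estimate of the Hessian by the Laplacian on the manifold -/

theorem lintegral_pushLebesgue {n : ℕ} {M : Type*} [TopologicalSpace M]
    [ChartedSpace (Model n) M] [MeasurableSpace M] [BorelSpace M] {p : M} {K : Set (Model n)}
    (hKt : K ⊆ (chartAt (Model n) p).target) {F : M → ℝ} (hF : Continuous F) :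
    ∫⁻ x, ENNReal.ofReal (F x) ∂(pushLebesgue p K) =
      ∫⁻ y in K, ENNReal.ofReal (F ((chartAt (Model n) p).symm y)) :=
  lintegral_map' hF.measurable.ennreal_ofReal.aemeasurable
    (aemeasurable_chart_symm_restrict hKt)

section HessianEstimate

variable {n : ℕ} {M : Type*} [TopologicalSpace M] [ChartedSpace (Model n) M]
  [IsManifold (𝓡 n) ∞ M] [MeasurableSpace M] [BorelSpace M]

theorem lintegral_le_of_measure_le {X : Type*} [MeasurableSpace X] {μ ν : Measure X} {C : ℝ≥0∞}
    (h : μ ≤ C • ν) (f : X → ℝ≥0∞) : ∫⁻ x, f x ∂μ ≤ C * ∫⁻ x, f x ∂ν :=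
  (lintegral_mono' h le_rfl).trans_eq (lintegral_smul_measure _ _)

theorem eLpNorm_one_eq_lintegral_ofReal {X : Type*} [MeasurableSpace X] {μ : Measure X}
    {f : X → ℝ} (hf : ∀ x, 0 ≤ f x) :
    eLpNorm f (1 : NNReal) μ = ∫⁻ x, ENNReal.ofReal (f x) ∂μ := by
  rw [ENNReal.coe_one, eLpNorm_one_eq_lintegral_enorm]
  exact lintegral_congr fun x => Real.enorm_of_nonneg (hf x)

theorem lintegral_closedBall_ofReal {c : Model n} {r : ℝ} {f : Model n → ℝ}
    (hf : ContinuousOn f (Metric.closedBall c r)) (h0 : ∀ y ∈ Metric.closedBall c r, 0 ≤ f y) :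
    ∫⁻ y in Metric.closedBall c r, ENNReal.ofReal (f y) =
      ENNReal.ofReal (∫ y in Metric.closedBall c r, f y) :=
  (ofReal_integral_eq_lintegral_ofReal (hf.integrableOn_compact (isCompact_closedBall _ _))
    ((ae_restrict_iff' Metric.isClosed_closedBall.measurableSet).2
      (Eventually.of_forall h0))).symm

variable [T2Space M]

/-- The Euclidean estimate with `A = (g^{ij})`: in a chart, `Δφ` and `∑ A^{ij} ∂ᵢ∂ⱼφ` differ by a
first order term. The integral is written as an `L¹` seminorm so that `exists_eLpNorm_le_of_local`
can patch it. -/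
theorem exists_local_lintegral_hessSqAt_le (g : SmoothMetric n M) (p : M) :
    ∃ U ∈ 𝓝 p, ∃ C : ℝ≥0∞, C ≠ ⊤ ∧ ∀ φ : {φ : M → ℝ // ContMDiff (𝓡 n) 𝓘(ℝ) ∞ φ},
      eLpNorm (hessSqAt g φ.1) (1 : NNReal) ((vol g).restrict U) ≤
        C * ∫⁻ x, ENNReal.ofReal (lapAt g φ.1 x ^ 2 + gradSqAt g φ.1 x) ∂(vol g) := by
  obtain ⟨r, hr, hsub4⟩ := exists_closedBall_subset_target (n := n) p
  have hsub2 : Metric.closedBall (chartAt (Model n) p p) (2 * r) ⊆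
    (chartAt (Model n) p).target := (Metric.closedBall_subset_closedBall (by linarith)).trans hsub4
  have h12 : Metric.closedBall (chartAt (Model n) p p) r ⊆
    Metric.closedBall (chartAt (Model n) p p) (2 * r) :=
    Metric.closedBall_subset_closedBall (by linarith)
  have hsub1 := h12.trans hsub2
  obtain ⟨D, hD, hbd⟩ := exists_chart_bounds g (isCompact_closedBall _ _) hsub2
  obtain ⟨E, hE, hest⟩ := exists_integral_euclHessSq_le (A := fun y => (gram g p y)⁻¹)
    (chartAt (Model n) p).open_target
    (fun i j => (contDiffOn_gram_inv g p i j).of_le (by norm_cast))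
    (fun y hy => (gram_posDef g p hy).inv) hr hsub2
  obtain ⟨C₁, hC₁, h1⟩ := vol_restrict_le (isCompact_closedBall _ _) hsub1 g
  obtain ⟨C₂, hC₂, h2⟩ := pushLebesgue_le (isCompact_closedBall _ _) hsub2 g
  refine ⟨_, image_closedBall_mem_nhds (n := n) p hr,
    -- `C₁` and `C₂` compare the measures. `D` passes from `|∇²φ|²` to Euclidean derivatives, `E +
    -- 1` is the interior estimate together with the gradient term, and `2D` returns to `(Δφ)² +
    -- |∇φ|²`.
    C₁ * (ENNReal.ofReal (D * (E + 1) * (2 * D)) * C₂),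
    ENNReal.mul_ne_top hC₁ (ENNReal.mul_ne_top (by simp) hC₂), fun φ => ?_⟩
  obtain ⟨φ, hφ⟩ := φ
  obtain ⟨f, hf, hfφ⟩ := exists_contDiff_extension hr (chartAt (Model n) p).open_target hsub4
    (contDiffOn_inChart hφ p)
  have hf3 : ContDiff ℝ 3 f := hf.of_le (by norm_cast)
  have hpd : ∀ i, ∀ y ∈ Metric.closedBall (chartAt (Model n) p p) (2 * r),
      partialDeriv i f =ᶠ[𝓝 y] partialDeriv i (inChart φ p) := fun i y hy => by
    filter_upwards [(hfφ y hy).eventually_nhds] with z hz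
    rw [partialDeriv, partialDeriv, Filter.EventuallyEq.fderiv_eq hz]
  have hpd2 : ∀ i j, ∀ y ∈ Metric.closedBall (chartAt (Model n) p p) (2 * r),
      partialDeriv i (partialDeriv j f) y = partialDeriv i (partialDeriv j (inChart φ p)) y :=
    fun i j y hy => by rw [partialDeriv, partialDeriv, (hpd j y hy).fderiv_eq]
  have hgrad : ∀ y ∈ Metric.closedBall (chartAt (Model n) p p) (2 * r),
      euclGradSq f y = euclGradSq (inChart φ p) y := fun y hy =>
    Finset.sum_congr rfl fun i _ => by rw [(hpd i y hy).eq_of_nhds]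
  have hhess : ∀ y ∈ Metric.closedBall (chartAt (Model n) p p) (2 * r),
      euclHessSq f y = euclHessSq (inChart φ p) y := fun y hy =>
    Finset.sum_congr rfl fun i _ => Finset.sum_congr rfl fun j _ => by rw [hpd2 i j y hy]
  set L : Model n → ℝ := fun y =>
    (∑ i, ∑ j, (gram g p y)⁻¹ i j * partialDeriv i (partialDeriv j f) y) ^ 2 + euclGradSq f y
    with hL
  have cG : Continuous (euclGradSq f) := continuous_euclGradSq (hf.of_le (by norm_cast))
  have cH : Continuous (euclHessSq f) := continuous_euclHessSq (hf.of_le (by norm_cast))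
  have cpd : ∀ i j, Continuous (partialDeriv i (partialDeriv j f)) := fun i j =>
    (contDiff_partialDeriv (m := 0) (contDiff_partialDeriv (m := 1) hf3 (by norm_cast) j)
      (by norm_cast) i).continuous
  have cL : ContinuousOn L (Metric.closedBall (chartAt (Model n) p p) (2 * r)) := by
    refine ContinuousOn.add (ContinuousOn.pow ?_ 2) cG.continuousOn
    exact continuousOn_finsetSum _ fun i _ => continuousOn_finsetSum _ fun j _ =>
      ((contDiffOn_gram_inv g p i j).continuousOn.mono hsub2).mul (cpd i j).continuousOn
  have L0 : ∀ y, 0 ≤ L y := fun y => add_nonneg (sq_nonneg _) (euclGradSq_nonneg f y)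
  have hLbd : ∀ y ∈ Metric.closedBall (chartAt (Model n) p p) (2 * r),
      L y ≤ 2 * D * (lapAt g φ ((chartAt (Model n) p).symm y) ^ 2 +
        gradSqAt g φ ((chartAt (Model n) p).symm y)) := by
    intro y hy
    obtain ⟨b1, -, -, -, b5⟩ := hbd φ hφ y hy
    simp only [hL]
    rw [hgrad y hy]
    simp only [hpd2 _ _ y hy]
    nlinarith [mul_nonneg hD.le (sq_nonneg (lapAt g φ ((chartAt (Model n) p).symm y)))]
  have hcont : Continuous fun x => lapAt g φ x ^ 2 + gradSqAt g φ x :=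
    ((continuous_lapAt g hφ).pow 2).add (continuous_gradSqAt g hφ)
  rw [eLpNorm_one_eq_lintegral_ofReal (hessSqAt_nonneg g φ)]
  refine (lintegral_le_of_measure_le h1 _).trans ?_
  rw [mul_assoc, lintegral_pushLebesgue hsub1 (continuous_hessSqAt g hφ)]
  refine mul_le_mul_right ?_ _
  have hint : ∫ y in Metric.closedBall (chartAt (Model n) p p) r,
      D * (euclHessSq f y + euclGradSq f y) ≤ D * (E + 1) *
        ∫ y in Metric.closedBall (chartAt (Model n) p p) (2 * r), L y := by
    rw [integral_const_mul, integral_add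
      (cH.continuousOn.integrableOn_compact (isCompact_closedBall _ _))
      (cG.continuousOn.integrableOn_compact (isCompact_closedBall _ _)), mul_assoc]
    refine mul_le_mul_of_nonneg_left ?_ hD.le
    have i1 := hest f hf3
    have i2 : ∫ y in Metric.closedBall (chartAt (Model n) p p) r, euclGradSq f y ≤
        ∫ y in Metric.closedBall (chartAt (Model n) p p) (2 * r), L y := by
      refine (setIntegral_mono_set
        (cG.continuousOn.integrableOn_compact (isCompact_closedBall _ _))
        (Eventually.of_forall (euclGradSq_nonneg f)) h12.eventuallyLE).trans ?_
      refine setIntegral_mono (cG.continuousOn.integrableOn_compact (isCompact_closedBall _ _))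
        (cL.integrableOn_compact (isCompact_closedBall _ _)) fun y => ?_
      exact le_add_of_nonneg_left (sq_nonneg _)
    linarith
  calc ∫⁻ y in Metric.closedBall (chartAt (Model n) p p) r,
        ENNReal.ofReal (hessSqAt g φ ((chartAt (Model n) p).symm y))
      ≤ ∫⁻ y in Metric.closedBall (chartAt (Model n) p p) r,
        ENNReal.ofReal (D * (euclHessSq f y + euclGradSq f y)) := by
        refine setLIntegral_mono' Metric.isClosed_closedBall.measurableSet fun y hy =>
          ENNReal.ofReal_le_ofReal ?_
        rw [hgrad y (h12 hy), hhess y (h12 hy)]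
        exact (hbd φ hφ y (h12 hy)).2.2.2.1
    _ = ENNReal.ofReal (∫ y in Metric.closedBall (chartAt (Model n) p p) r,
        D * (euclHessSq f y + euclGradSq f y)) :=
        lintegral_closedBall_ofReal (continuous_const.mul (cH.add cG)).continuousOn fun y _ =>
          mul_nonneg hD.le (add_nonneg (euclHessSq_nonneg f y) (euclGradSq_nonneg f y))
    _ ≤ ENNReal.ofReal (D * (E + 1) *
        ∫ y in Metric.closedBall (chartAt (Model n) p p) (2 * r), L y) :=
        ENNReal.ofReal_le_ofReal hint
    _ = ENNReal.ofReal (D * (E + 1)) *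
        ∫⁻ y in Metric.closedBall (chartAt (Model n) p p) (2 * r), ENNReal.ofReal (L y) := by
        rw [ENNReal.ofReal_mul (by positivity),
          lintegral_closedBall_ofReal cL fun y _ => L0 y]
    _ ≤ ENNReal.ofReal (D * (E + 1)) * (ENNReal.ofReal (2 * D) *
        ∫⁻ y in Metric.closedBall (chartAt (Model n) p p) (2 * r),
          ENNReal.ofReal (lapAt g φ ((chartAt (Model n) p).symm y) ^ 2 +
            gradSqAt g φ ((chartAt (Model n) p).symm y))) := by
        refine mul_le_mul_right ?_ _
        rw [← lintegral_const_mul' _ _ ENNReal.ofReal_ne_top]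
        refine setLIntegral_mono' Metric.isClosed_closedBall.measurableSet fun y hy => ?_
        rw [← ENNReal.ofReal_mul (by positivity)]
        exact ENNReal.ofReal_le_ofReal (hLbd y hy)
    _ ≤ ENNReal.ofReal (D * (E + 1)) * (ENNReal.ofReal (2 * D) * (C₂ *
        ∫⁻ x, ENNReal.ofReal (lapAt g φ x ^ 2 + gradSqAt g φ x) ∂(vol g))) := by
        refine mul_le_mul_right (mul_le_mul_right ?_ _) _
        rw [← lintegral_pushLebesgue hsub2 hcont]
        exact lintegral_le_of_measure_le h2 _
    _ = _ := by
        rw [ENNReal.ofReal_mul (p := D * (E + 1)) (by positivity)]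
        ring

theorem exists_lintegral_hessSqAt_le [CompactSpace M] (g : SmoothMetric n M) :
    ∃ C : ℝ≥0∞, C ≠ ⊤ ∧ ∀ φ : M → ℝ, ContMDiff (𝓡 n) 𝓘(ℝ) ∞ φ →
      ∫⁻ x, ENNReal.ofReal (hessSqAt g φ x) ∂(vol g) ≤
        C * ∫⁻ x, ENNReal.ofReal (lapAt g φ x ^ 2 + gradSqAt g φ x) ∂(vol g) := by
  obtain ⟨C, hC, h⟩ := exists_eLpNorm_le_of_local (μ := vol g) le_rfl
    (fun φ : {φ : M → ℝ // ContMDiff (𝓡 n) 𝓘(ℝ) ∞ φ} => hessSqAt g φ.1)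
    (fun φ => ∫⁻ x, ENNReal.ofReal (lapAt g φ.1 x ^ 2 + gradSqAt g φ.1 x) ∂(vol g))
    (exists_local_lintegral_hessSqAt_le g)
  refine ⟨C, hC, fun φ hφ => ?_⟩
  rw [← eLpNorm_one_eq_lintegral_ofReal (hessSqAt_nonneg g φ)]
  exact h ⟨φ, hφ⟩

end HessianEstimate

/-! ### Global Sobolev inequalities and the lower order terms -/

section SobolevInequalities

/-- Hölder's inequality with the conjugate exponents `t` and `q / 2`. -/
theorem lintegral_mul_sq_le {X : Type*} [MeasurableSpace X] {μ : Measure X} {a f : X → ℝ}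
    (ha : AEStronglyMeasurable a μ) (hf : AEStronglyMeasurable f μ) {t q : NNReal}
    (ht : 1 < t) (htq : (t : ℝ)⁻¹ + 2 * (q : ℝ)⁻¹ = 1) :
    ∫⁻ x, ‖a x‖ₑ * ENNReal.ofReal (f x ^ 2) ∂μ ≤ eLpNorm a t μ * eLpNorm f q μ ^ 2 := by
  have ht0 : (0 : ℝ) < t := by exact_mod_cast zero_lt_one.trans ht
  have ht1 : (1 : ℝ) < t := by exact_mod_cast ht
  have hti : (t : ℝ)⁻¹ < 1 := inv_lt_one_of_one_lt₀ ht1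
  have hq0 : (0 : ℝ) < q := by
    rcases eq_or_lt_of_le q.2 with h | h
    · have h' : (q : ℝ) = 0 := h.symm
      rw [h'] at htq
      simp only [inv_zero] at htq
      linarith
    · exact h
  have hconj : (t : ℝ).HolderConjugate (q / 2 : ℝ) :=
    Real.holderConjugate_iff.2 ⟨ht1, by rw [inv_div, div_eq_mul_inv]; exact htq⟩
  have hsq : ∀ x, ENNReal.ofReal (f x ^ 2) = ‖f x‖ₑ ^ 2 := fun x => by
    rw [← enorm_pow, Real.enorm_of_nonneg (sq_nonneg _)]
  simp only [hsq]
  refine (ENNReal.lintegral_mul_le_Lp_mul_Lq μ hconj ha.enorm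
    (hf.enorm.pow_const 2)).trans_eq ?_
  have ht0' : (t : ℝ≥0∞) ≠ 0 := by
    have : t ≠ 0 := (zero_lt_one.trans ht).ne'
    exact_mod_cast this
  have hq0' : (q : ℝ≥0∞) ≠ 0 := by
    have : q ≠ 0 := fun h => by simp [h] at hq0
    exact_mod_cast this
  rw [eLpNorm_eq_lintegral_rpow_enorm_toReal ht0' ENNReal.coe_ne_top,
    eLpNorm_eq_lintegral_rpow_enorm_toReal hq0' ENNReal.coe_ne_top]
  simp only [ENNReal.coe_toReal]
  congr 1
  rw [← ENNReal.rpow_natCast, ← ENNReal.rpow_mul]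
  have : ∀ x, (‖f x‖ₑ ^ 2) ^ ((q : ℝ) / 2) = ‖f x‖ₑ ^ (q : ℝ) := fun x => by
    rw [← ENNReal.rpow_natCast, ← ENNReal.rpow_mul]
    congr 1
    push_cast
    ring
  simp only [this]
  congr 1
  push_cast
  field_simp

variable {n : ℕ} {M : Type*} [TopologicalSpace M] [ChartedSpace (Model n) M]
  [IsManifold (𝓡 n) ∞ M] [MeasurableSpace M]

theorem eLpNorm_secondOrderSize_sq (g : SmoothMetric n M) (φ : M → ℝ) :
    eLpNorm (secondOrderSize g φ) 2 (vol g) ^ 2 =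
      ∫⁻ x, ENNReal.ofReal (jetSq g x (jet g φ x)) ∂(vol g) := by
  have h0 : ∀ x, 0 ≤ φ x ^ 2 + gradSqAt g φ x + hessSqAt g φ x := fun x =>
    add_nonneg (add_nonneg (sq_nonneg _) (gradSqAt_nonneg g φ x)) (hessSqAt_nonneg g φ x)
  rw [eLpNorm_eq_lintegral_rpow_enorm_toReal (by simp) (by simp), ← ENNReal.rpow_natCast,
    ← ENNReal.rpow_mul]
  norm_num
  refine lintegral_congr fun x => ?_
  rw [← enorm_pow, secondOrderSize, Real.sq_sqrt (h0 x), Real.enorm_of_nonneg (h0 x)]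
  rfl

theorem eLpNorm_firstOrderSize_le_second (g : SmoothMetric n M) (φ : M → ℝ) (q : ℝ≥0∞) :
    eLpNorm (firstOrderSize g φ) q (vol g) ≤ eLpNorm (secondOrderSize g φ) q (vol g) := by
  refine eLpNorm_mono fun x => ?_
  rw [firstOrderSize, secondOrderSize, Real.norm_of_nonneg (Real.sqrt_nonneg _),
    Real.norm_of_nonneg (Real.sqrt_nonneg _)]
  exact Real.sqrt_le_sqrt (le_add_of_nonneg_right (hessSqAt_nonneg g φ x))

variable [BorelSpace M]

theorem eLpNorm_firstOrderSize_le (g : SmoothMetric n M) {φ : M → ℝ}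
    (hφ : ContMDiff (𝓡 n) 𝓘(ℝ) ∞ φ) {q : ℝ≥0∞} (hq : 1 ≤ q) :
    eLpNorm (firstOrderSize g φ) q (vol g) ≤
      eLpNorm φ q (vol g) + eLpNorm (fun x => Real.sqrt (gradSqAt g φ x)) q (vol g) := by
  have h1 : AEStronglyMeasurable (fun x => ‖φ x‖) (vol g) :=
    hφ.continuous.norm.aestronglyMeasurable
  have h2 : AEStronglyMeasurable (fun x => Real.sqrt (gradSqAt g φ x)) (vol g) :=
    (Real.continuous_sqrt.comp (continuous_gradSqAt g hφ)).aestronglyMeasurable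
  rw [← eLpNorm_norm φ]
  refine le_trans (eLpNorm_mono (g := (fun x => ‖φ x‖) + fun x => Real.sqrt (gradSqAt g φ x))
    fun x => ?_) (eLpNorm_add_le h1 h2 hq)
  have hs := Real.sqrt_nonneg (gradSqAt g φ x)
  have h0 : 0 ≤ ‖φ x‖ + Real.sqrt (gradSqAt g φ x) := add_nonneg (norm_nonneg _) hs
  rw [firstOrderSize, Real.norm_of_nonneg (Real.sqrt_nonneg _), Pi.add_apply,
    Real.norm_of_nonneg h0, Real.sqrt_le_left h0, Real.norm_eq_abs]
  nlinarith [Real.sq_sqrt (gradSqAt_nonneg g φ x), sq_abs (φ x), abs_nonneg (φ x)]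

variable [T2Space M] [CompactSpace M]

/-- Two Sobolev steps: from exponent 2 to `q₁` for both `φ` and `∇φ`, then from `q₁` to `q₂` for
`φ`. With `n ≥ 5`, the reciprocals of both exponents are positive. -/
theorem exists_eLpNorm_sobolev_le (g : SmoothMetric n M) (hn : 5 ≤ n) {q₁ q₂ : NNReal}
    (hq₁ : (q₁ : ℝ)⁻¹ = 2⁻¹ - (n : ℝ)⁻¹) (hq₂ : (q₂ : ℝ)⁻¹ = 2⁻¹ - 2 * (n : ℝ)⁻¹) :
    ∃ C : ℝ≥0∞, C ≠ ⊤ ∧ ∀ φ : M → ℝ, ContMDiff (𝓡 n) 𝓘(ℝ) ∞ φ →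
      eLpNorm (fun x => Real.sqrt (gradSqAt g φ x)) q₁ (vol g) ≤
        C * eLpNorm (secondOrderSize g φ) 2 (vol g) ∧
      eLpNorm φ q₂ (vol g) ≤ C * eLpNorm (secondOrderSize g φ) 2 (vol g) := by
  have hn5 : (5 : ℝ) ≤ n := by exact_mod_cast hn
  have hni : (n : ℝ)⁻¹ ≤ 5⁻¹ := inv_anti₀ (by norm_num) hn5
  have hni0 : 0 < (n : ℝ)⁻¹ := by positivity
  have one_le : ∀ q : NNReal, 0 < (q : ℝ)⁻¹ → (q : ℝ)⁻¹ ≤ 1 → 1 ≤ q := by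
    intro q h0 h1
    have hq : 0 < (q : ℝ) := inv_pos.1 h0
    have : (1 : ℝ) ≤ q := (inv_le_one₀ hq).1 h1
    exact_mod_cast this
  have h1q₁ : 1 ≤ q₁ := one_le _ (by rw [hq₁]; linarith) (by rw [hq₁]; linarith)
  have h1q₂ : 1 ≤ q₂ := one_le _ (by rw [hq₂]; linarith) (by rw [hq₂]; linarith)
  have h12 : (1 : NNReal) ≤ 2 := by norm_num
  obtain ⟨C₁, hC₁, h1⟩ := exists_eLpNorm_le_of_local h1q₁ _ _
    (exists_local_eLpNorm_grad_le g (by omega) h12 h1q₁ (by rw [hq₁]; norm_num))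
  obtain ⟨C₂, hC₂, h2⟩ := exists_eLpNorm_le_of_local h1q₁ _ _
    (exists_local_eLpNorm_le g (by omega) h12 (q' := q₁) (by rw [hq₁]; norm_num))
  obtain ⟨C₃, hC₃, h3⟩ := exists_eLpNorm_le_of_local h1q₂ _ _
    (exists_local_eLpNorm_le g (by omega) h1q₁ (q' := q₂) (by rw [hq₂, hq₁]; ring))
  simp only [ENNReal.coe_ofNat] at h1 h2
  refine ⟨C₁ + C₃ * (C₂ + C₁), by finiteness, fun φ hφ => ⟨?_, ?_⟩⟩
  · exact (h1 ⟨φ, hφ⟩).trans (mul_le_mul_left le_self_add _)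
  refine (h3 ⟨φ, hφ⟩).trans ?_
  rw [add_mul, mul_assoc, add_mul]
  refine le_trans (mul_le_mul_right ((eLpNorm_firstOrderSize_le g hφ
    (by exact_mod_cast h1q₁)).trans (add_le_add ((h2 ⟨φ, hφ⟩).trans
      (mul_le_mul_right (eLpNorm_firstOrderSize_le_second g φ 2) _)) (h1 ⟨φ, hφ⟩))) _) le_add_self

/-- The Sobolev inequality, in the form of a bound for the lower order terms of the operator. -/
theorem exists_lintegral_lower_order_le (g : SmoothMetric n M) (hn : 5 ≤ n) {r s : ℝ≥0∞}
    (hr : (n : ℝ≥0∞) / 2 < r) (hs : (n : ℝ≥0∞) / 4 < s) {a b : M → ℝ}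
    (ha : MemLp a r (vol g)) (hb : MemLp b s (vol g)) :
    ∃ C : ℝ≥0∞, C ≠ ⊤ ∧ ∀ φ : M → ℝ, ContMDiff (𝓡 n) 𝓘(ℝ) ∞ φ →
      ∫⁻ x, ‖a x‖ₑ * ENNReal.ofReal (gradSqAt g φ x) ∂(vol g) ≤
        C * ∫⁻ x, ENNReal.ofReal (jetSq g x (jet g φ x)) ∂(vol g) ∧
      ∫⁻ x, ‖b x‖ₑ * ENNReal.ofReal (φ x ^ 2) ∂(vol g) ≤
        C * ∫⁻ x, ENNReal.ofReal (jetSq g x (jet g φ x)) ∂(vol g) := by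
  have hn5 : (5 : ℝ) ≤ n := by exact_mod_cast hn
  have hn5' : (5 : NNReal) ≤ n := by exact_mod_cast hn
  have e1 : ((2 * n / (n - 2) : ℝ).toNNReal : ℝ) = 2 * n / (n - 2) :=
    Real.coe_toNNReal _ (div_nonneg (by linarith) (by linarith))
  have e2 : ((2 * n / (n - 4) : ℝ).toNNReal : ℝ) = 2 * n / (n - 4) :=
    Real.coe_toNNReal _ (div_nonneg (by linarith) (by linarith))
  have z2 : (n : ℝ) - 2 ≠ 0 := by linarith
  have z4 : (n : ℝ) - 4 ≠ 0 := by linarith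
  -- The exponents `2n/(n-2)` and `2n/(n-4)` are the Hölder partners of `n/2` and `n/4`: `2/n +
  -- (n-2)/n = 1` and `4/n + (n-4)/n = 1`.
  obtain ⟨C, hC, h⟩ := exists_eLpNorm_sobolev_le g hn
    (q₁ := (2 * n / (n - 2) : ℝ).toNNReal) (q₂ := (2 * n / (n - 4) : ℝ).toNNReal)
    (by rw [e1]; field_simp) (by rw [e2]; field_simp; ring)
  have ht : ((n / 2 : NNReal) : ℝ≥0∞) ≤ r := by
    refine le_trans (le_of_eq ?_) hr.le
    rw [ENNReal.coe_div (by norm_num)]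
    simp
  have ht' : ((n / 4 : NNReal) : ℝ≥0∞) ≤ s := by
    refine le_trans (le_of_eq ?_) hs.le
    rw [ENNReal.coe_div (by norm_num)]
    simp
  -- On a space of finite volume a smaller exponent gives a weaker condition.
  have ha' := ha.mono_exponent ht
  have hb' := hb.mono_exponent ht'
  refine ⟨(eLpNorm a (n / 2 : NNReal) (vol g) + eLpNorm b (n / 4 : NNReal) (vol g)) * C ^ 2,
    ENNReal.mul_ne_top (ENNReal.add_ne_top.2 ⟨ha'.2.ne, hb'.2.ne⟩) (by finiteness),
    fun φ hφ => ?_⟩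
  obtain ⟨h1, h2⟩ := h φ hφ
  rw [← eLpNorm_secondOrderSize_sq]
  constructor
  · have := lintegral_mul_sq_le (f := fun x => Real.sqrt (gradSqAt g φ x)) ha.1
      (Real.continuous_sqrt.comp (continuous_gradSqAt g hφ)).aestronglyMeasurable
      (t := n / 2) (q := (2 * n / (n - 2) : ℝ).toNNReal)
      (by rw [lt_div_iff₀ (by norm_num)]; exact lt_of_lt_of_le (by norm_num) hn5')
      (by rw [e1]; push_cast; field_simp; ring)
    simp only [Real.sq_sqrt (gradSqAt_nonneg g φ _)] at this
    refine this.trans ?_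
    rw [mul_assoc, ← mul_pow]
    exact mul_le_mul' le_self_add (pow_le_pow_left₀ zero_le h1 2)
  · refine (lintegral_mul_sq_le (f := φ) hb.1 hφ.continuous.aestronglyMeasurable
      (t := n / 4) (q := (2 * n / (n - 4) : ℝ).toNNReal)
      (by rw [lt_div_iff₀ (by norm_num)]; exact lt_of_lt_of_le (by norm_num) hn5')
      (by rw [e2]; push_cast; field_simp; ring)).trans ?_
    rw [mul_assoc, ← mul_pow]
    exact mul_le_mul' le_add_self (pow_le_pow_left₀ zero_le h2 2)

end SobolevInequalities

/-! ### Pointwise algebra of jets -/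

section PointwiseAlgebra

variable {n : ℕ} {M : Type*} [TopologicalSpace M] [ChartedSpace (Model n) M]
  [IsManifold (𝓡 n) ∞ M]

theorem gramAt_posDef (g : SmoothMetric n M) (x : M) : (gramAt g x).PosDef :=
  gram_posDef g x (mem_chart_target _ x)

theorem tensorSq_sub_smul_gramAt (g : SmoothMetric n M) (x : M) (η : Matrix (Fin n) (Fin n) ℝ)
    (t : ℝ) :
    tensorSq g x (η - t • gramAt g x) =
      tensorSq g x η - 2 * t * tensorTrace g x η + t ^ 2 * n := by
  have hG := gramAt_posDef g x
  have hu : IsUnit (gramAt g x).det := hG.det_pos.ne'.isUnit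
  have hs : (gramAt g x).transpose = gramAt g x := by
    have := hG.isHermitian
    rwa [Matrix.IsHermitian, Matrix.conjTranspose_eq_transpose_of_trivial] at this
  have hi : (gramAt g x)⁻¹.transpose = (gramAt g x)⁻¹ := by
    rw [Matrix.transpose_nonsing_inv, hs]
  change contractTensorSq (gramAt g x) _ = contractTensorSq (gramAt g x) _ -
    2 * t * contractTrace (gramAt g x) η + _
  rw [contractTensorSq_eq, contractTensorSq_eq, contractTrace_eq, hi]
  generalize gramAt g x = G at *
  have h1 : G⁻¹ * G = 1 := Matrix.nonsing_inv_mul _ hu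
  have e1 : (G⁻¹ * (η - t • G) * G⁻¹ * (η - t • G).transpose) =
      G⁻¹ * η * G⁻¹ * η.transpose - t • (G⁻¹ * η) - t • (G⁻¹ * η.transpose) +
        (t ^ 2) • (1 : Matrix (Fin n) (Fin n) ℝ) := by
    have e2 : G⁻¹ * (η - t • G) = G⁻¹ * η - t • (1 : Matrix (Fin n) (Fin n) ℝ) := by
      rw [Matrix.mul_sub, Matrix.mul_smul, h1]
    have e3 : G⁻¹ * (η - t • G).transpose =
        G⁻¹ * η.transpose - t • (1 : Matrix (Fin n) (Fin n) ℝ) := by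
      rw [Matrix.transpose_sub, Matrix.transpose_smul, hs, Matrix.mul_sub, Matrix.mul_smul, h1]
    rw [Matrix.mul_assoc, e2, e3]
    simp only [Matrix.sub_mul, Matrix.mul_sub, Matrix.mul_smul, Matrix.smul_mul, Matrix.mul_one,
      Matrix.one_mul, Matrix.mul_assoc, smul_sub, smul_smul]
    rw [pow_two]
    abel
  have e4 : (G⁻¹ * η).trace = (G⁻¹ * η.transpose).trace := by
    rw [← Matrix.trace_transpose, Matrix.transpose_mul, hi, Matrix.trace_mul_comm]
  rw [e1, Matrix.trace_add, Matrix.trace_sub, Matrix.trace_sub, Matrix.trace_smul,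
    Matrix.trace_smul, Matrix.trace_smul, e4, Matrix.trace_one, Fintype.card_fin]
  simp only [smul_eq_mul]
  ring

/-- The trace-free part `η - (tr η / n) g` has squared norm `|η|² - (tr η)² / n`, which is
nonnegative. -/
theorem tensorTrace_sq_le (g : SmoothMetric n M) (x : M) (η : Matrix (Fin n) (Fin n) ℝ) :
    tensorTrace g x η ^ 2 ≤ n * tensorSq g x η := by
  rcases Nat.eq_zero_or_pos n with rfl | hn
  · simp [tensorTrace]
  have hn' : (0 : ℝ) < n := by exact_mod_cast hn
  have h := tensorSq_nonneg g x (η - (tensorTrace g x η / n) • gramAt g x)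
  rw [tensorSq_sub_smul_gramAt] at h
  have e : tensorSq g x η - 2 * (tensorTrace g x η / n) * tensorTrace g x η +
      (tensorTrace g x η / n) ^ 2 * n = tensorSq g x η - tensorTrace g x η ^ 2 / n := by
    field_simp
    ring
  rw [e] at h
  rw [← div_le_iff₀' hn']
  linarith

theorem tensorTrace_add (g : SmoothMetric n M) (x : M) (η ζ : Matrix (Fin n) (Fin n) ℝ) :
    tensorTrace g x (η + ζ) = tensorTrace g x η + tensorTrace g x ζ := by
  simp only [tensorTrace, Matrix.add_apply, mul_add, Finset.sum_add_distrib]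

theorem tensorTrace_smul (g : SmoothMetric n M) (x : M) (c : ℝ) (η : Matrix (Fin n) (Fin n) ℝ) :
    tensorTrace g x (c • η) = c * tensorTrace g x η := by
  simp only [tensorTrace, Matrix.smul_apply, smul_eq_mul, Finset.mul_sum]
  exact Finset.sum_congr rfl fun i _ => Finset.sum_congr rfl fun j _ => by ring

/-- The cross term is expressed through values of the quadratic form alone, so no symmetry of the
bilinear form is needed. The same shape recurs in `quadDensity_add_smul` and in the hypothesis of
`isNorm_sqrt_of_quadratic`. -/
theorem covInner_add_smul_self (g : SmoothMetric n M) (x : M) (t : ℝ) (ξ ζ : Fin n → ℝ) :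
    covInner g x (ξ + t • ζ) (ξ + t • ζ) = covInner g x ξ ξ +
      t * (covInner g x (ξ + ζ) (ξ + ζ) - covInner g x ξ ξ - covInner g x ζ ζ) +
        t ^ 2 * covInner g x ζ ζ := by
  simp only [covInner, Finset.mul_sum, ← Finset.sum_add_distrib, ← Finset.sum_sub_distrib,
    Pi.add_apply, Pi.smul_apply, smul_eq_mul]
  exact Finset.sum_congr rfl fun i _ => Finset.sum_congr rfl fun j _ => by ring

theorem covInner_add_self_le (g : SmoothMetric n M) (x : M) (ξ ζ : Fin n → ℝ) :
    covInner g x (ξ + ζ) (ξ + ζ) ≤ 2 * covInner g x ξ ξ + 2 * covInner g x ζ ζ := by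
  have h := covInner_self_nonneg g x (ξ + (-1 : ℝ) • ζ)
  rw [covInner_add_smul_self] at h
  linarith

theorem continuous_covInner_self (g : SmoothMetric n M) (x : M) :
    Continuous fun J : Jet n => covInner g x J.2.1 J.2.1 := by
  have h : ∀ i, Continuous fun J : Jet n => J.2.1 i := fun i =>
    (continuous_apply i).comp (continuous_fst.comp continuous_snd)
  exact continuous_finsetSum _ fun i _ => continuous_finsetSum _ fun j _ =>
    (continuous_const.mul (h i)).mul (h j)

theorem continuous_matrix_entry_snd_snd (i j : Fin n) : Continuous fun J : Jet n => J.2.2 i j :=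
  (continuous_snd.comp continuous_snd).matrix_elem i j

theorem continuous_tensorSq (g : SmoothMetric n M) (x : M) :
    Continuous fun J : Jet n => tensorSq g x J.2.2 :=
  continuous_finsetSum _ fun i _ => continuous_finsetSum _ fun j _ =>
    continuous_finsetSum _ fun k _ => continuous_finsetSum _ fun l _ =>
      (continuous_const.mul (continuous_matrix_entry_snd_snd i j)).mul
        (continuous_matrix_entry_snd_snd k l)

theorem continuous_tensorTrace (g : SmoothMetric n M) (x : M) :
    Continuous fun J : Jet n => tensorTrace g x J.2.2 :=
  continuous_finsetSum _ fun i _ => continuous_finsetSum _ fun j _ =>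
    continuous_const.mul (continuous_matrix_entry_snd_snd i j)

theorem continuous_jetSq (g : SmoothMetric n M) (x : M) : Continuous (jetSq g x) :=
  ((continuous_fst.pow 2).add (continuous_covInner_self g x)).add (continuous_tensorSq g x)

/-- `jetSq` controls every component of a jet. -/
theorem exists_component_sq_le (g : SmoothMetric n M) (x : M) :
    ∃ C : ℝ, ∀ J : Jet n, J.1 ^ 2 ≤ C * jetSq g x J ∧ (∀ i, J.2.1 i ^ 2 ≤ C * jetSq g x J) ∧
      ∀ i j, J.2.2 i j ^ 2 ≤ C * jetSq g x J := by
  -- The bounds for compact subsets of a chart are applied to a single point.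
  have hy : ({chartAt (Model n) x x} : Set (Model n)) ⊆ (chartAt (Model n) x).target :=
    Set.singleton_subset_iff.2 (mem_chart_target _ x)
  obtain ⟨C₁, hC₁, h1⟩ := exists_gradSq_bounds g isCompact_singleton hy
  obtain ⟨C₂, hC₂, h2⟩ := exists_hessSq_bounds g isCompact_singleton hy
  refine ⟨1 + C₁ + C₂, fun J => ?_⟩
  have b1 : ∑ i, J.2.1 i ^ 2 ≤ C₁ * covInner g x J.2.1 J.2.1 :=
    (h1 _ (Set.mem_singleton _) J.2.1).1
  have b2 : ∑ i, ∑ j, J.2.2 i j ^ 2 ≤ C₂ * tensorSq g x J.2.2 :=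
    (h2 _ (Set.mem_singleton _) J.2.2).1
  have n0 := sq_nonneg J.1
  have n1 := covInner_self_nonneg g x J.2.1
  have n2 := tensorSq_nonneg g x J.2.2
  have p0 : 0 ≤ jetSq g x J := jetSq_nonneg g x J
  have hJ : jetSq g x J = J.1 ^ 2 + covInner g x J.2.1 J.2.1 + tensorSq g x J.2.2 := rfl
  have m1 : C₁ * covInner g x J.2.1 J.2.1 ≤ C₁ * jetSq g x J :=
    mul_le_mul_of_nonneg_left (by linarith) hC₁.le
  have m2 : C₂ * tensorSq g x J.2.2 ≤ C₂ * jetSq g x J :=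
    mul_le_mul_of_nonneg_left (by linarith) hC₂.le
  have q1 := mul_nonneg hC₁.le p0
  have q2 := mul_nonneg hC₂.le p0
  refine ⟨by linarith, fun i => ?_, fun i j => ?_⟩
  · have := Finset.single_le_sum (f := fun i => J.2.1 i ^ 2) (fun _ _ => sq_nonneg _)
      (Finset.mem_univ i)
    linarith
  · have h3 := Finset.single_le_sum (f := fun j => J.2.2 i j ^ 2) (fun _ _ => sq_nonneg _)
      (Finset.mem_univ j)
    have h4 := Finset.single_le_sum (f := fun i => ∑ j, J.2.2 i j ^ 2)
      (fun _ _ => Finset.sum_nonneg fun _ _ => sq_nonneg _) (Finset.mem_univ i)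
    linarith

theorem eq_zero_of_jetSq_eq_zero (g : SmoothMetric n M) (x : M) {J : Jet n}
    (h : jetSq g x J = 0) : J = 0 := by
  obtain ⟨C, hC⟩ := exists_component_sq_le g x
  obtain ⟨h1, h2, h3⟩ := hC J
  simp only [h, mul_zero] at h1 h2 h3
  refine Prod.ext (sq_nonpos_iff _ |>.1 h1) (Prod.ext (funext fun i => ?_) (Matrix.ext fun i j => ?_))
  · exact sq_nonpos_iff _ |>.1 (h2 i)
  · exact sq_nonpos_iff _ |>.1 (h3 i j)

theorem tendsto_of_sq_sub_le {ι : Type*} {l : Filter ι} {u B : ι → ℝ} {c : ℝ} (C : ℝ)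
    (h : ∀ k, (u k - c) ^ 2 ≤ C * B k) (hB : Tendsto B l (𝓝 0)) : Tendsto u l (𝓝 c) := by
  have h0 : Tendsto (fun k => (u k - c) ^ 2) l (𝓝 0) :=
    squeeze_zero (fun k => sq_nonneg _) h (by simpa using hB.const_mul C)
  have h1 := (Real.continuous_sqrt.tendsto 0).comp h0
  simp only [Function.comp_def, Real.sqrt_sq_eq_abs, Real.sqrt_zero] at h1
  exact tendsto_sub_nhds_zero_iff.1 ((tendsto_zero_iff_abs_tendsto_zero _).2 h1)

theorem tendsto_jet_of_jetSq (g : SmoothMetric n M) (x : M) {ι : Type*} {l : Filter ι}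
    {K : ι → Jet n} {J : Jet n} (h : Tendsto (fun k => jetSq g x (K k - J)) l (𝓝 0)) :
    Tendsto K l (𝓝 J) := by
  obtain ⟨C, hC⟩ := exists_component_sq_le g x
  refine Prod.tendsto_iff _ _ |>.2 ⟨?_, Prod.tendsto_iff _ _ |>.2 ⟨?_, ?_⟩⟩
  · exact tendsto_of_sq_sub_le C (fun k => (hC (K k - J)).1) h
  · exact tendsto_pi_nhds.2 fun i => tendsto_of_sq_sub_le C (fun k => (hC (K k - J)).2.1 i) h
  · exact tendsto_pi_nhds.2 fun i => tendsto_pi_nhds.2 fun j =>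
      tendsto_of_sq_sub_le C (fun k => (hC (K k - J)).2.2 i j) h

end PointwiseAlgebra

/-! ### Passing from smooth functions to the Sobolev space -/

section Approximation

variable {n : ℕ} {M : Type*} [TopologicalSpace M] [ChartedSpace (Model n) M]
  [IsManifold (𝓡 n) ∞ M] [MeasurableSpace M]

theorem exists_measurable_majorant_lt {X : Type*} [MeasurableSpace X] {μ : Measure X}
    {f : X → ℝ≥0∞} {c : ℝ≥0∞} (h : upperLIntegral μ f < c) :
    ∃ F : X → ℝ≥0∞, Measurable F ∧ (∀ x, f x ≤ F x) ∧ ∫⁻ x, F x ∂μ < c := by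
  obtain ⟨F, hF⟩ := iInf_lt_iff.1 h
  exact ⟨F.1, F.2.1, F.2.2, hF⟩

/-- As in the Riesz–Fischer theorem: along a subsequence the squared distances have measurable
majorants `F k` with integrals below `2⁻ᵏ`. Their sum is integrable, so `F k → 0` almost everywhere,
and `jetSq` controls every component. -/
theorem exists_approximation (g : SmoothMetric n M) {J : M → Jet n} (hJ : J ∈ preH22 g) :
    ∃ (φ : ℕ → M → ℝ) (F : ℕ → M → ℝ≥0∞), (∀ k, ContMDiff (𝓡 n) 𝓘(ℝ) ∞ (φ k)) ∧
      (∀ k, Measurable (F k)) ∧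
      (∀ k x, ENNReal.ofReal (jetSq g x (jet g (φ k) x - J x)) ≤ F k x) ∧
      (∀ k, ∫⁻ x, F k x ∂(vol g) ≠ ⊤) ∧
      Tendsto (fun k => ∫⁻ x, F k x ∂(vol g)) atTop (𝓝 0) ∧
      ∀ᵐ x ∂(vol g), Tendsto (fun k => jet g (φ k) x) atTop (𝓝 (J x)) := by
  obtain ⟨φ, hφ, hlim⟩ := hJ
  have hpos : ∀ k : ℕ, (0 : ℝ≥0∞) < (2⁻¹ : ℝ≥0∞) ^ k := fun k =>
    ENNReal.pow_pos (by simp) k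
  have hex : ∀ k : ℕ, ∃ m, jetDistSq g (φ m) J < (2⁻¹ : ℝ≥0∞) ^ k := fun k =>
    (hlim.eventually_lt_const (hpos k)).exists
  choose m hm using hex
  choose F hFm hFle hFint using fun k => exists_measurable_majorant_lt (hm k)
  have hsum : ∑' k, ∫⁻ x, F k x ∂(vol g) ≠ ⊤ := by
    refine ne_top_of_le_ne_top ?_ (ENNReal.tsum_le_tsum fun k => (hFint k).le)
    rw [ENNReal.tsum_geometric]
    simp
  refine ⟨fun k => φ (m k), F, fun k => hφ _, hFm, hFle, ENNReal.ne_top_of_tsum_ne_top hsum,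
    ENNReal.tendsto_atTop_zero_of_tsum_ne_top hsum, ?_⟩
  rw [← lintegral_tsum fun k => (hFm k).aemeasurable] at hsum
  filter_upwards [ae_lt_top (Measurable.tsum hFm) hsum] with x hx
  have hF0 := ENNReal.tendsto_atTop_zero_of_tsum_ne_top hx.ne
  refine tendsto_jet_of_jetSq g x ?_
  have h1 : Tendsto (fun k => ENNReal.ofReal (jetSq g x (jet g (φ (m k)) x - J x))) atTop (𝓝 0) :=
    tendsto_of_tendsto_of_tendsto_of_le_of_le tendsto_const_nhds hF0 (fun _ => zero_le)
      fun k => hFle k x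
  have h2 := (ENNReal.tendsto_toReal ENNReal.zero_ne_top).comp h1
  simpa [Function.comp_def, ENNReal.toReal_ofReal (jetSq_nonneg g x _)] using h2

variable {g : SmoothMetric n M} {J : M → Jet n} (hJ : J ∈ preH22 g)
include hJ

/-- An almost everywhere limit of measurable functions. The claim concerns scalar expressions `q`,
because the components of `J` refer to a chart that varies with the point. -/
theorem aemeasurable_of_mem_preH22 {q : M → Jet n → ℝ} (hq : ∀ x, Continuous (q x))
    (hqm : ∀ φ : M → ℝ, ContMDiff (𝓡 n) 𝓘(ℝ) ∞ φ → Measurable fun x => q x (jet g φ x)) :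
    AEMeasurable (fun x => q x (J x)) (vol g) := by
  obtain ⟨φ, F, hφ, -, -, -, -, hlim⟩ := exists_approximation g hJ
  refine aemeasurable_of_tendsto_metrizable_ae atTop (fun k => (hqm _ (hφ k)).aemeasurable) ?_
  filter_upwards [hlim] with x hx using ((hq x).tendsto _).comp hx

/-- Inequalities between integrals of quadratic expressions pass from smooth functions to the
Sobolev space. -/
theorem lintegral_le_of_mem_preH22 {q Q : M → Jet n → ℝ} {w : M → ℝ≥0∞}
    (hw : AEMeasurable w (vol g)) (hwt : ∀ x, w x ≠ ⊤) (hq : ∀ x, Continuous (q x))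
    (hqm : ∀ φ : M → ℝ, ContMDiff (𝓡 n) 𝓘(ℝ) ∞ φ → Measurable fun x => q x (jet g φ x))
    (hQ : ∀ x, Continuous (Q x))
    (hQm : ∀ φ : M → ℝ, ContMDiff (𝓡 n) 𝓘(ℝ) ∞ φ → Measurable fun x => Q x (jet g φ x))
    (hQ0 : ∀ x K, 0 ≤ Q x K) (hQadd : ∀ x K L, Q x (K + L) ≤ 2 * Q x K + 2 * Q x L) {c : ℝ}
    (hc : 0 ≤ c) (hQle : ∀ x K, Q x K ≤ c * jetSq g x K) {C : ℝ≥0∞} (hC : C ≠ ⊤)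
    (h : ∀ φ : M → ℝ, ContMDiff (𝓡 n) 𝓘(ℝ) ∞ φ →
      ∫⁻ x, w x * ENNReal.ofReal (q x (jet g φ x)) ∂(vol g) ≤
        C * ∫⁻ x, ENNReal.ofReal (Q x (jet g φ x)) ∂(vol g)) :
    ∫⁻ x, w x * ENNReal.ofReal (q x (J x)) ∂(vol g) ≤
      2 * C * ∫⁻ x, ENNReal.ofReal (Q x (J x)) ∂(vol g) := by
  have hQJ := aemeasurable_of_mem_preH22 hJ hQ hQm
  obtain ⟨φ, F, hφ, hFm, hFle, hFt, hF0, hlim⟩ := exists_approximation g hJ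
  -- Quasi-additivity of `Q` applied to `jet φₖ = J + (jet φₖ - J)`; this is where the factor 2 in
  -- the conclusion arises.
  have hstep : ∀ k, ∫⁻ x, ENNReal.ofReal (Q x (jet g (φ k) x)) ∂(vol g) ≤
      2 * ∫⁻ x, ENNReal.ofReal (Q x (J x)) ∂(vol g) +
        2 * ENNReal.ofReal c * ∫⁻ x, F k x ∂(vol g) := by
    intro k
    rw [← lintegral_const_mul' _ _ (by simp), ← lintegral_const_mul' _ _ (by finiteness),
      ← lintegral_add_left' (hQJ.ennreal_ofReal.const_mul 2)]
    refine lintegral_mono fun x => ?_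
    have h1 : Q x (jet g (φ k) x) ≤
        2 * Q x (J x) + 2 * (c * jetSq g x (jet g (φ k) x - J x)) := by
      have := hQadd x (J x) (jet g (φ k) x - J x)
      rw [add_sub_cancel] at this
      linarith [hQle x (jet g (φ k) x - J x)]
    have hj := mul_nonneg hc (jetSq_nonneg g x (jet g (φ k) x - J x))
    refine (ENNReal.ofReal_le_ofReal h1).trans ?_
    rw [ENNReal.ofReal_add (mul_nonneg zero_le_two (hQ0 _ _)) (mul_nonneg zero_le_two hj),
      ENNReal.ofReal_mul zero_le_two, ENNReal.ofReal_mul zero_le_two, ENNReal.ofReal_mul hc,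
      ENNReal.ofReal_ofNat, mul_assoc]
    exact add_le_add_right (mul_le_mul_right (mul_le_mul_right (hFle k x) _) _) _
  have hlim2 : Tendsto (fun k => C * (2 * ∫⁻ x, ENNReal.ofReal (Q x (J x)) ∂(vol g) +
      2 * ENNReal.ofReal c * ∫⁻ x, F k x ∂(vol g))) atTop
      (𝓝 (C * (2 * ∫⁻ x, ENNReal.ofReal (Q x (J x)) ∂(vol g) + 2 * ENNReal.ofReal c * 0))) :=
    ENNReal.Tendsto.const_mul (tendsto_const_nhds.add
      (ENNReal.Tendsto.const_mul hF0 (Or.inr (by finiteness)))) (Or.inr hC)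
  -- Fatou's lemma needs only pointwise convergence of the left-hand integrands; their integrability
  -- is not known beforehand and is a consequence.
  have hfatou : ∫⁻ x, w x * ENNReal.ofReal (q x (J x)) ∂(vol g) ≤
      liminf (fun k => ∫⁻ x, w x * ENNReal.ofReal (q x (jet g (φ k) x)) ∂(vol g)) atTop := by
    refine le_trans (le_of_eq (lintegral_congr_ae ?_)) (lintegral_liminf_le' fun k =>
      hw.mul (hqm _ (hφ k)).ennreal_ofReal.aemeasurable)
    filter_upwards [hlim] with x hx
    exact (ENNReal.Tendsto.const_mul (ENNReal.tendsto_ofReal (((hq x).tendsto _).comp hx))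
      (Or.inr (hwt x))).liminf_eq.symm
  refine hfatou.trans ((liminf_le_liminf (Eventually.of_forall fun k =>
    (h _ (hφ k)).trans (mul_le_mul_right (hstep k) C))).trans_eq ?_)
  rw [hlim2.liminf_eq]
  ring

end Approximation

/-! ### Integrability and the two main estimates on the Sobolev space -/

section RealEstimates

theorem integrable_of_lintegral_ofReal_ne_top {X : Type*} [MeasurableSpace X] {μ : Measure X}
    {f : X → ℝ} (hf : AEMeasurable f μ) (h0 : ∀ x, 0 ≤ f x)
    (h : ∫⁻ x, ENNReal.ofReal (f x) ∂μ ≠ ⊤) : Integrable f μ :=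
  ⟨hf.aestronglyMeasurable,
    (hasFiniteIntegral_iff_ofReal (Eventually.of_forall h0)).2 h.lt_top⟩

theorem integral_norm_le_of_lintegral_le {X E : Type*} [MeasurableSpace X] [NormedAddCommGroup E]
    {μ : Measure X} {f : X → E} {h : X → ℝ} (hf : AEStronglyMeasurable f μ) (hh : Integrable h μ)
    (h0 : ∀ x, 0 ≤ h x) {C : ℝ≥0∞} (hC : C ≠ ⊤)
    (hle : ∫⁻ x, ‖f x‖ₑ ∂μ ≤ C * ∫⁻ x, ENNReal.ofReal (h x) ∂μ) :
    Integrable f μ ∧ ∫ x, ‖f x‖ ∂μ ≤ C.toReal * ∫ x, h x ∂μ := by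
  have hfin : ∫⁻ x, ENNReal.ofReal (h x) ∂μ ≠ ⊤ :=
    ((hasFiniteIntegral_iff_ofReal (Eventually.of_forall h0)).1 hh.2).ne
  have htop : C * ∫⁻ x, ENNReal.ofReal (h x) ∂μ ≠ ⊤ := ENNReal.mul_ne_top hC hfin
  refine ⟨⟨hf, hle.trans_lt htop.lt_top⟩, ?_⟩
  rw [integral_norm_eq_lintegral_enorm hf, integral_eq_lintegral_of_nonneg_ae
    (Eventually.of_forall h0) hh.1, ← ENNReal.toReal_mul]
  exact ENNReal.toReal_mono htop hle

variable {n : ℕ} {M : Type*} [TopologicalSpace M] [ChartedSpace (Model n) M]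
  [IsManifold (𝓡 n) ∞ M] {g : SmoothMetric n M}

theorem continuous_jetSq_jet {φ : M → ℝ} (hφ : ContMDiff (𝓡 n) 𝓘(ℝ) ∞ φ) :
    Continuous fun x => jetSq g x (jet g φ x) :=
  ((hφ.continuous.pow 2).add (continuous_gradSqAt g hφ)).add (continuous_hessSqAt g hφ)

variable [MeasurableSpace M] [BorelSpace M]

section Integrability

variable {J : M → Jet n} (hJ : J ∈ preH22 g)
include hJ

theorem aemeasurable_fst : AEMeasurable (fun x => (J x).1) (vol g) :=
  aemeasurable_of_mem_preH22 hJ (q := fun _ K => K.1) (fun _ => continuous_fst)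
    fun _ hφ => hφ.continuous.measurable

theorem aemeasurable_covInner :
    AEMeasurable (fun x => covInner g x (J x).2.1 (J x).2.1) (vol g) :=
  aemeasurable_of_mem_preH22 hJ (q := fun x K => covInner g x K.2.1 K.2.1)
    (continuous_covInner_self g) fun _ hφ => (continuous_gradSqAt g hφ).measurable

theorem aemeasurable_tensorSq : AEMeasurable (fun x => tensorSq g x (J x).2.2) (vol g) :=
  aemeasurable_of_mem_preH22 hJ (q := fun x K => tensorSq g x K.2.2)
    (continuous_tensorSq g) fun _ hφ => (continuous_hessSqAt g hφ).measurable

theorem aemeasurable_tensorTrace : AEMeasurable (fun x => tensorTrace g x (J x).2.2) (vol g) :=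
  aemeasurable_of_mem_preH22 hJ (q := fun x K => tensorTrace g x K.2.2)
    (continuous_tensorTrace g) fun _ hφ => (continuous_lapAt g hφ).measurable

variable [T2Space M] [CompactSpace M]

theorem integrable_jetSq : Integrable (fun x => jetSq g x (J x)) (vol g) := by
  refine integrable_of_lintegral_ofReal_ne_top (((aemeasurable_fst hJ).pow_const 2).add
    (aemeasurable_covInner hJ) |>.add (aemeasurable_tensorSq hJ))
    (fun x => jetSq_nonneg g x _) ?_
  -- One approximant suffices: the jet of `φ 0` is square integrable by compactness, and `J` is at
  -- finite distance from it.
  obtain ⟨φ, F, hφ, hFm, hFle, hFt, -, -⟩ := exists_approximation g hJ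
  have hc : Integrable (fun x => jetSq g x (jet g (φ 0) x)) (vol g) :=
    (continuous_jetSq_jet (hφ 0)).integrable_of_hasCompactSupport
      (HasCompactSupport.of_compactSpace _)
  have hfin := ((hasFiniteIntegral_iff_ofReal
    (Eventually.of_forall fun x => jetSq_nonneg g x _)).1 hc.2).ne
  have hle : ∫⁻ x, ENNReal.ofReal (jetSq g x (J x)) ∂(vol g) ≤
      2 * ∫⁻ x, ENNReal.ofReal (jetSq g x (jet g (φ 0) x)) ∂(vol g) +
        2 * ∫⁻ x, F 0 x ∂(vol g) := by
    rw [← lintegral_const_mul' _ _ (by simp), ← lintegral_const_mul' _ _ (by simp),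
      ← lintegral_add_right _ ((hFm 0).const_mul 2)]
    refine lintegral_mono fun x => ?_
    have h1 := jetSq_add_le g x (jet g (φ 0) x) ((-1 : ℝ) • (jet g (φ 0) x - J x))
    rw [jetSq_smul] at h1
    have e : jet g (φ 0) x + (-1 : ℝ) • (jet g (φ 0) x - J x) = J x := by
      rw [neg_one_smul]; abel
    rw [e] at h1
    have j1 := jetSq_nonneg g x (jet g (φ 0) x)
    have j2 := jetSq_nonneg g x (jet g (φ 0) x - J x)
    refine (ENNReal.ofReal_le_ofReal (h1.trans_eq (by ring : _ = 2 * jetSq g x (jet g (φ 0) x) +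
      2 * jetSq g x (jet g (φ 0) x - J x)))).trans ?_
    rw [ENNReal.ofReal_add (by positivity) (by positivity), ENNReal.ofReal_mul zero_le_two,
      ENNReal.ofReal_mul zero_le_two, ENNReal.ofReal_ofNat]
    exact add_le_add_right (mul_le_mul_right (hFle 0 x) _) _
  have := hFt 0
  exact ne_top_of_le_ne_top (by finiteness) hle

theorem integrable_fst_sq : Integrable (fun x => (J x).1 ^ 2) (vol g) :=
  (integrable_jetSq hJ).mono' ((aemeasurable_fst hJ).pow_const 2).aestronglyMeasurable
    (Eventually.of_forall fun x => by
      rw [Real.norm_of_nonneg (sq_nonneg _), jetSq, add_assoc]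
      exact le_add_of_nonneg_right (add_nonneg (covInner_self_nonneg g x _)
        (tensorSq_nonneg g x _)))

theorem integrable_covInner :
    Integrable (fun x => covInner g x (J x).2.1 (J x).2.1) (vol g) :=
  (integrable_jetSq hJ).mono' (aemeasurable_covInner hJ).aestronglyMeasurable
    (Eventually.of_forall fun x => by
      rw [Real.norm_of_nonneg (covInner_self_nonneg g x _), jetSq]
      linarith [sq_nonneg (J x).1, tensorSq_nonneg g x (J x).2.2])

theorem integrable_tensorSq : Integrable (fun x => tensorSq g x (J x).2.2) (vol g) :=
  (integrable_jetSq hJ).mono' (aemeasurable_tensorSq hJ).aestronglyMeasurable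
    (Eventually.of_forall fun x => by
      rw [Real.norm_of_nonneg (tensorSq_nonneg g x _), jetSq]
      linarith [sq_nonneg (J x).1, covInner_self_nonneg g x (J x).2.1])

theorem integrable_tensorTrace_sq :
    Integrable (fun x => tensorTrace g x (J x).2.2 ^ 2) (vol g) :=
  ((integrable_tensorSq hJ).const_mul (n : ℝ)).mono'
    ((aemeasurable_tensorTrace hJ).pow_const 2).aestronglyMeasurable
    (Eventually.of_forall fun x => by
      rw [Real.norm_of_nonneg (sq_nonneg _)]
      exact tensorTrace_sq_le g x _)

theorem integral_tensorTrace_sq_le :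
    ∫ x, tensorTrace g x (J x).2.2 ^ 2 ∂(vol g) ≤ n * ∫ x, tensorSq g x (J x).2.2 ∂(vol g) := by
  rw [← integral_const_mul]
  exact integral_mono (integrable_tensorTrace_sq hJ) ((integrable_tensorSq hJ).const_mul _)
    fun x => tensorTrace_sq_le g x _

theorem integral_jetSq : ∫ x, jetSq g x (J x) ∂(vol g) = ∫ x, (J x).1 ^ 2 ∂(vol g) +
    ∫ x, covInner g x (J x).2.1 (J x).2.1 ∂(vol g) + ∫ x, tensorSq g x (J x).2.2 ∂(vol g) := by
  rw [← integral_add' (integrable_fst_sq hJ) (integrable_covInner hJ),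
    ← integral_add' ((integrable_fst_sq hJ).add (integrable_covInner hJ)) (integrable_tensorSq hJ)]
  rfl

end Integrability

variable [T2Space M] [CompactSpace M]

/-- The `L²` norm of the Hessian is controlled by the Laplacian and the gradient. -/
theorem exists_integral_tensorSq_le (g : SmoothMetric n M) :
    ∃ C : ℝ, 0 ≤ C ∧ ∀ J ∈ preH22 g, ∫ x, tensorSq g x (J x).2.2 ∂(vol g) ≤
      C * ∫ x, (tensorTrace g x (J x).2.2 ^ 2 + covInner g x (J x).2.1 (J x).2.1) ∂(vol g) := by
  obtain ⟨C, hC, h⟩ := exists_lintegral_hessSqAt_le g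
  refine ⟨(2 * C).toReal, ENNReal.toReal_nonneg, fun J hJ => ?_⟩
  have key := lintegral_le_of_mem_preH22 hJ (q := fun x K => tensorSq g x K.2.2)
    (Q := fun x K => tensorTrace g x K.2.2 ^ 2 + covInner g x K.2.1 K.2.1) (w := fun _ => 1)
    aemeasurable_const (fun _ => ENNReal.one_ne_top) (continuous_tensorSq g)
    (fun _ hφ => (continuous_hessSqAt g hφ).measurable)
    (fun x => ((continuous_tensorTrace g x).pow 2).add (continuous_covInner_self g x))
    (fun _ hφ => (((continuous_lapAt g hφ).pow 2).add (continuous_gradSqAt g hφ)).measurable)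
    (fun x K => add_nonneg (sq_nonneg _) (covInner_self_nonneg g x _))
    (fun x K L => by
      have h1 := covInner_add_self_le g x K.2.1 L.2.1
      have h2 := sq_nonneg (tensorTrace g x K.2.2 - tensorTrace g x L.2.2)
      have h3 := tensorTrace_add g x K.2.2 L.2.2
      simp only [Prod.snd_add, Prod.fst_add, h3]
      nlinarith)
    -- `(tr η)² ≤ n |η|²` makes the right-hand density at most `n + 1` times `jetSq`.
    (c := n + 1) (by positivity)
    (fun x K => by
      have h1 := tensorTrace_sq_le g x K.2.2
      have h2 := covInner_self_nonneg g x K.2.1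
      have h3 := tensorSq_nonneg g x K.2.2
      have h4 := sq_nonneg K.1
      have h5 : 0 ≤ (n : ℝ) * (K.1 ^ 2 + covInner g x K.2.1 K.2.1) := by positivity
      simp only [jetSq]
      nlinarith)
    hC (fun φ hφ => by simp only [one_mul]; exact h φ hφ)
  simp only [one_mul] at key
  have h2 : 2 * C ≠ ⊤ := by finiteness
  have := (integral_norm_le_of_lintegral_le
    (f := fun x => tensorSq g x (J x).2.2) (aemeasurable_tensorSq hJ).aestronglyMeasurable
    ((integrable_tensorTrace_sq hJ).add (integrable_covInner hJ))
    (fun x => add_nonneg (sq_nonneg _) (covInner_self_nonneg g x _)) h2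
    (le_trans (le_of_eq (lintegral_congr fun x =>
      Real.enorm_of_nonneg (tensorSq_nonneg g x _))) key)).2
  simp only [Real.norm_of_nonneg (tensorSq_nonneg g _ _)] at this
  exact this

/-- The lower order terms are controlled by the `L²` norm of the jet. -/
theorem exists_integral_lower_order_le (g : SmoothMetric n M) (hn : 5 ≤ n) {r s : ℝ≥0∞}
    (hr : (n : ℝ≥0∞) / 2 < r) (hs : (n : ℝ≥0∞) / 4 < s) {a b : M → ℝ}
    (ha : MemLp a r (vol g)) (hb : MemLp b s (vol g)) :
    ∃ C : ℝ, 0 ≤ C ∧ ∀ J ∈ preH22 g,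
      (Integrable (fun x => a x * covInner g x (J x).2.1 (J x).2.1) (vol g) ∧
        ∫ x, ‖a x * covInner g x (J x).2.1 (J x).2.1‖ ∂(vol g) ≤
          C * ∫ x, jetSq g x (J x) ∂(vol g)) ∧
      (Integrable (fun x => b x * (J x).1 ^ 2) (vol g) ∧
        ∫ x, ‖b x * (J x).1 ^ 2‖ ∂(vol g) ≤ C * ∫ x, jetSq g x (J x) ∂(vol g)) := by
  obtain ⟨C, hC, h⟩ := exists_lintegral_lower_order_le g hn hr hs ha hb
  refine ⟨(2 * C).toReal, ENNReal.toReal_nonneg, fun J hJ => ?_⟩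
  have h2 : 2 * C ≠ ⊤ := by finiteness
  have hQle : ∀ (x : M) (K : Jet n), jetSq g x K ≤ 1 * jetSq g x K := fun x K =>
    (one_mul (jetSq g x K)).ge
  constructor
  · refine integral_norm_le_of_lintegral_le
      (ha.1.mul (aemeasurable_covInner hJ).aestronglyMeasurable) (integrable_jetSq hJ)
      (fun x => jetSq_nonneg g x _) h2 ?_
    refine le_trans (le_of_eq (lintegral_congr fun x => ?_)) (lintegral_le_of_mem_preH22 hJ
      (q := fun x K => covInner g x K.2.1 K.2.1) (Q := jetSq g) ha.1.enorm
      (fun _ => enorm_ne_top) (continuous_covInner_self g)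
      (fun _ hφ => (continuous_gradSqAt g hφ).measurable) (continuous_jetSq g)
      (fun _ hφ => (continuous_jetSq_jet hφ).measurable) (jetSq_nonneg g) (jetSq_add_le g)
      zero_le_one hQle hC fun φ hφ => (h φ hφ).1)
    rw [Pi.mul_apply, enorm_mul, Real.enorm_of_nonneg (covInner_self_nonneg g x _)]
  · refine integral_norm_le_of_lintegral_le
      (hb.1.mul ((aemeasurable_fst hJ).pow_const 2).aestronglyMeasurable) (integrable_jetSq hJ)
      (fun x => jetSq_nonneg g x _) h2 ?_
    refine le_trans (le_of_eq (lintegral_congr fun x => ?_)) (lintegral_le_of_mem_preH22 hJ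
      (q := fun _ K => K.1 ^ 2) (Q := jetSq g) hb.1.enorm
      (fun _ => enorm_ne_top) (fun _ => continuous_fst.pow 2)
      (fun _ hφ => (hφ.continuous.pow 2).measurable) (continuous_jetSq g)
      (fun _ hφ => (continuous_jetSq_jet hφ).measurable) (jetSq_nonneg g) (jetSq_add_le g)
      zero_le_one hQle hC fun φ hφ => (h φ hφ).2)
    rw [Pi.mul_apply, enorm_mul, Real.enorm_of_nonneg (sq_nonneg _)]

end RealEstimates

/-! ### Representatives of Sobolev classes -/

section Representatives

variable {n : ℕ} {M : Type*} [TopologicalSpace M] [ChartedSpace (Model n) M]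
  [IsManifold (𝓡 n) ∞ M] [MeasurableSpace M] {g : SmoothMetric n M}

theorem H22.rep_mem (u : H22 g) : u.rep ∈ preH22 g := (Quotient.out u : preH22 g).2

theorem H22.mk_out (u : H22 g) : Submodule.Quotient.mk (Quotient.out u : preH22 g) = u :=
  Quotient.out_eq u

/-- `rep` is a choice of representative, so it is linear only up to a triple that vanishes almost
everywhere. -/
theorem H22.rep_add_smul (u v : H22 g) (t : ℝ) :
    ∀ᵐ x ∂(vol g), (u + t • v).rep x = u.rep x + t • v.rep x := by
  have h : Submodule.Quotient.mk (p := nullH22 g) (Quotient.out (u + t • v) : preH22 g) =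
      Submodule.Quotient.mk (Quotient.out u + t • Quotient.out v : preH22 g) := by
    rw [Submodule.Quotient.mk_add, Submodule.Quotient.mk_smul, H22.mk_out, H22.mk_out, H22.mk_out]
  have h2 : ∀ᵐ x ∂(vol g), (u + t • v).rep x - (u.rep x + t • v.rep x) = 0 :=
    (Submodule.Quotient.eq _).1 h
  filter_upwards [h2] with x hx using sub_eq_zero.1 hx

theorem H22.rep_add (u v : H22 g) : ∀ᵐ x ∂(vol g), (u + v).rep x = u.rep x + v.rep x := by
  simpa only [one_smul] using H22.rep_add_smul u v 1

theorem H22.eq_zero_of_rep {u : H22 g} (h : ∀ᵐ x ∂(vol g), u.rep x = 0) : u = 0 := by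
  rw [← H22.mk_out u]
  exact (Submodule.Quotient.mk_eq_zero _).2 h

end Representatives

/-! ### Norms from quadratic forms -/

section Norms

/-- The square root of a positive definite quadratic form is a norm. -/
theorem isNorm_sqrt_of_quadratic {V : Type*} [AddCommGroup V] [Module ℝ V] {Q : V → ℝ}
    (hQ : ∀ u v (t : ℝ), Q (u + t • v) = Q u + t * (Q (u + v) - Q u - Q v) + t ^ 2 * Q v)
    (h0 : ∀ u, 0 ≤ Q u) (hzero : ∀ u, Q u = 0 → u = 0) : IsNorm fun u => Real.sqrt (Q u) where
  nonneg u := Real.sqrt_nonneg _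
  eq_zero u hu := hzero u ((Real.sqrt_eq_zero (h0 u)).1 hu)
  smul c u := by
    -- The law at `u = v = 0`, `t = 2` reads `Q 0 = 3 Q 0`.
    have e0 : Q 0 = 0 := by
      have := hQ 0 0 2
      simp only [smul_zero, add_zero] at this
      linarith
    have e1 : Q (c • u) = c ^ 2 * Q u := by
      have := hQ 0 u c
      simp only [zero_add, e0] at this
      linarith
    simp only [e1]
    rw [Real.sqrt_mul (sq_nonneg c), Real.sqrt_sq_eq_abs]
  triangle u v := by
    -- The quadratic polynomial `t ↦ Q (u + t • v)` is nonnegative, so its discriminant is not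
    -- positive: this is the Cauchy–Schwarz inequality.
    have hd := discrim_le_zero (a := Q v) (b := Q (u + v) - Q u - Q v) (c := Q u) fun t => by
      have := h0 (u + t • v)
      rw [hQ] at this
      linarith
    rw [discrim] at hd
    have h1 : (Q (u + v) - Q u - Q v) ^ 2 ≤ (2 * (Real.sqrt (Q u) * Real.sqrt (Q v))) ^ 2 := by
      rw [mul_pow, mul_pow, Real.sq_sqrt (h0 u), Real.sq_sqrt (h0 v)]
      linarith
    have h2 : Q (u + v) - Q u - Q v ≤ 2 * (Real.sqrt (Q u) * Real.sqrt (Q v)) :=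
      (le_abs_self _).trans (abs_le_of_sq_le_sq h1 (by positivity))
    refine Real.sqrt_le_iff.2 ⟨by positivity, ?_⟩
    nlinarith [Real.sq_sqrt (h0 u), Real.sq_sqrt (h0 v)]

variable {n : ℕ} {M : Type*} [TopologicalSpace M] [ChartedSpace (Model n) M]
  [IsManifold (𝓡 n) ∞ M] {g : SmoothMetric n M}

/-- The integrand `(tr η)² - a |ξ|² + b s²` of the quadratic form. -/
def quadDensity (g : SmoothMetric n M) (a b : M → ℝ) (x : M) (J : Jet n) : ℝ :=
  tensorTrace g x J.2.2 ^ 2 - a x * covInner g x J.2.1 J.2.1 + b x * J.1 ^ 2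

theorem quadDensity_add_smul (a b : M → ℝ) (x : M) (J K : Jet n) (t : ℝ) :
    quadDensity g a b x (J + t • K) = quadDensity g a b x J +
      t * (quadDensity g a b x (J + K) - quadDensity g a b x J - quadDensity g a b x K) +
        t ^ 2 * quadDensity g a b x K := by
  simp only [quadDensity, Prod.snd_add, Prod.fst_add, Prod.smul_snd, Prod.smul_fst,
    tensorTrace_add, tensorTrace_smul, smul_eq_mul, covInner_add_smul_self g x t]
  ring

variable [MeasurableSpace M]

theorem H22.pairing_self (a b : M → ℝ) (u : H22 g) : H22.pairing a b u u = u.quadForm a b := by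
  refine integral_congr_ae (Eventually.of_forall fun x => ?_)
  simp only [H22.gradSq, sq]

theorem H22.quadForm_add_smul {a b : M → ℝ}
    (hint : ∀ J ∈ preH22 g, Integrable (fun x => quadDensity g a b x (J x)) (vol g))
    (u v : H22 g) (t : ℝ) :
    (u + t • v).quadForm a b = u.quadForm a b +
      t * ((u + v).quadForm a b - u.quadForm a b - v.quadForm a b) + t ^ 2 * v.quadForm a b := by
  have hi : ∀ w : H22 g, Integrable (fun x => quadDensity g a b x (w.rep x)) (vol g) :=
    fun w => hint _ w.rep_mem
  change ∫ x, quadDensity g a b x ((u + t • v).rep x) ∂(vol g) =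
    ∫ x, quadDensity g a b x (u.rep x) ∂(vol g) +
      t * (∫ x, quadDensity g a b x ((u + v).rep x) ∂(vol g) -
        ∫ x, quadDensity g a b x (u.rep x) ∂(vol g) -
        ∫ x, quadDensity g a b x (v.rep x) ∂(vol g)) +
      t ^ 2 * ∫ x, quadDensity g a b x (v.rep x) ∂(vol g)
  rw [← integral_sub (hi _) (hi _), ← integral_sub ((hi _).sub' (hi _)) (hi _),
    ← integral_const_mul, ← integral_const_mul,
    ← integral_add (hi _) ((((hi _).sub' (hi _)).sub' (hi _)).const_mul _),
    ← integral_add (f := fun x => quadDensity g a b x (u.rep x) + t *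
        (quadDensity g a b x ((u + v).rep x) - quadDensity g a b x (u.rep x) -
          quadDensity g a b x (v.rep x)))
      ((hi _).add ((((hi _).sub' (hi _)).sub' (hi _)).const_mul _)) ((hi _).const_mul _)]
  refine integral_congr_ae ?_
  filter_upwards [H22.rep_add_smul u v t, H22.rep_add u v] with x h1 h2
  rw [h1, h2]
  exact quadDensity_add_smul a b x _ _ t

end Norms

/-! ### Comparison of the energy with the norms and the quadratic form -/

section Comparison

variable {n : ℕ} {M : Type*} [TopologicalSpace M] [ChartedSpace (Model n) M]
  [IsManifold (𝓡 n) ∞ M] [MeasurableSpace M] {g : SmoothMetric n M}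

/-- `∫ (u² + |∇u|² + |∇²u|²)`. -/
def H22.energy (u : H22 g) : ℝ := ∫ x, jetSq g x (u.rep x) ∂(vol g)

theorem H22.integral_fn_sq_nonneg (u : H22 g) : 0 ≤ ∫ x, u.fn x ^ 2 ∂(vol g) :=
  integral_nonneg fun _ => sq_nonneg _

theorem H22.integral_gradSq_nonneg (u : H22 g) : 0 ≤ ∫ x, u.gradSq x ∂(vol g) :=
  integral_nonneg fun x => covInner_self_nonneg g x _

theorem H22.integral_hessSq_nonneg (u : H22 g) : 0 ≤ ∫ x, u.hessSq x ∂(vol g) :=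
  integral_nonneg fun x => tensorSq_nonneg g x _

theorem H22.energy_nonneg (u : H22 g) : 0 ≤ u.energy :=
  integral_nonneg fun x => jetSq_nonneg g x _

theorem H22.stdNorm_nonneg (u : H22 g) : 0 ≤ u.stdNorm := by
  unfold H22.stdNorm
  positivity

variable [T2Space M] [CompactSpace M] [BorelSpace M]

theorem H22.energy_eq (u : H22 g) : u.energy = ∫ x, u.fn x ^ 2 ∂(vol g) +
    ∫ x, u.gradSq x ∂(vol g) + ∫ x, u.hessSq x ∂(vol g) := integral_jetSq u.rep_mem

theorem H22.energy_le_stdNorm_sq (u : H22 g) : u.energy ≤ u.stdNorm ^ 2 := by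
  rw [u.energy_eq, H22.stdNorm]
  have h1 := Real.sq_sqrt u.integral_fn_sq_nonneg
  have h2 := Real.sq_sqrt u.integral_gradSq_nonneg
  have h3 := Real.sq_sqrt u.integral_hessSq_nonneg
  have n1 := Real.sqrt_nonneg (∫ x, u.fn x ^ 2 ∂(vol g))
  have n2 := Real.sqrt_nonneg (∫ x, u.gradSq x ∂(vol g))
  have n3 := Real.sqrt_nonneg (∫ x, u.hessSq x ∂(vol g))
  nlinarith [mul_nonneg n1 n2, mul_nonneg n1 n3, mul_nonneg n2 n3]

theorem H22.stdNorm_sq_le (u : H22 g) : u.stdNorm ^ 2 ≤ 3 * u.energy := by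
  rw [u.energy_eq, H22.stdNorm]
  have h1 := Real.sq_sqrt u.integral_fn_sq_nonneg
  have h2 := Real.sq_sqrt u.integral_gradSq_nonneg
  have h3 := Real.sq_sqrt u.integral_hessSq_nonneg
  generalize Real.sqrt (∫ x, u.fn x ^ 2 ∂(vol g)) = p at *
  generalize Real.sqrt (∫ x, u.gradSq x ∂(vol g)) = q at *
  generalize Real.sqrt (∫ x, u.hessSq x ∂(vol g)) = r at *
  nlinarith [sq_nonneg (p - q), sq_nonneg (p - r), sq_nonneg (q - r)]

theorem H22.eq_zero_of_energy {u : H22 g} (h : u.energy = 0) : u = 0 := by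
  refine H22.eq_zero_of_rep ?_
  have := (integral_eq_zero_iff_of_nonneg (fun x => jetSq_nonneg g x (u.rep x))
    (integrable_jetSq u.rep_mem)).1 h
  filter_upwards [this] with x hx using eq_zero_of_jetSq_eq_zero g x hx

theorem H22.lapNorm_sq (u : H22 g) : u.lapNorm ^ 2 = ∫ x, u.lap x ^ 2 ∂(vol g) +
    ∫ x, u.gradSq x ∂(vol g) + ∫ x, u.fn x ^ 2 ∂(vol g) := by
  have hL := integrable_tensorTrace_sq u.rep_mem
  have hG := integrable_covInner u.rep_mem
  have hF := integrable_fst_sq u.rep_mem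
  have h0 : 0 ≤ ∫ x, (u.lap x ^ 2 + u.gradSq x + u.fn x ^ 2) ∂(vol g) :=
    integral_nonneg fun x => add_nonneg (add_nonneg (sq_nonneg _)
      (covInner_self_nonneg g x _)) (sq_nonneg _)
  rw [H22.lapNorm, Real.sq_sqrt h0]
  exact (integral_add (hL.add hG) hF).trans (congrArg (· + _) (integral_add hL hG))

theorem H22.integral_lap_sq_le (u : H22 g) :
    ∫ x, u.lap x ^ 2 ∂(vol g) ≤ n * ∫ x, u.hessSq x ∂(vol g) :=
  integral_tensorTrace_sq_le u.rep_mem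

theorem H22.lapNorm_sq_le (u : H22 g) (hn : 1 ≤ n) : u.lapNorm ^ 2 ≤ n * u.energy := by
  have hn' : (1 : ℝ) ≤ n := by exact_mod_cast hn
  rw [u.lapNorm_sq, u.energy_eq]
  nlinarith [u.integral_lap_sq_le, u.integral_fn_sq_nonneg, u.integral_gradSq_nonneg]

/-- The deep half of the comparison with `lapNorm`: the Hessian is recovered from its trace by the
elliptic estimate. -/
theorem H22.exists_energy_le (g : SmoothMetric n M) :
    ∃ C : ℝ, 0 < C ∧ ∀ u : H22 g, u.energy ≤ C * u.lapNorm ^ 2 := by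
  obtain ⟨C, hC, h⟩ := exists_integral_tensorSq_le g
  refine ⟨1 + C, by positivity, fun u => ?_⟩
  have h1 : ∫ x, u.hessSq x ∂(vol g) ≤
      C * (∫ x, u.lap x ^ 2 ∂(vol g) + ∫ x, u.gradSq x ∂(vol g)) :=
    (h _ u.rep_mem).trans_eq (congrArg (C * ·) (integral_add
      (integrable_tensorTrace_sq u.rep_mem) (integrable_covInner u.rep_mem)))
  have h2 : 0 ≤ ∫ x, u.lap x ^ 2 ∂(vol g) := integral_nonneg fun _ => sq_nonneg _
  rw [u.lapNorm_sq, u.energy_eq]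
  nlinarith [u.integral_fn_sq_nonneg, u.integral_gradSq_nonneg]

theorem integrable_quadDensity {a b : M → ℝ} {J : M → Jet n} (hJ : J ∈ preH22 g)
    (ha : Integrable (fun x => a x * covInner g x (J x).2.1 (J x).2.1) (vol g))
    (hb : Integrable (fun x => b x * (J x).1 ^ 2) (vol g)) :
    Integrable (fun x => quadDensity g a b x (J x)) (vol g) :=
  ((integrable_tensorTrace_sq hJ).sub ha).add hb

theorem H22.quadForm_le {a b : M → ℝ} {C : ℝ} (u : H22 g)
    (ha : Integrable (fun x => a x * u.gradSq x) (vol g))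
    (ha' : ∫ x, ‖a x * u.gradSq x‖ ∂(vol g) ≤ C * u.energy)
    (hb : Integrable (fun x => b x * u.fn x ^ 2) (vol g))
    (hb' : ∫ x, ‖b x * u.fn x ^ 2‖ ∂(vol g) ≤ C * u.energy) :
    u.quadForm a b ≤ (n + 2 * C) * u.energy := by
  have hL := integrable_tensorTrace_sq u.rep_mem
  have h1 : u.quadForm a b = ∫ x, u.lap x ^ 2 ∂(vol g) - ∫ x, a x * u.gradSq x ∂(vol g) +
      ∫ x, b x * u.fn x ^ 2 ∂(vol g) :=
    (integral_add (hL.sub' ha) hb).trans (congrArg (· + _) (integral_sub hL ha))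
  have h2 := (norm_integral_le_integral_norm (fun x => a x * u.gradSq x)).trans ha'
  have h3 := (norm_integral_le_integral_norm (fun x => b x * u.fn x ^ 2)).trans hb'
  rw [Real.norm_eq_abs] at h2 h3
  have h4 : ∫ x, u.lap x ^ 2 ∂(vol g) ≤ n * u.energy := by
    refine u.integral_lap_sq_le.trans (mul_le_mul_of_nonneg_left ?_ (Nat.cast_nonneg n))
    rw [u.energy_eq]
    linarith [u.integral_fn_sq_nonneg, u.integral_gradSq_nonneg]
  linarith [neg_le_of_abs_le h2, le_of_abs_le h3]

end Comparison

end SobolevH22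

end

/-! ### The equivalence -/

theorem mainTheorem6 {n : ℕ} (hn : 5 ≤ n)
    {M : Type*} [TopologicalSpace M] [T2Space M] [CompactSpace M]
    [ChartedSpace (EuclideanSpace ℝ (Fin n)) M] [IsManifold (𝓡 n) ∞ M]
    [MeasurableSpace M] [BorelSpace M]
    (g : SobolevH22.SmoothMetric n M)
    {r s : ℝ≥0∞} (hr : (n : ℝ≥0∞) / 2 < r) (hs : (n : ℝ≥0∞) / 4 < s)
    {a b : M → ℝ} (ha : MemLp a r (SobolevH22.vol g)) (hb : MemLp b s (SobolevH22.vol g)) :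
    (∀ u : SobolevH22.H22 g,
      Integrable (fun x => u.fn x ^ 2) (SobolevH22.vol g) ∧
      Integrable (fun x => u.gradSq x) (SobolevH22.vol g) ∧
      Integrable (fun x => u.hessSq x) (SobolevH22.vol g) ∧
      Integrable (fun x => u.lap x ^ 2) (SobolevH22.vol g) ∧
      Integrable (fun x => a x * u.gradSq x) (SobolevH22.vol g) ∧
      Integrable (fun x => b x * u.fn x ^ 2) (SobolevH22.vol g)) ∧
    (((∀ u : SobolevH22.H22 g, 0 ≤ u.quadForm a b) ∧
      SobolevH22.IsEquivalentNorm
        (fun u : SobolevH22.H22 g => Real.sqrt (u.quadForm a b))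
        (fun u : SobolevH22.H22 g => u.stdNorm)) ↔
      SobolevH22.IsCoercive g a b) := by
  obtain ⟨C, hC, hlow⟩ := SobolevH22.exists_integral_lower_order_le g hn hr hs ha hb
  have hlow' : ∀ u : SobolevH22.H22 g, _ := fun u => hlow _ u.rep_mem
  refine ⟨fun u => ⟨SobolevH22.integrable_fst_sq u.rep_mem,
    SobolevH22.integrable_covInner u.rep_mem, SobolevH22.integrable_tensorSq u.rep_mem,
    SobolevH22.integrable_tensorTrace_sq u.rep_mem, (hlow' u).1.1, (hlow' u).2.1⟩, ?_, ?_⟩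
  · rintro ⟨hnonneg, -, c, _, hc, -, hequiv⟩
    have hn0 : (0 : ℝ) < n := by
      have : 0 < n := by omega
      exact_mod_cast this
    -- `c²` comes from the lower norm bound, and `1/n` from `(Δu)² ≤ n |∇²u|²`.
    refine ⟨c ^ 2 / n, by positivity, fun u => ?_⟩
    rw [u.pairing_self]
    have h1 : (c * u.stdNorm) ^ 2 ≤ u.quadForm a b :=
      (Real.le_sqrt (mul_nonneg hc.le u.stdNorm_nonneg) (hnonneg u)).1 (hequiv u).1
    calc c ^ 2 / n * u.lapNorm ^ 2 ≤ c ^ 2 / n * (n * u.energy) :=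
          mul_le_mul_of_nonneg_left (u.lapNorm_sq_le (by omega)) (by positivity)
      _ = c ^ 2 * u.energy := by field_simp
      _ ≤ c ^ 2 * u.stdNorm ^ 2 :=
          mul_le_mul_of_nonneg_left u.energy_le_stdNorm_sq (sq_nonneg c)
      _ = (c * u.stdNorm) ^ 2 := by ring
      _ ≤ u.quadForm a b := h1
  · rintro ⟨Λ, hΛ, hcoer⟩
    obtain ⟨D, hD, henergy⟩ := SobolevH22.H22.exists_energy_le g
    -- Coercivity is stated for `lapNorm`; the elliptic estimate turns it into a bound by the full
    -- energy, which yields nonnegativity, definiteness and the lower norm bound together.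
    have hlower : ∀ u : SobolevH22.H22 g, Λ / D * u.energy ≤ u.quadForm a b := fun u => by
      rw [← u.pairing_self]
      refine le_trans ?_ (hcoer u)
      rw [div_mul_eq_mul_div, div_le_iff₀ hD, mul_assoc, mul_comm _ D]
      exact mul_le_mul_of_nonneg_left (henergy u) hΛ.le
    have hnonneg : ∀ u : SobolevH22.H22 g, 0 ≤ u.quadForm a b := fun u =>
      (mul_nonneg (by positivity) u.energy_nonneg).trans (hlower u)
    -- In the lower constant `Λ / D / 3`, the 3 compares the square of the sum of three `L²` norms
    -- with the sum of their squares. In `n + 2C`, `n` bounds the Laplacian term and each lower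
    -- order term contributes one `C`.
    refine ⟨hnonneg, SobolevH22.isNorm_sqrt_of_quadratic
      (SobolevH22.H22.quadForm_add_smul fun J hJ =>
        SobolevH22.integrable_quadDensity hJ (hlow J hJ).1.1 (hlow J hJ).2.1) hnonneg
      fun u hu => ?_, Real.sqrt (Λ / D / 3), Real.sqrt (n + 2 * C), by positivity, ?_,
      fun u => ⟨?_, ?_⟩⟩
    · refine SobolevH22.H22.eq_zero_of_energy (le_antisymm ?_ u.energy_nonneg)
      have := hlower u
      rw [hu] at this
      exact nonpos_of_mul_nonpos_right this (by positivity)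
    · have : 0 < n := by omega
      positivity
    · simp only
      rw [← Real.sqrt_sq u.stdNorm_nonneg, ← Real.sqrt_mul (by positivity)]
      refine Real.sqrt_le_sqrt (le_trans ?_ (hlower u))
      calc Λ / D / 3 * u.stdNorm ^ 2 ≤ Λ / D / 3 * (3 * u.energy) :=
            mul_le_mul_of_nonneg_left u.stdNorm_sq_le (by positivity)
        _ = Λ / D * u.energy := by ring
    · simp only
      rw [← Real.sqrt_sq u.stdNorm_nonneg, ← Real.sqrt_mul (by positivity)]
      refine Real.sqrt_le_sqrt ((u.quadForm_le (hlow' u).1.1 (hlow' u).1.2 (hlow' u).2.1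
        (hlow' u).2.2).trans ?_)
      exact mul_le_mul_of_nonneg_left u.energy_le_stdNorm_sq (by positivity)
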